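/- **Model.** Fix a maximum degree $\Delta\ge 3$ and $\alpha\ge 1$. An input is a simple graph $G=(V,E)$ with $n$ nodes and maximum degree at most $\Delta$, with a port ordering (a bijection between the edges at $v$ and $\{1,\dots,\deg v\}$ for each node $v$), distinct identifiers from $\{1,\dots,\lfloor n^\alpha\rfloor\}$, and an input label for each node. An execution of an algorithm $A$ initiated at $v$ knows $n$ and the identifier, degree and label of $v$, and keeps a set $V_v$ of visited nodes, initially $\{v\}$. In each step it adaptively chooses $w\in V_v$ and a port $j\le\deg w$; it learns the identifier, degree and label of the $j$-th neighbour $u$ of $w$, and $u$ is added to $V_v$. Eventually it halts with an output for $v$. A randomized algorithm may also read, one by one, the bits of the private random strings of visited nodes (all bits are independent and fair), which count as a part of the input. The volume cost $\mathrm{VOL}_n(A)$ and the distance cost $\mathrm{DIST}_n(A)$ are the suprema of $|V_v|$ and of $\max_{w\in V_v}\mathrm{dist}(v,w)$ over all inputs with at most $n$ nodes and all initial nodes $v$. A deterministic algorithm solves a problem if its outputs are valid on every input; a randomized one, if on every input they are valid with probability at least $1-C/n$, where $C>0$ is a constant. D-DIST, D-VOL, R-DIST, R-VOL are the infima of the respective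 costs over all algorithms that solve the problem. **The problem $\textsf{Hierarchical-THC}(k)$.** The label of $v$ consists of $\mathrm P(v),\mathrm{LC}(v),\mathrm{RC}(v)\in\{1,\dots,\Delta\}\cup\{\bot\}$ (parent, left child, right child; a port is identified with the neighbour of $v$ at it) and a color $\chi_{\rm in}(v)\in\{R,B\}$. First, ports larger than $\deg v$ are read as $\bot$, and so are all three ports of a node at which two ports other than $\bot$ in its label coincide. Then $\mathrm{LC}(v)=u$ or $\mathrm{RC}(v)=u$ is replaced by $\bot$ unless $\mathrm P(u)=v$. Let $\mathrm{level}(v)=1$ if $\mathrm{RC}(v)=\bot$ and $\mathrm{level}(v)=1+\mathrm{level}(\mathrm{RC}(v))$ otherwise ($\infty$ if this recursion runs into a cycle). Finally, $\mathrm{LC}(v)=u$ is replaced by $\bot$ unless $\mathrm{level}(u)=\mathrm{level}(v)$. A node of finite level is a *leaf* if $\mathrm{LC}(v)=\bot$. An output $\chi:V\to\{R,B,D,X\}$ is valid if for every $v$, with $\ell=\mathrm{level}(v)$: 1. if $\ell>k$, then $\chi(v)=X$; 2. if $\ell\le k$ and $v$ is a leaf, then $\chi(v)\in\{\chi_{\rm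 in}(v),D,X\}$; 3. if $\ell=1\le k$, then $\chi(v)\in\{R,B,D\}$, and $\chi(v)=\chi(\mathrm{LC}(v))$ if $v$ is not a leaf; 4. if $1<\ell<k$ and $v$ is not a leaf, then (a) $\chi(v)=\chi(\mathrm{LC}(v))\in\{R,B,D\}$, or (b) $\chi(v)=X$ and $\chi(\mathrm{RC}(v))\in\{R,B,X\}$, or (c) $\chi(v)\in\{\chi_{\rm in}(v),D\}$ and $\chi(\mathrm{LC}(v))=X$; 5. if $\ell=k$, then $\chi(v)\in\{R,B,X\}$, and (a) if $\chi(v)=X$, then $\mathrm{RC}(v)\neq\bot$ and $\chi(\mathrm{RC}(v))\in\{R,B,X\}$; (b) if $v$ is not a leaf and $\chi(v)\ne X$, then either $\chi(\mathrm{LC}(v))\neq X$ and $\chi(v)=\chi(\mathrm{LC}(v))$, or $\chi(\mathrm{LC}(v))=X$ and $\chi(v)=\chi_{\rm in}(v)$. **Theorem.** For each fixed integer $k\ge1$, and for every constant $C>0$ in the definition of the randomized complexities, as $n\to\infty$, $$\text{R-DIST}(\textsf{Hierarchical-THC}(k))=\Theta(n^{1/k}),\qquad \text{D-DIST}(\textsf{Hierarchical-THC}(k))=\Theta(n^{1/k}),$$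 $$\text{R-VOL}(\textsf{Hierarchical-THC}(k))=O\bigl(n^{1/k}\log^{O(k)}n\bigr),\qquad \text{D-VOL}(\textsf{Hierarchical-THC}(k))=\Omega\Bigl(\frac{n}{k\log n}\Bigr).$$ Here the $O(k)$ in the exponent is at most $ak$ with a constant $a$ independent of $k$ and $C$, and the constant in the last bound does not depend on $k$ (the bound holds for all $n\ge n_0(k)$); the other implied constants may depend on $k$ and $C$. All constants may depend on $\Delta$ and $\alpha$. -/

import Mathlib

open Filter MeasureTheory
open scoped ENNReal

namespace VolumeModel

/-! ### Labelled graphs -/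

/-- A labelled input graph on `n` nodes (named `0, …, n-1`; algorithms never see these names):
a simple graph of maximum degree at most `Δ`, a port ordering (for each node `v` a bijection between
the ports `0, …, deg v - 1` and the neighbours of `v`), pairwise distinct identifiers from
`{1, …, ⌊n ^ α⌋}`, and a problem-specific input label for each node. -/
structure LabeledGraph (Δ : ℕ) (α : ℝ) (L : Type) (n : ℕ) where
  graph : SimpleGraph (Fin n)
  deg : Fin n → ℕ
  port : (v : Fin n) → Fin (deg v) ≃ graph.neighborSet v
  deg_le : ∀ v, deg v ≤ Δ
  ident : Fin n → ℕ
  ident_injective : Function.Injective ident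
  ident_pos : ∀ v, 1 ≤ ident v
  ident_le : ∀ v, (ident v : ℝ) ≤ (n : ℝ) ^ α
  label : Fin n → L

/-- A graph problem: the valid triples (graph, input labelling, output labelling). -/
def GraphProblem (Δ : ℕ) (α : ℝ) (L Out : Type) : Type :=
  (n : ℕ) → LabeledGraph Δ α L n → (Fin n → Out) → Prop

/-! ### Query algorithms -/

/-- What an algorithm learns when it visits a node: its identifier, its degree and its input. -/
structure NodeInfo (L : Type) where
  ident : ℕ
  deg : ℕ
  label : L

/-- The answers an algorithm can receive. -/
inductive Answer (L : Type) where
  | node (info : NodeInfo L)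
  | bit (b : Bool)

/-- The possible next moves: query port `j` of the visited node with identifier `w`, read the next
unread bit of the private random string of the visited node with identifier `w`, or halt. -/
inductive Move (Out : Type) where
  | query (w j : ℕ)
  | coin (w : ℕ)
  | output (o : Out)

/-- An algorithm is given the number of nodes and the list of all answers received so far (the first
of them describes the node at which the execution is initiated) and decides on its next move. -/
def Algorithm (L Out : Type) : Type := ℕ → List (Answer L) → Move Out

/-- An algorithm is deterministic if it never reads a random bit. -/
def Algorithm.IsDeterministic {L Out : Type} (A : Algorithm L Out) : Prop :=
  ∀ n h w, A n h ≠ Move.coin w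

/-- A state of an execution: the answers so far, the visited nodes in order of their visits, and for
each node the number of bits of its random string that have been read. -/
structure ExecState (L : Type) (n : ℕ) where
  history : List (Answer L)
  visited : List (Fin n)
  used : Fin n → ℕ

section Execution

variable {Δ : ℕ} {α : ℝ} {L Out : Type} {n : ℕ}

def LabeledGraph.info (G : LabeledGraph Δ α L n) (v : Fin n) : NodeInfo L :=
  ⟨G.ident v, G.deg v, G.label v⟩

/-- One step of an execution, where `r (v, i)` is the `i`-th bit of the random string of `v`.
After an `output` move, or a move that names an unvisited node or a port that does not exist, the
state no longer changes; in the latter case the execution never produces an output. -/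
def step (A : Algorithm L Out) (G : LabeledGraph Δ α L n) (r : Fin n × ℕ → Bool)
    (s : ExecState L n) : ExecState L n :=
  match A n s.history with
  | Move.output _ => s
  | Move.query w j =>
    match s.visited.find? (fun x => decide (G.ident x = w)) with
    | none => s
    | some x =>
      if h : j < G.deg x then
        { history := s.history ++ [Answer.node (G.info (G.port x ⟨j, h⟩))]
          visited := s.visited ++ [(G.port x ⟨j, h⟩ : Fin n)]
          used := s.used }
      else s
  | Move.coin w =>
    match s.visited.find? (fun x => decide (G.ident x = w)) with
    | none => s
    | some x =>
      { history := s.history ++ [Answer.bit (r (x, s.used x))]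
        visited := s.visited
        used := Function.update s.used x (s.used x + 1) }

/-- The state after `t` steps of the execution initiated at `v`. -/
def exec (A : Algorithm L Out) (G : LabeledGraph Δ α L n) (r : Fin n × ℕ → Bool) (v : Fin n)
    (t : ℕ) : ExecState L n :=
  (step A G r)^[t] ⟨[Answer.node (G.info v)], [v], fun _ => 0⟩

/-- The execution initiated at `v` halts with output `o`. -/
def Outputs (A : Algorithm L Out) (G : LabeledGraph Δ α L n) (r : Fin n × ℕ → Bool) (v : Fin n)
    (o : Out) : Prop :=
  ∃ t, A n (exec A G r v t).history = Move.output o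

/-- The set of all nodes visited by the execution initiated at `v`. -/
def visitedSet (A : Algorithm L Out) (G : LabeledGraph Δ α L n) (r : Fin n × ℕ → Bool)
    (v : Fin n) : Set (Fin n) :=
  {u | ∃ t, u ∈ (exec A G r v t).visited}

/-- All executions halt, and the outputs form a valid solution. -/
def Succeeds (P : GraphProblem Δ α L Out) (A : Algorithm L Out) (G : LabeledGraph Δ α L n)
    (r : Fin n × ℕ → Bool) : Prop :=
  ∃ out : Fin n → Out, (∀ v, Outputs A G r v (out v)) ∧ P n G out

end Execution

/-- The law of the random strings of `n` nodes: all bits are independent and fair. -/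
noncomputable def coinMeasure (n : ℕ) : Measure (Fin n × ℕ → Bool) :=
  Measure.infinitePi fun _ => (PMF.uniformOfFintype Bool).toMeasure

section Complexity

variable {Δ : ℕ} {α : ℝ} {L Out : Type}

/-- The deterministic algorithm `A` solves the problem `P`. -/
def SolvesDet (P : GraphProblem Δ α L Out) (A : Algorithm L Out) : Prop :=
  A.IsDeterministic ∧ ∀ (n : ℕ) (G : LabeledGraph Δ α L n) (r : Fin n × ℕ → Bool), Succeeds P A G r

/-- The randomized algorithm `A` solves the problem `P` with probability at least `1 - C / n` on
every input with `n` nodes. An execution reads its random bits one by one, so a halting execution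
reads only finitely many of them. -/
def SolvesRand (P : GraphProblem Δ α L Out) (C : ℝ) (A : Algorithm L Out) : Prop :=
  ∀ (n : ℕ) (G : LabeledGraph Δ α L n),
    coinMeasure n {r | ¬ Succeeds P A G r} ≤ ENNReal.ofReal (C / n)

/-- The distance cost of `A` on graphs with at most `n` nodes: the largest distance from the
initial node to a visited node. Random strings count as a part of the input. -/
noncomputable def distCost (Δ : ℕ) (α : ℝ) (A : Algorithm L Out) (n : ℕ) : ℕ∞ :=
  ⨆ (m : ℕ) (_ : m ≤ n) (G : LabeledGraph Δ α L m) (r : Fin m × ℕ → Bool) (v : Fin m)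
    (u : Fin m) (_ : u ∈ visitedSet A G r v), G.graph.edist v u

/-- The volume cost of `A` on graphs with at most `n` nodes: the largest number of visited nodes. -/
noncomputable def volCost (Δ : ℕ) (α : ℝ) (A : Algorithm L Out) (n : ℕ) : ℕ∞ :=
  ⨆ (m : ℕ) (_ : m ≤ n) (G : LabeledGraph Δ α L m) (r : Fin m × ℕ → Bool) (v : Fin m),
    (visitedSet A G r v).encard

/-- Deterministic distance complexity. -/
noncomputable def DDist (P : GraphProblem Δ α L Out) (n : ℕ) : ℕ∞ :=
  ⨅ (A : Algorithm L Out) (_ : SolvesDet P A), distCost Δ α A n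

/-- Deterministic volume complexity. -/
noncomputable def DVol (P : GraphProblem Δ α L Out) (n : ℕ) : ℕ∞ :=
  ⨅ (A : Algorithm L Out) (_ : SolvesDet P A), volCost Δ α A n

/-- Randomized distance complexity, for algorithms with failure probability at most `C / n`. -/
noncomputable def RDist (P : GraphProblem Δ α L Out) (C : ℝ) (n : ℕ) : ℕ∞ :=
  ⨅ (A : Algorithm L Out) (_ : SolvesRand P C A), distCost Δ α A n

/-- Randomized volume complexity, for algorithms with failure probability at most `C / n`. -/
noncomputable def RVol (P : GraphProblem Δ α L Out) (C : ℝ) (n : ℕ) : ℕ∞ :=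
  ⨅ (A : Algorithm L Out) (_ : SolvesRand P C A), volCost Δ α A n

end Complexity

/-- `T = O(f)`. -/
def IsBigOh (T : ℕ → ℕ∞) (f : ℕ → ℝ) : Prop :=
  ∃ c : ℝ, 0 < c ∧ ∀ᶠ n in atTop, (T n : ℝ≥0∞) ≤ ENNReal.ofReal (c * f n)

/-- `T = Ω(f)`. -/
def IsBigOmega (T : ℕ → ℕ∞) (f : ℕ → ℝ) : Prop :=
  ∃ c : ℝ, 0 < c ∧ ∀ᶠ n in atTop, ENNReal.ofReal (c * f n) ≤ (T n : ℝ≥0∞)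

/-- `T = Θ(f)`. -/
def IsBigTheta (T : ℕ → ℕ∞) (f : ℕ → ℝ) : Prop :=
  IsBigOh T f ∧ IsBigOmega T f

/-! ### Colored tree labelings and the hierarchical forest -/

inductive Color where
  | R
  | B

/-- The label of a node in a colored tree labeling; `none` stands for `⊥`. -/
structure TreeLabel (Δ : ℕ) where
  parent : Option (Fin Δ)
  left : Option (Fin Δ)
  right : Option (Fin Δ)
  color : Color

/-- The ports different from `⊥` are pairwise distinct. -/
def TreeLabel.WellFormed {Δ : ℕ} (l : TreeLabel Δ) : Prop :=
  (∀ p, ¬ (l.parent = some p ∧ l.left = some p)) ∧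
  (∀ p, ¬ (l.parent = some p ∧ l.right = some p)) ∧
  (∀ p, ¬ (l.left = some p ∧ l.right = some p))

section Forest

variable {Δ : ℕ} {α : ℝ} {n : ℕ} (G : LabeledGraph Δ α (TreeLabel Δ) n)

/-- `u` is the neighbour of `v` at the port `p`, where `v` carries a well-formed label (the labels of
other nodes are read as `⊥`, as are ports that do not exist). -/
def PointsTo (v : Fin n) (p : Option (Fin Δ)) (u : Fin n) : Prop :=
  (G.label v).WellFormed ∧ ∃ (j : Fin Δ) (h : (j : ℕ) < G.deg v),
    p = some j ∧ (G.port v ⟨j, h⟩ : Fin n) = u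

/-- `u` is the left child of `v` and `v` is the parent of `u`. -/
def LeftChild' (v u : Fin n) : Prop :=
  PointsTo G v (G.label v).left u ∧ PointsTo G u (G.label u).parent v

/-- `u` is the right child of `v` and `v` is the parent of `u`. -/
def RightChild (v u : Fin n) : Prop :=
  PointsTo G v (G.label v).right u ∧ PointsTo G u (G.label u).parent v

/-- The level of a node. Nodes from which the right children run into a cycle have no level; they
count as nodes of infinite level. -/
inductive HasLevel : Fin n → ℕ → Prop
  | one (v : Fin n) : (∀ u, ¬ RightChild G v u) → HasLevel v 1
  | succ (v u : Fin n) (l : ℕ) : RightChild G v u → HasLevel u l → HasLevel v (l + 1)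

/-- The edges of the hierarchical forest between nodes of the same level: `u` is the left child
of `v`, at the same level `l`. -/
def LeftChild (l : ℕ) (v u : Fin n) : Prop :=
  LeftChild' G v u ∧ HasLevel G v l ∧ HasLevel G u l

/-- `v`, a node of level `l`, has no left child in the hierarchical forest. -/
def IsLevelLeaf (l : ℕ) (v : Fin n) : Prop :=
  HasLevel G v l ∧ ∀ u, ¬ LeftChild G l v u

end Forest

/-! ### Hierarchical-THC -/

/-- Output colors: red, blue, decline, exempt. -/
inductive OutColor where
  | R
  | B
  | D
  | X

def Color.toOut : Color → OutColor
  | Color.R => OutColor.R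
  | Color.B => OutColor.B

/-- Validity of an output labelling `out` for `Hierarchical-THC(k)`. -/
structure ValidTHC {Δ : ℕ} {α : ℝ} {n : ℕ} (k : ℕ) (G : LabeledGraph Δ α (TreeLabel Δ) n)
    (out : Fin n → OutColor) : Prop where
  /-- Nodes of level larger than `k` are exempt. -/
  cond1 : ∀ v, (∀ l ≤ k, ¬ HasLevel G v l) → out v = OutColor.X
  cond2 : ∀ v, ∀ l ≤ k, IsLevelLeaf G l v →
    out v = (G.label v).color.toOut ∨ out v = OutColor.D ∨ out v = OutColor.X
  cond3a : ∀ v, 1 ≤ k → HasLevel G v 1 →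
    out v = OutColor.R ∨ out v = OutColor.B ∨ out v = OutColor.D
  cond3b : ∀ v u, 1 ≤ k → LeftChild G 1 v u → out v = out u
  /-- Nodes `v` of level `1 < l < k` with a left child `u`. -/
  cond4 : ∀ l, 1 < l → l < k → ∀ v u, LeftChild G l v u →
    (out v = out u ∧ (out v = OutColor.R ∨ out v = OutColor.B ∨ out v = OutColor.D)) ∨
    (out v = OutColor.X ∧ ∃ w, RightChild G v w ∧
      (out w = OutColor.R ∨ out w = OutColor.B ∨ out w = OutColor.X)) ∨
    ((out v = (G.label v).color.toOut ∨ out v = OutColor.D) ∧ out u = OutColor.X)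
  cond5 : ∀ v, HasLevel G v k → out v = OutColor.R ∨ out v = OutColor.B ∨ out v = OutColor.X
  cond5a : ∀ v, HasLevel G v k → out v = OutColor.X → ∃ w, RightChild G v w ∧
    (out w = OutColor.R ∨ out w = OutColor.B ∨ out w = OutColor.X)
  cond5b : ∀ v u, LeftChild G k v u → out v ≠ OutColor.X →
    (out u ≠ OutColor.X ∧ out v = out u) ∨
    (out u = OutColor.X ∧ out v = (G.label v).color.toOut)

/-- The problem `Hierarchical-THC(k)`. -/
def hierarchicalTHC (Δ : ℕ) (α : ℝ) (k : ℕ) : GraphProblem Δ α (TreeLabel Δ) OutColor :=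
  fun _ G out => ValidTHC k G out

end VolumeModel

/-!
# The complexity of `Hierarchical-THC(k)` for distance and for volume

All bounds come from the hierarchical forest: the nodes of one level form paths or cycles (the
*backbones*) along the left children, and a right child is the first node of a backbone that is one
level lower.

**Distance, lower bound** (`isBigOmega_rDist`). Take the balanced forest with `k` levels, in which
every backbone has `s` nodes. An algorithm with distance cost less than `s - 2` that starts at the
first node of a backbone does not see the color of the last two nodes of this backbone, so its
output on this node does not change if these are recolored. By induction over the levels the first
node must decline: no node of the backbone can be exempt, as its right child declines, so the first
node has to decline or to have the color of the last nodes, whichever it is. At level `k` declining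
is forbidden. One color for the last nodes of the backbones of each level is enough for this
argument, so only `2 ^ k` colorings are needed. By the union bound one choice of the random bits is
good for all of them, hence the bound holds for randomized algorithms.

**Volume, deterministic lower bound** (`le_dVol`). An adversary builds the graph while the algorithm
runs; a node that is reached for the first time is always fresh. Once the output of the first node
of a backbone of level `l` is fixed to red or blue, the adversary ends the backbone with a leaf of
the other color. The outputs at the ends differ, so a binary search over the backbone finds an
exempt node (if the first node is exempt itself, no search is needed). Its right child is the first
node of a backbone of level `l - 1` and does not decline. At level `1` this is a contradiction. Each
level takes about `log n` runs of the algorithm, so `k log n` runs would do with fewer than `n`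
nodes if the volume were smaller than a small multiple of `n / (k log n)`.

**Upper bounds** (`isBigOh_dDist`, `isBigOh_rVol`). Fix a set `W` of way-points. A way-point is
exempt if its right child does not decline; the other nodes form runs on the backbones, and each run
of at most `s` nodes gets a common color (`rule`). If a node of level `l` declines, its run contains
`s` nodes, and none of them is an exempt way-point. If `W` hits every window of a backbone that has
`q` *light* nodes, from which fewer than `h ^ (l - 1)` nodes are hanging, then a run with
`s ≥ h + q` contains `h` nodes which are not light, hence at least `h ^ l` nodes are hanging from
the run (`pow_le_card_desc`). So with `h ^ k > n` no node of level `k` declines and the outputs are valid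
(`validTHC_rule`). With all nodes as way-points, `q = 1` and `s = h` are sufficient, and the outputs
depend on the nodes at distance `O(k (s + k))`. For the volume, each node is a way-point with
probability about `1 / h`, determined by its own random bits. Then with high probability every
window of length `O(h log n)` is hit as required and contains only `O(log n)` way-points
(`coinMeasure_not_hits_le`). The recursion into the lower level happens at way-points only, so it
visits `O(h log n)` nodes on each backbone and branches `O(log n)` times on each level; the
algorithm gives up if it exceeds this bound.

Algorithms are written as programs (`Prog`), whose executions are described by weakest
preconditions.
-/

namespace VolumeModel

/-! ### Frames: partially specified input graphs -/

/-- A partially specified input graph. The specified nodes are `0, …, m - 1`; each of them has the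
ports `0`, `1`, `2`, thought of as leading to its parent, its left and its right child, and
`nb u i = none` means that it is still open what is behind the port `i` of `u`. -/
structure Frame (Δ : ℕ) where
  m : ℕ
  nb : ℕ → Fin 3 → Option ℕ
  lab : ℕ → TreeLabel Δ
  nb_lt : ∀ {u i v}, nb u i = some v → u < m ∧ v < m
  nb_ne : ∀ {u i v}, nb u i = some v → u ≠ v
  nb_inj : ∀ {u i j v}, nb u i = some v → nb u j = some v → i = j
  nb_down : ∀ {u i v}, i ≠ 0 → nb u i = some v → nb v 0 = some u
  nb_up : ∀ {u v}, nb v 0 = some u → ∃ i, i ≠ 0 ∧ nb u i = some v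

/-- The label whose pointers are the ports `0`, `1`, `2`, the last two only if they are wanted. -/
def stdLabel {Δ : ℕ} (hΔ : 3 ≤ Δ) (hasL hasR : Prop) [Decidable hasL] [Decidable hasR] (c : Color) :
    TreeLabel Δ where
  parent := some ⟨0, by omega⟩
  left := if hasL then some ⟨1, by omega⟩ else none
  right := if hasR then some ⟨2, by omega⟩ else none
  color := c

theorem stdLabel_wellFormed {Δ : ℕ} (hΔ : 3 ≤ Δ) (hasL hasR : Prop) [Decidable hasL]
    [Decidable hasR] (c : Color) : (stdLabel hΔ hasL hasR c).WellFormed := by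
  refine ⟨?_, ?_, ?_⟩ <;> rintro p ⟨h1, h2⟩ <;> simp only [stdLabel] at h1 h2 <;>
    (try split_ifs at h1) <;> (try split_ifs at h2) <;> simp_all <;> subst h1 <;> simp_all

namespace Frame

variable {Δ : ℕ} (S : Frame Δ)

/-- The node behind the port `i` of the specified node `u` in the completed graph: behind an open
port there is a node of degree one. -/
def q (u : ℕ) (i : Fin 3) : ℕ := (S.nb u i).getD (S.m + 3 * u + i)

/-- The neighbours of `x` in the completed graph, in the order of the ports. Nodes with indices
`m ≤ x < 4 * m` are reserved for the open ports, all further nodes are isolated. -/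
def nbrs (x : ℕ) : List ℕ :=
  if x < S.m then [S.q x 0, S.q x 1, S.q x 2]
  else if h : (x - S.m) / 3 < S.m ∧
      S.nb ((x - S.m) / 3) ⟨(x - S.m) % 3, Nat.mod_lt _ (by norm_num)⟩ = none then
    [(x - S.m) / 3]
  else []

theorem nb_symm {u i v} (h : S.nb u i = some v) : ∃ j, S.nb v j = some u := by
  by_cases hi : i = 0
  · subst hi; obtain ⟨j, -, hj⟩ := S.nb_up h; exact ⟨j, hj⟩
  · exact ⟨0, S.nb_down hi h⟩

theorem q_eq_of_some {u i v} (h : S.nb u i = some v) : S.q u i = v := by simp [q, h]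

theorem q_eq_of_none {u i} (h : S.nb u i = none) : S.q u i = S.m + 3 * u + i := by simp [q, h]

theorem mem_nbrs_of_lt {x y : ℕ} (hx : x < S.m) : y ∈ S.nbrs x ↔ ∃ i, S.q x i = y := by
  simp [nbrs, hx, Fin.exists_fin_succ, eq_comm]

theorem mem_nbrs_of_le {x y : ℕ} (hx : ¬ x < S.m) :
    y ∈ S.nbrs x ↔ y < S.m ∧ ∃ i, S.nb y i = none ∧ x = S.m + 3 * y + i := by
  unfold nbrs
  rw [if_neg hx]
  constructor
  · intro h
    split_ifs at h with h1
    · simp only [List.mem_singleton] at h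
      subst h
      refine ⟨h1.1, _, h1.2, ?_⟩
      simp only
      omega
    · simp at h
  · rintro ⟨hy, i, hi, hxi⟩
    have e1 : (x - S.m) / 3 = y := by omega
    have e2 : (⟨(x - S.m) % 3, Nat.mod_lt _ (by norm_num)⟩ : Fin 3) = i := by
      ext; simp only; omega
    rw [dif_pos]
    · simp [e1]
    · rw [e2, e1]; exact ⟨hy, hi⟩

theorem q_lt {u : ℕ} (hu : u < S.m) (i : Fin 3) : S.q u i < 4 * S.m := by
  rcases h : S.nb u i with _ | v
  · rw [S.q_eq_of_none h]; omega
  · rw [S.q_eq_of_some h]; have := (S.nb_lt h).2; omega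

theorem nbrs_lt {x y : ℕ} (h : y ∈ S.nbrs x) : y < 4 * S.m := by
  by_cases hx : x < S.m
  · obtain ⟨i, rfl⟩ := (S.mem_nbrs_of_lt hx).1 h; exact S.q_lt hx i
  · have := ((S.mem_nbrs_of_le hx).1 h).1; omega

theorem nbrs_symm {x y : ℕ} (h : y ∈ S.nbrs x) : x ∈ S.nbrs y := by
  by_cases hx : x < S.m
  · obtain ⟨i, rfl⟩ := (S.mem_nbrs_of_lt hx).1 h
    rcases h : S.nb x i with _ | v
    · rw [S.mem_nbrs_of_le (by rw [S.q_eq_of_none h]; omega)]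
      exact ⟨hx, i, h, S.q_eq_of_none h⟩
    · rw [S.q_eq_of_some h, S.mem_nbrs_of_lt (S.nb_lt h).2]
      obtain ⟨j, hj⟩ := S.nb_symm h
      exact ⟨j, S.q_eq_of_some hj⟩
  · obtain ⟨hy, i, hi, rfl⟩ := (S.mem_nbrs_of_le hx).1 h
    rw [S.mem_nbrs_of_lt hy]
    exact ⟨i, S.q_eq_of_none hi⟩

theorem nbrs_irrefl (x : ℕ) : x ∉ S.nbrs x := by
  intro h
  by_cases hx : x < S.m
  · obtain ⟨i, hi⟩ := (S.mem_nbrs_of_lt hx).1 h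
    rcases h : S.nb x i with _ | v
    · rw [S.q_eq_of_none h] at hi; omega
    · rw [S.q_eq_of_some h] at hi; exact S.nb_ne h hi.symm
  · exact hx ((S.mem_nbrs_of_le hx).1 h).1

theorem q_inj {x : ℕ} {i j : Fin 3} (h : S.q x i = S.q x j) : i = j := by
  rcases hi : S.nb x i with _ | v <;> rcases hj : S.nb x j with _ | w
  · rw [S.q_eq_of_none hi, S.q_eq_of_none hj] at h; ext; omega
  · rw [S.q_eq_of_none hi, S.q_eq_of_some hj] at h; have := (S.nb_lt hj).2; omega
  · rw [S.q_eq_of_some hi, S.q_eq_of_none hj] at h; have := (S.nb_lt hi).2; omega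
  · rw [S.q_eq_of_some hi, S.q_eq_of_some hj] at h; subst h; exact S.nb_inj hi hj

theorem nbrs_nodup (x : ℕ) : (S.nbrs x).Nodup := by
  unfold nbrs
  split_ifs with h h'
  · have h01 : S.q x 0 ≠ S.q x 1 := fun h => by simpa using S.q_inj h
    have h02 : S.q x 0 ≠ S.q x 2 := fun h => by simpa using S.q_inj h
    have h12 : S.q x 1 ≠ S.q x 2 := fun h => by simpa using S.q_inj h
    simp [h01, h02, h12]
  · simp
  · simp

theorem length_nbrs {x : ℕ} (hx : x < S.m) : (S.nbrs x).length = 3 := by simp [nbrs, hx]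

theorem length_nbrs_le (x : ℕ) : (S.nbrs x).length ≤ 3 := by
  unfold nbrs; split_ifs <;> simp

theorem nbrs_getElem {x : ℕ} (hx : x < S.m) (i : ℕ) (hi : i < (S.nbrs x).length) :
    (S.nbrs x)[i] = S.q x ⟨i, by rwa [S.length_nbrs hx] at hi⟩ := by
  have h3 := hi
  rw [S.length_nbrs hx] at h3
  interval_cases i <;> simp [nbrs, hx]

/-- The completion of the frame `S` to an input graph with `n ≥ 4 * m` nodes. A node with
index `x` has the identifier `x + 1`, and unspecified nodes have no pointers. -/
noncomputable def toGraph {α : ℝ} {n : ℕ} (hΔ : 3 ≤ Δ) (hα : 1 ≤ α) (hn : 4 * S.m ≤ n) :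
    LabeledGraph Δ α (TreeLabel Δ) n where
  graph :=
    { Adj := fun x y => (y : ℕ) ∈ S.nbrs x
      symm := ⟨fun _ _ h => S.nbrs_symm h⟩
      loopless := ⟨fun x => S.nbrs_irrefl x⟩ }
  deg := fun x => (S.nbrs x).length
  port := fun x => Equiv.ofBijective
    (fun i => ⟨⟨(S.nbrs x)[i], (S.nbrs_lt (List.getElem_mem i.2)).trans_le hn⟩,
      List.getElem_mem i.2⟩)
    ⟨fun i j h => by
      have h' : (S.nbrs x)[i] = (S.nbrs x)[j] := by simpa using h
      exact Fin.ext ((List.Nodup.getElem_inj_iff (S.nbrs_nodup x)).1 h'),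
     fun ⟨y, hy⟩ => by
      obtain ⟨i, hi, h⟩ := List.getElem_of_mem (show (y : ℕ) ∈ S.nbrs x from hy)
      exact ⟨⟨i, hi⟩, Subtype.ext (Fin.ext h)⟩⟩
  deg_le := fun x => (S.length_nbrs_le x).trans hΔ
  ident := fun x => x + 1
  ident_injective := fun x y h => Fin.ext (by simpa using h)
  ident_pos := fun x => by simp
  ident_le := fun x => by
    have h1 : ((x + 1 : ℕ) : ℝ) ≤ n := by exact_mod_cast x.2
    have h0 : (1 : ℝ) ≤ n := by exact_mod_cast (Nat.one_le_of_lt x.2)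
    exact h1.trans (by simpa using Real.rpow_le_rpow_of_exponent_le h0 hα)
  label := fun x => if (x : ℕ) < S.m then S.lab x else ⟨none, none, none, Color.R⟩

section

variable {α : ℝ} {n : ℕ} (hΔ : 3 ≤ Δ) (hα : 1 ≤ α) (hn : 4 * S.m ≤ n)

theorem deg_toGraph {x : Fin n} (hx : (x : ℕ) < S.m) : (S.toGraph hΔ hα hn).deg x = 3 :=
  S.length_nbrs hx

theorem label_toGraph {x : Fin n} (hx : (x : ℕ) < S.m) :
    (S.toGraph hΔ hα hn).label x = S.lab x := if_pos hx

theorem port_toGraph {x : Fin n} (hx : (x : ℕ) < S.m) (i : ℕ)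
    (hi : i < (S.toGraph hΔ hα hn).deg x) :
    (((S.toGraph hΔ hα hn).port x ⟨i, hi⟩ : Fin n) : ℕ) =
      S.q x ⟨i, by rwa [S.deg_toGraph hΔ hα hn hx] at hi⟩ :=
  S.nbrs_getElem hx i hi

/-- In the completion of a frame, a pointer to one of the first three ports of a specified node
leads to the node behind that port. -/
theorem pointsTo_toGraph {x : Fin n} (hx : (x : ℕ) < S.m) (hw : (S.lab x).WellFormed) {i : Fin 3}
    (hi : (i : ℕ) < Δ) (y : Fin n) :
    PointsTo (S.toGraph hΔ hα hn) x (some ⟨i, hi⟩) y ↔ (y : ℕ) = S.q x i := by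
  unfold PointsTo
  rw [S.label_toGraph hΔ hα hn hx]
  constructor
  · rintro ⟨-, j, hj, h1, rfl⟩
    obtain rfl : _ = j := Option.some_injective _ h1
    exact S.port_toGraph hΔ hα hn hx _ _
  · intro h
    refine ⟨hw, ⟨i, hi⟩, ?_, rfl, ?_⟩
    · rw [S.deg_toGraph hΔ hα hn hx]; exact i.2
    · ext; rw [S.port_toGraph hΔ hα hn hx]; exact h.symm

theorem not_pointsTo_toGraph {x : Fin n} (hx : ¬ (x : ℕ) < S.m) (y : Fin n) :
    ¬ PointsTo (S.toGraph hΔ hα hn) x ((S.toGraph hΔ hα hn).label x).parent y := by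
  rintro ⟨-, j, hj, h1, -⟩
  simp [toGraph, hx] at h1

/-- A specified node with standard labels is the child of another one along the edge `i` exactly
if the frame says so. -/
theorem child_toGraph {x : Fin n} (hx : (x : ℕ) < S.m) (hw : (S.lab x).WellFormed) {i : Fin 3}
    (hi : (i : ℕ) < Δ) (hi0 : i ≠ 0)
    (hp : ∀ v < S.m, (S.lab v).WellFormed ∧ (S.lab v).parent = some ⟨0, by omega⟩) (y : Fin n) :
    (PointsTo (S.toGraph hΔ hα hn) x (some ⟨i, hi⟩) y ∧
      PointsTo (S.toGraph hΔ hα hn) y ((S.toGraph hΔ hα hn).label y).parent x) ↔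
      S.nb x i = some (y : ℕ) := by
  rw [S.pointsTo_toGraph hΔ hα hn hx hw hi]
  constructor
  · rintro ⟨h1, h2⟩
    by_cases hy : (y : ℕ) < S.m
    · rcases h : S.nb x i with _ | v
      · rw [S.q_eq_of_none h] at h1; omega
      · rw [S.q_eq_of_some h] at h1; rw [h1]
    · exact absurd h2 (S.not_pointsTo_toGraph hΔ hα hn hy x)
  · intro h
    refine ⟨(S.q_eq_of_some h).symm, ?_⟩
    have hy := (S.nb_lt h).2
    rw [S.label_toGraph hΔ hα hn hy, (hp _ hy).2]
    refine (S.pointsTo_toGraph (i := 0) hΔ hα hn hy (hp _ hy).1 (by simp; omega) x).2 ?_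
    exact (S.q_eq_of_some (S.nb_down hi0 h)).symm

end

end Frame

/-! ### Executions -/

section Execution

variable {Δ : ℕ} {α : ℝ} {L Out : Type} {n : ℕ}

theorem visited_prefix_step (A : Algorithm L Out) (G : LabeledGraph Δ α L n)
    (r : Fin n × ℕ → Bool) (s : ExecState L n) : s.visited <+: (step A G r s).visited := by
  unfold step
  split
  · exact List.prefix_rfl
  · split
    · exact List.prefix_rfl
    · split_ifs
      · exact List.prefix_append _ _
      · exact List.prefix_rfl
  · split <;> exact List.prefix_rfl

theorem exec_succ (A : Algorithm L Out) (G : LabeledGraph Δ α L n) (r : Fin n × ℕ → Bool)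
    (v : Fin n) (t : ℕ) : exec A G r v (t + 1) = step A G r (exec A G r v t) := by
  simp [exec, Function.iterate_succ_apply']

theorem visited_prefix_exec (A : Algorithm L Out) (G : LabeledGraph Δ α L n)
    (r : Fin n × ℕ → Bool) (v : Fin n) {t t' : ℕ} (h : t ≤ t') :
    (exec A G r v t).visited <+: (exec A G r v t').visited := by
  induction h with
  | refl => exact List.prefix_rfl
  | step _ ih => rw [exec_succ]; exact ih.trans (visited_prefix_step ..)

theorem exec_eq_of_output {A : Algorithm L Out} {G : LabeledGraph Δ α L n}
    {r : Fin n × ℕ → Bool} {v : Fin n} {t t' : ℕ} {o : Out} (h : t ≤ t')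
    (ho : A n (exec A G r v t).history = Move.output o) : exec A G r v t' = exec A G r v t := by
  induction h with
  | refl => rfl
  | step _ ih => rw [exec_succ, ih]; unfold step; rw [ho]

theorem Outputs.unique {A : Algorithm L Out} {G : LabeledGraph Δ α L n}
    {r : Fin n × ℕ → Bool} {v : Fin n} {o o' : Out} (h : Outputs A G r v o)
    (h' : Outputs A G r v o') : o = o' := by
  obtain ⟨t, ht⟩ := h
  obtain ⟨t', ht'⟩ := h'
  have : Move.output o = Move.output o' := by
    rcases le_total t t' with hle | hle
    · rw [exec_eq_of_output hle ht, ht] at ht'; exact ht'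
    · rw [exec_eq_of_output hle ht', ht'] at ht; exact ht.symm
  simpa using this

end Execution

theorem RightChild.unique {Δ : ℕ} {α : ℝ} {n : ℕ} {G : LabeledGraph Δ α (TreeLabel Δ) n}
    {v u u' : Fin n} (h : RightChild G v u) (h' : RightChild G v u') : u = u' := by
  obtain ⟨⟨-, j, hj, e, rfl⟩, -⟩ := h
  obtain ⟨⟨-, j', hj', e', rfl⟩, -⟩ := h'
  rw [e] at e'
  cases e'
  rfl

/-! ### Balanced hierarchical forests -/

section Relabel

variable {Δ : ℕ} {α : ℝ} {L Out : Type} {n : ℕ}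

/-- An execution does not depend on the labels of the nodes that it does not visit. -/
theorem exec_relabel (A : Algorithm L Out) (G : LabeledGraph Δ α L n) (lab : Fin n → L)
    (r : Fin n × ℕ → Bool) (v : Fin n) (h : ∀ u ∈ visitedSet A G r v, lab u = G.label u) (t : ℕ) :
    exec A { G with label := lab } r v t = exec A G r v t := by
  have hinfo : ∀ u ∈ visitedSet A G r v,
      ({ G with label := lab } : LabeledGraph Δ α L n).info u = G.info u := by
    intro u hu; simp [LabeledGraph.info, h u hu]
  induction t with
  | zero => simp [exec, hinfo v ⟨0, by simp [exec]⟩]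
  | succ t ih =>
    have key : ∀ u ∈ (exec A G r v (t + 1)).visited,
      ({ G with label := lab } : LabeledGraph Δ α L n).info u = G.info u :=
        fun u hu => hinfo u ⟨t + 1, hu⟩
    rw [exec_succ] at key
    rw [exec_succ, exec_succ, ih]
    revert key
    generalize exec A G r v t = st
    intro key
    unfold step at key ⊢
    cases hA : A n st.history with
    | output o => rfl
    | query w j =>
      simp only [hA] at key ⊢
      cases hf : st.visited.find? (fun x => decide (G.ident x = w)) with
      | none => rfl
      | some x =>
        simp only [hf] at key ⊢
        by_cases hj : j < G.deg x
        · simp only [hj, dite_true] at key ⊢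
          rw [key _ (List.mem_append_right _ (List.mem_singleton.2 rfl))]
        · simp only [hj, dite_false]
    | coin w => rfl

end Relabel

/-- The nodes of the balanced hierarchical forest with `k` levels and backbones of length `s`: the
node `(j, t)` lies in a backbone of level `k - j`, at the position `t j`, and the earlier
coordinates are the positions of its ancestors. The nodes whose later coordinates do not
vanish form further components, which play no role. -/
abbrev BalNode (k s : ℕ) : Type := Fin k × (Fin k → Fin s)

namespace BalNode

variable {k s : ℕ}

/-- The next node on the backbone. -/
def left (v : BalNode k s) : Option (BalNode k s) :=
  if h : (v.2 v.1 : ℕ) + 1 < s then some (v.1, Function.update v.2 v.1 ⟨v.2 v.1 + 1, h⟩) else none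

/-- The first node of the backbone that hangs from `v`; it inherits the positions of `v`. -/
def right (v : BalNode k s) : Option (BalNode k s) :=
  if h : (v.1 : ℕ) + 1 < k then
    if (v.2 ⟨v.1 + 1, h⟩ : ℕ) = 0 then some (⟨v.1 + 1, h⟩, v.2) else none
  else none

/-- The previous node on the backbone, or the node that the backbone hangs from. -/
def parent (v : BalNode k s) : Option (BalNode k s) :=
  if (v.2 v.1 : ℕ) = 0 then
    if (v.1 : ℕ) = 0 then none else some (⟨v.1 - 1, by omega⟩, v.2)
  else some (v.1, Function.update v.2 v.1 ⟨v.2 v.1 - 1, by omega⟩)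

/-- The neighbours of `v`, in the order of the ports of a frame. -/
def nb (v : BalNode k s) : Fin 3 → Option (BalNode k s) :=
  ![v.parent, v.left, v.right]

theorem parent_of_left {v w : BalNode k s} (h : v.left = some w) : w.parent = some v := by
  obtain ⟨j, t⟩ := v
  unfold left at h
  split_ifs at h with h1
  obtain rfl := Option.some_injective _ h
  simp [parent]

theorem eq_of_right {v w : BalNode k s} (h : v.right = some w) :
    ∃ h : (v.1 : ℕ) + 1 < k, (v.2 ⟨v.1 + 1, h⟩ : ℕ) = 0 ∧ w = (⟨v.1 + 1, h⟩, v.2) := by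
  unfold right at h
  split_ifs at h with h1 h2
  exact ⟨h1, h2, (Option.some_injective _ h).symm⟩

theorem parent_of_right {v w : BalNode k s} (h : v.right = some w) : w.parent = some v := by
  obtain ⟨j, t⟩ := v
  unfold right at h
  split_ifs at h with h1 h2
  obtain rfl := Option.some_injective _ h
  simp only at h2
  simp [parent, h2]

theorem left_or_right_of_parent {v w : BalNode k s} (h : w.parent = some v) :
    v.left = some w ∨ v.right = some w := by
  obtain ⟨j, t⟩ := w
  unfold parent at h
  split_ifs at h with h1 h2
  · obtain rfl := Option.some_injective _ h
    right
    simp only at h1 h2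
    have e : (j : ℕ) - 1 + 1 = j := by omega
    simp [right, e, h1]
  · obtain rfl := Option.some_injective _ h
    left
    simp only at h1
    have e : (t j : ℕ) - 1 + 1 = t j := by omega
    simp [left, e]

theorem left_ne_right {v w w' : BalNode k s} (h : v.left = some w) (h' : v.right = some w') :
    w ≠ w' := by
  obtain ⟨j, t⟩ := v
  unfold left at h
  unfold right at h'
  split_ifs at h h' with h1 h2
  obtain rfl := Option.some_injective _ h
  obtain rfl := Option.some_injective _ h'
  intro e
  have := congrArg (fun x : BalNode k s => (x.1 : ℕ)) e
  simp at this

/-- A measure that grows by one along each edge from a parent to a child, so that no node is its own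
neighbour and the two ends of an edge are not joined by a second one. -/
def rank (v : BalNode k s) : ℕ := v.1 + ∑ i, (v.2 i : ℕ)

theorem rank_of_left {v w : BalNode k s} (h : v.left = some w) : w.rank = v.rank + 1 := by
  obtain ⟨j, t⟩ := v
  unfold left at h
  split_ifs at h with h1
  obtain rfl := Option.some_injective _ h
  simp only [rank]
  rw [← Finset.add_sum_erase _ _ (Finset.mem_univ j),
    ← Finset.add_sum_erase Finset.univ (fun i => (t i : ℕ)) (Finset.mem_univ j),
    Finset.sum_congr rfl (g := fun i => (t i : ℕ))]
  · simp; ring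
  · intro i hi; simp [Function.update_of_ne (Finset.ne_of_mem_erase hi)]

theorem rank_of_right {v w : BalNode k s} (h : v.right = some w) : w.rank = v.rank + 1 := by
  obtain ⟨j, t⟩ := v
  unfold right at h
  split_ifs at h with h1 h2
  obtain rfl := Option.some_injective _ h
  simp only [rank]; ring

theorem rank_of_parent {v w : BalNode k s} (h : w.parent = some v) : w.rank = v.rank + 1 := by
  rcases left_or_right_of_parent h with h | h
  · exact rank_of_left h
  · exact rank_of_right h

theorem nb_ne {v w : BalNode k s} {i : Fin 3} (h : v.nb i = some w) : v ≠ w := by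
  rintro rfl
  fin_cases i
  · have := rank_of_parent h; omega
  · have := rank_of_left h; omega
  · have := rank_of_right h; omega

theorem nb_inj {v w : BalNode k s} {i j : Fin 3} (h : v.nb i = some w) (h' : v.nb j = some w) :
    i = j := by
  fin_cases i <;> fin_cases j <;> try rfl
  · have h1 := rank_of_parent h; have h2 := rank_of_left h'; omega
  · have h1 := rank_of_parent h; have h2 := rank_of_right h'; omega
  · have h1 := rank_of_left h; have h2 := rank_of_parent h'; omega
  · exact absurd rfl (left_ne_right h h')
  · have h1 := rank_of_right h; have h2 := rank_of_parent h'; omega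
  · exact absurd rfl (left_ne_right h' h)

/-- The position of the ancestor of `v` in a backbone of index `j` (`0` if there is none). It
changes by at most one along each edge. -/
def pos (j : Fin k) (v : BalNode k s) : ℕ := if j ≤ v.1 then v.2 j else 0

theorem pos_of_left (j : Fin k) {v w : BalNode k s} (h : v.left = some w) :
    pos j w ≤ pos j v + 1 ∧ pos j v ≤ pos j w + 1 := by
  obtain ⟨i, t⟩ := v
  unfold left at h
  split_ifs at h with h1
  obtain rfl := Option.some_injective _ h
  simp only [pos]
  split_ifs with h2
  · by_cases hij : j = i
    · subst hij; simp; omega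
    · simp [Function.update_of_ne hij]
  · simp

theorem pos_of_right (j : Fin k) {v w : BalNode k s} (h : v.right = some w) :
    pos j w ≤ pos j v + 1 ∧ pos j v ≤ pos j w + 1 := by
  obtain ⟨i, t⟩ := v
  unfold right at h
  split_ifs at h with h1 h2
  obtain rfl := Option.some_injective _ h
  simp only [pos]
  by_cases h3 : j ≤ i
  · have h4 : j ≤ ⟨i + 1, h1⟩ := by rw [Fin.le_def] at h3 ⊢; simp only; omega
    simp [h3, h4]
  · rw [if_neg h3]
    split_ifs with h4
    · have : j = ⟨i + 1, h1⟩ := by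
        rw [Fin.le_def] at h3 h4; simp only at h4; ext; simp only; omega
      subst this
      simp only at h2
      omega
    · simp

theorem pos_of_nb (j : Fin k) {v w : BalNode k s} {i : Fin 3} (h : v.nb i = some w) :
    pos j w ≤ pos j v + 1 := by
  fin_cases i
  · rcases left_or_right_of_parent h with h | h
    · exact (pos_of_left j h).2
    · exact (pos_of_right j h).2
  · exact (pos_of_left j h).1
  · exact (pos_of_right j h).1

variable (k s) in
/-- An enumeration of the nodes of the balanced forest. -/
noncomputable def idx : BalNode k s ≃ Fin (k * s ^ k) :=
  Fintype.equivFinOfCardEq (by simp)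

/-- The input colors: the last two nodes of each backbone with the index `j` have the color `c j`,
all other nodes are red. -/
def color (c : Fin k → Color) (v : BalNode k s) : Color :=
  if s ≤ v.2 v.1 + 2 then c v.1 else Color.R

end BalNode

open BalNode in
/-- The balanced hierarchical forest as a frame. -/
noncomputable def balFrame {Δ : ℕ} (hΔ : 3 ≤ Δ) (k s : ℕ) (c : Fin k → Color) : Frame Δ where
  m := k * s ^ k
  nb := fun u i => if h : u < k * s ^ k then
    (((idx k s).symm ⟨u, h⟩).nb i).map fun v => (idx k s v : ℕ) else none
  lab := fun u => stdLabel hΔ True True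
    (if h : u < k * s ^ k then color c ((idx k s).symm ⟨u, h⟩) else Color.R)
  nb_lt := by
    intro u i v h
    split_ifs at h with h1
    obtain ⟨w, -, rfl⟩ := Option.map_eq_some_iff.1 h
    exact ⟨h1, (idx k s w).2⟩
  nb_ne := by
    rintro u i v h rfl
    split_ifs at h with h1
    obtain ⟨w, hw, e⟩ := Option.map_eq_some_iff.1 h
    exact nb_ne hw (by rw [Equiv.symm_apply_eq]; exact Fin.ext e.symm)
  nb_inj := by
    intro u i j v h h'
    split_ifs at h h' with h1
    obtain ⟨w, hw, rfl⟩ := Option.map_eq_some_iff.1 h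
    obtain ⟨w', hw', e⟩ := Option.map_eq_some_iff.1 h'
    obtain rfl := (idx k s).injective (Fin.ext e)
    exact nb_inj hw hw'
  nb_down := by
    intro u i v hi h
    split_ifs at h with h1
    obtain ⟨w, hw, rfl⟩ := Option.map_eq_some_iff.1 h
    have : w.parent = some ((idx k s).symm ⟨u, h1⟩) := by
      fin_cases i
      · exact absurd rfl hi
      · exact parent_of_left hw
      · exact parent_of_right hw
    simp [nb, this]
  nb_up := by
    intro u v h
    split_ifs at h with h1
    obtain ⟨w, hw, rfl⟩ := Option.map_eq_some_iff.1 h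
    rcases left_or_right_of_parent hw with h2 | h2
    · exact ⟨1, by simp, by simp [nb, h2]⟩
    · exact ⟨2, by simp, by simp [nb, h2]⟩

namespace BalNode

variable {k s : ℕ}

/-- A node of the balanced forest as a node of the input graph. -/
noncomputable def toFin (v : BalNode k s) : Fin (4 * (k * s ^ k)) :=
  Fin.castLE (Nat.le_mul_of_pos_left _ (by norm_num)) (idx k s v)

variable {Δ : ℕ} {α : ℝ} (hΔ : 3 ≤ Δ) (hα : 1 ≤ α)

variable (k s) in
theorem four_mul_m_le (c : Fin k → Color) : 4 * (balFrame hΔ k s c).m ≤ 4 * (k * s ^ k) := le_rfl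

/-- The balanced hierarchical forest as an input graph. -/
noncomputable def graph (k s : ℕ) (c : Fin k → Color) :
    LabeledGraph Δ α (TreeLabel Δ) (4 * (k * s ^ k)) :=
  (balFrame hΔ k s c).toGraph hΔ hα (four_mul_m_le k s hΔ c)

theorem balFrame_nb (c : Fin k → Color) (v : BalNode k s) (i : Fin 3) :
    (balFrame hΔ k s c).nb (toFin v) i = (v.nb i).map fun v => (toFin v : ℕ) := by
  simp [balFrame, toFin]

theorem label_toFin (c : Fin k → Color) (v : BalNode k s) :
    (graph hΔ hα k s c).label (toFin v) = stdLabel hΔ True True (color c v) := by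
  unfold graph
  rw [Frame.label_toGraph _ _ _ _ (show ((toFin v : Fin _) : ℕ) < (balFrame hΔ k s c).m from
    (idx k s v).2)]
  simp [balFrame, toFin]

theorem child_iff (c : Fin k → Color) (v : BalNode k s) {i : Fin 3} (hi : (i : ℕ) < Δ)
    (hi0 : i ≠ 0) (y : Fin (4 * (k * s ^ k))) :
    (PointsTo (graph hΔ hα k s c) (toFin v) (some ⟨i, hi⟩) y ∧
      PointsTo (graph hΔ hα k s c) y ((graph hΔ hα k s c).label y).parent (toFin v)) ↔
      ∃ w, v.nb i = some w ∧ y = toFin w := by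
  unfold graph
  rw [Frame.child_toGraph _ _ _ _ (show ((toFin v : Fin _) : ℕ) < (balFrame hΔ k s c).m from
    (idx k s v).2) (stdLabel_wellFormed hΔ _ _ _) hi hi0
    (fun v _ => ⟨stdLabel_wellFormed hΔ _ _ _, rfl⟩), balFrame_nb]
  simp only [Option.map_eq_some_iff]
  exact exists_congr fun w => and_congr_right fun _ => ⟨fun h => Fin.ext h.symm, fun h => by rw [h]⟩

theorem rightChild_iff (c : Fin k → Color) (v : BalNode k s) (y : Fin (4 * (k * s ^ k))) :
    RightChild (graph hΔ hα k s c) (toFin v) y ↔ ∃ w, v.right = some w ∧ y = toFin w := by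
  unfold RightChild
  rw [label_toFin]
  exact child_iff hΔ hα c v (i := 2) (by simp; omega) (by simp) y

theorem leftChild'_iff (c : Fin k → Color) (v : BalNode k s) (y : Fin (4 * (k * s ^ k))) :
    LeftChild' (graph hΔ hα k s c) (toFin v) y ↔ ∃ w, v.left = some w ∧ y = toFin w := by
  unfold LeftChild'
  rw [label_toFin]
  exact child_iff hΔ hα c v (i := 1) (by simp; omega) (by simp) y

theorem hasLevel (c : Fin k → Color) (v : BalNode k s) (hv : ∀ i, v.1 < i → (v.2 i : ℕ) = 0) :
    HasLevel (graph hΔ hα k s c) (toFin v) (k - v.1) := by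
  obtain ⟨j, t⟩ := v
  obtain ⟨d, hd⟩ : ∃ d, d = k - j := ⟨_, rfl⟩
  induction d generalizing j with
  | zero => omega
  | succ d ih =>
    by_cases h1 : (j : ℕ) + 1 < k
    · have hr : right (j, t) = some (⟨j + 1, h1⟩, t) := by
        have := hv ⟨j + 1, h1⟩ (by rw [Fin.lt_def]; simp)
        simp only at this
        simp [right, h1, this]
      have := ih ⟨j + 1, h1⟩ (fun i hi => hv i (by
        rw [Fin.lt_def] at hi ⊢; simp only at hi ⊢; omega)) (by simp only; omega)
      have e : k - (j : ℕ) = k - ((⟨j + 1, h1⟩ : Fin k) : ℕ) + 1 := by simp only; omega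
      simp only
      rw [e]
      exact HasLevel.succ _ _ _ ((rightChild_iff hΔ hα c _ _).2 ⟨_, hr, rfl⟩) this
    · have e : k - (j : ℕ) = 1 := by omega
      simp only
      rw [e]
      refine HasLevel.one _ fun u hu => ?_
      obtain ⟨w, hw, -⟩ := (rightChild_iff hΔ hα c _ _).1 hu
      simp [right, h1] at hw

end BalNode

theorem le_add_edist {V : Type*} {G : SimpleGraph V} {f : V → ℕ}
    (hf : ∀ x y, G.Adj x y → f y ≤ f x + 1) (x y : V) : (f y : ℕ∞) ≤ f x + G.edist x y := by
  by_cases h : G.edist x y = ⊤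
  · simp [h]
  · obtain ⟨p, hp⟩ := SimpleGraph.exists_walk_of_edist_ne_top h
    rw [← hp]
    have : f y ≤ f x + p.length := by
      clear hp h
      induction p with
      | nil => simp
      | cons hadj p ih => have := hf _ _ hadj; rw [SimpleGraph.Walk.length_cons]; omega
    exact_mod_cast this

instance (n : ℕ) : IsProbabilityMeasure (coinMeasure n) := by
  unfold coinMeasure; infer_instance

theorem edist_le_distCost {Δ : ℕ} {α : ℝ} {L Out : Type} {A : Algorithm L Out} {m n : ℕ}
    (hm : m ≤ n) (G : LabeledGraph Δ α L m) (r : Fin m × ℕ → Bool) (v u : Fin m)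
    (hu : u ∈ visitedSet A G r v) : G.graph.edist v u ≤ distCost Δ α A n :=
  le_iSup_of_le m <| le_iSup_of_le hm <| le_iSup_of_le G <| le_iSup_of_le r <|
    le_iSup_of_le v <| le_iSup_of_le u <| le_iSup_of_le hu le_rfl

namespace BalNode

variable {Δ : ℕ} {α : ℝ} {k s : ℕ} (hΔ : 3 ≤ Δ) (hα : 1 ≤ α)

/-- The position measure `pos`, extended to the pendant nodes of the completed graph. -/
noncomputable def posFin (j : Fin k) (x : ℕ) : ℕ :=
  if h : x < k * s ^ k then pos j ((idx k s).symm ⟨x, h⟩)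
  else if h : (x - k * s ^ k) / 3 < k * s ^ k then
    pos j ((idx k s).symm ⟨(x - k * s ^ k) / 3, h⟩) else 0

theorem posFin_toFin (j : Fin k) (v : BalNode k s) :
    posFin (s := s) j (toFin v : Fin _) = pos j v := by
  have h : ((toFin v : Fin _) : ℕ) < k * s ^ k := (idx k s v).2
  rw [posFin, dif_pos h]
  congr 1
  rw [Equiv.symm_apply_eq]; rfl

theorem posFin_q (c : Fin k → Color) (j : Fin k) {x : ℕ} (hx : x < k * s ^ k) (i : Fin 3) :
    posFin (s := s) j ((balFrame hΔ k s c).q x i) ≤ posFin (s := s) j x + 1 ∧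
    ((balFrame hΔ k s c).nb x i = none →
      posFin (s := s) j ((balFrame hΔ k s c).q x i) = posFin (s := s) j x) := by
  obtain ⟨v, hv⟩ : ∃ v : BalNode k s, x = (toFin v : Fin _) :=
    ⟨(idx k s).symm ⟨x, hx⟩, by simp [toFin]⟩
  subst hv
  rw [posFin_toFin]
  rcases h : (balFrame hΔ k s c).nb (toFin v : Fin _) i with _ | y
  · rw [Frame.q_eq_of_none _ h]
    have e : posFin (s := s) j ((balFrame hΔ k s c).m + 3 * (toFin v : Fin _) + i) = pos j v := by
      have h1 : ¬ k * s ^ k + 3 * ((toFin v : Fin _) : ℕ) + i < k * s ^ k := by omega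
      have h2 : (k * s ^ k + 3 * ((toFin v : Fin _) : ℕ) + i - k * s ^ k) / 3 =
        ((toFin v : Fin _) : ℕ) := by omega
      rw [← posFin_toFin, show (balFrame hΔ k s c).m = k * s ^ k from rfl, posFin, dif_neg h1]
      simp only [h2]
      rw [posFin, dif_pos hx, dif_pos hx]
    rw [e]; simp
  · rw [Frame.q_eq_of_some _ h]
    rw [balFrame_nb] at h
    obtain ⟨w, hw, rfl⟩ := Option.map_eq_some_iff.1 h
    rw [posFin_toFin]
    exact ⟨pos_of_nb j hw, by simp⟩

theorem posFin_adj (c : Fin k → Color) (j : Fin k) (x y : Fin (4 * (k * s ^ k)))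
    (h : (graph (α := α) hΔ hα k s c).graph.Adj x y) :
    posFin (s := s) j y ≤ posFin (s := s) j x + 1 := by
  change (y : ℕ) ∈ (balFrame hΔ k s c).nbrs x at h
  by_cases hx : (x : ℕ) < k * s ^ k
  · obtain ⟨i, hi⟩ := (Frame.mem_nbrs_of_lt _ hx).1 h
    rw [← hi]; exact (posFin_q hΔ c j hx i).1
  · obtain ⟨hy, i, hi, e⟩ := (Frame.mem_nbrs_of_le _ hx).1 h
    have := (posFin_q hΔ c j hy i).2 hi
    rw [Frame.q_eq_of_none _ hi, ← e] at this
    omega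

/-- The labels of the balanced forest for the colors `c`, as labels of nodes of the graph. -/
theorem graph_eq_relabel (c c' : Fin k → Color) :
    graph (α := α) hΔ hα k s c' =
      { graph (α := α) hΔ hα k s c with label := (graph (α := α) hΔ hα k s c').label } := rfl

/-- A node at the top of a backbone of index `j` cannot distinguish the colors `c j`. -/
theorem outputs_congr {A : Algorithm (TreeLabel Δ) OutColor} {n : ℕ}
    (hn : 4 * (k * s ^ k) ≤ n) (hcost : distCost Δ α A n < (s - 2 : ℕ))
    (c c' : Fin k → Color) (j : Fin k) (hc : ∀ i, i ≠ j → c i = c' i)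
    (r : Fin (4 * (k * s ^ k)) × ℕ → Bool) (v : BalNode k s) (hv : pos j v = 0) {o : OutColor}
    (h : Outputs A (graph (α := α) hΔ hα k s c) r (toFin v) o) :
    Outputs A (graph (α := α) hΔ hα k s c') r (toFin v) o := by
  obtain ⟨t, ht⟩ := h
  refine ⟨t, ?_⟩
  rw [graph_eq_relabel hΔ hα c c', exec_relabel, ht]
  intro u hu
  by_cases hum : (u : ℕ) < k * s ^ k
  · obtain ⟨w, rfl⟩ : ∃ w : BalNode k s, u = toFin w :=
      ⟨(idx k s).symm ⟨u, hum⟩, by ext; simp [toFin]⟩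
    rw [label_toFin, label_toFin]
    congr 1
    unfold color
    split_ifs with hs
    · by_cases hj : w.1 = j
      · exfalso
        have h1 := le_add_edist (posFin_adj (α := α) hΔ hα c j) (toFin v) (toFin w)
        rw [posFin_toFin, posFin_toFin, hv, Nat.cast_zero, zero_add] at h1
        have h2 : ((s - 2 : ℕ) : ℕ∞) ≤ pos j w := by
          have : s - 2 ≤ pos j w := by
            unfold pos; rw [if_pos hj.ge, ← hj]; omega
          exact_mod_cast this
        exact absurd ((h2.trans h1).trans (edist_le_distCost hn _ r _ _ hu)) (not_le.2 hcost)
      · exact (hc _ hj).symm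
    · rfl
  · simp only [graph, Frame.toGraph]
    exact (if_neg hum).trans (if_neg hum).symm

/-- The `i`-th node of the backbone of index `j` that contains `(j, t)`. -/
def onBackbone (j : Fin k) (t : Fin k → Fin s) (i : Fin s) : BalNode k s :=
  (j, Function.update t j i)

section Backbone

variable {j : Fin k} {t : Fin k → Fin s}

theorem hasLevel_onBackbone (ht : ∀ i, j < i → (t i : ℕ) = 0) (c : Fin k → Color)
    (i : Fin s) :
    HasLevel (graph (α := α) hΔ hα k s c) (toFin (onBackbone j t i)) (k - j) :=
  hasLevel hΔ hα c (onBackbone j t i) fun i' hi' => by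
    simp only [onBackbone] at hi' ⊢
    rw [Function.update_of_ne hi'.ne']; exact ht i' hi'

theorem leftChild_onBackbone (ht : ∀ i, j < i → (t i : ℕ) = 0) (c : Fin k → Color)
    {i : ℕ} (hi : i + 1 < s) :
    LeftChild (graph (α := α) hΔ hα k s c) (k - j) (toFin (onBackbone j t ⟨i, by omega⟩))
      (toFin (onBackbone j t ⟨i + 1, hi⟩)) :=
  ⟨(leftChild'_iff hΔ hα c _ _).2 ⟨_, by simp [onBackbone, left, hi], rfl⟩,
    hasLevel_onBackbone hΔ hα ht c _, hasLevel_onBackbone hΔ hα ht c _⟩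

theorem isLevelLeaf_onBackbone (ht : ∀ i, j < i → (t i : ℕ) = 0) (c : Fin k → Color)
    (hs : 0 < s) :
    IsLevelLeaf (graph (α := α) hΔ hα k s c) (k - j)
      (toFin (onBackbone j t ⟨s - 1, by omega⟩)) := by
  refine ⟨hasLevel_onBackbone hΔ hα ht c _, fun u hu => ?_⟩
  obtain ⟨w, hw, -⟩ := (leftChild'_iff hΔ hα c _ _).1 hu.1
  simp only [onBackbone, left, Function.update_self] at hw
  split_ifs at hw with h
  omega

theorem label_onBackbone (c : Fin k → Color) {i : Fin s} (hi : s ≤ i + 2) :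
    ((graph (α := α) hΔ hα k s c).label (toFin (onBackbone j t i))).color = c j := by
  rw [label_toFin]; simp [stdLabel, color, onBackbone, hi]

/-- If all nodes hanging from a backbone decline, then its top node declines or knows the color
at the bottom of the backbone. -/
theorem out_top (ht : ∀ i, j < i → (t i : ℕ) = 0) (hs : 3 ≤ s) (c : Fin k → Color)
    {out : Fin (4 * (k * s ^ k)) → OutColor}
    (hout : ValidTHC k (graph (α := α) hΔ hα k s c) out)
    (hD : ∀ i w, RightChild (graph (α := α) hΔ hα k s c) (toFin (onBackbone j t i)) w →
      out w = OutColor.D) :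
    (out (toFin (onBackbone j t ⟨0, by omega⟩)) = (c j).toOut) ∨
      ((j : ℕ) ≠ 0 ∧ out (toFin (onBackbone j t ⟨0, by omega⟩)) = OutColor.D) := by
  have hj := j.2
  have toOut_ne : ∀ c : Color, c.toOut ≠ OutColor.X ∧ c.toOut ≠ OutColor.D := by
    intro c; cases c <;> simp [Color.toOut]
  have hR : ∀ i, ¬ ∃ w, RightChild (graph (α := α) hΔ hα k s c) (toFin (onBackbone j t i)) w ∧
      (out w = OutColor.R ∨ out w = OutColor.B ∨ out w = OutColor.X) := by
    rintro i ⟨w, hw, h⟩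
    rw [hD i w hw] at h
    simp at h
  have hleaf := hout.cond2 _ _ (by omega) (isLevelLeaf_onBackbone hΔ hα ht c (by omega))
  rw [label_onBackbone hΔ hα c (by simp only; omega)] at hleaf
  -- the color of the last but one node, and the fact that no node above it is exempt
  suffices H : (out (toFin (onBackbone j t ⟨s - 2, by omega⟩)) = (c j).toOut ∨
      ((j : ℕ) ≠ 0 ∧ out (toFin (onBackbone j t ⟨s - 2, by omega⟩)) = OutColor.D)) ∧
      ∀ i (hi : i + 1 < s), out (toFin (onBackbone j t ⟨i + 1, hi⟩)) ≠ OutColor.X →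
        out (toFin (onBackbone j t ⟨i, by omega⟩)) =
          out (toFin (onBackbone j t ⟨i + 1, hi⟩)) by
    have : ∀ d, ∀ h : d ≤ s - 2, out (toFin (onBackbone j t ⟨s - 2 - d, by omega⟩)) =
        out (toFin (onBackbone j t ⟨s - 2, by omega⟩)) := by
      intro d
      induction d with
      | zero => intro _; rfl
      | succ d ih =>
        intro h
        have e := H.2 (s - 2 - (d + 1)) (by omega)
        have e1 : s - 2 - (d + 1) + 1 = s - 2 - d := by omega
        simp only [e1] at e
        rw [ih (by omega)] at e
        refine e ?_
        rcases H.1 with h1 | h1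
        · rw [h1]; exact (toOut_ne _).1
        · rw [h1.2]; simp
    have h0 := this (s - 2) le_rfl
    simp only [Nat.sub_self] at h0
    rw [h0]
    exact H.1
  have hlast : s - 2 + 1 = s - 1 := by omega
  have hL := fun i hi => leftChild_onBackbone (α := α) hΔ hα ht c (i := i) hi
  have hLlast := hL (s - 2) (by omega)
  have hcol := label_onBackbone (α := α) (j := j) (t := t) hΔ hα c (i := ⟨s - 2, by omega⟩)
    (by simp only; omega)
  simp only [hlast] at hLlast
  by_cases h0 : (j : ℕ) = 0
  · have hk : k - (j : ℕ) = k := by omega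
    simp only [hk] at hL hLlast hleaf
    have hlev := fun i => hasLevel_onBackbone (α := α) hΔ hα ht c i
    simp only [hk] at hlev
    have hX : ∀ i, out (toFin (onBackbone j t i)) ≠ OutColor.X :=
      fun i hi => hR i (hout.cond5a _ (hlev i) hi)
    have heq : ∀ i (hi : i + 1 < s), out (toFin (onBackbone j t ⟨i, by omega⟩)) =
        out (toFin (onBackbone j t ⟨i + 1, hi⟩)) := fun i hi => by
      rcases hout.cond5b _ _ (hL i hi) (hX _) with h | h
      · exact h.2
      · exact absurd h.1 (hX _)
    refine ⟨Or.inl ?_, fun i hi _ => heq i hi⟩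
    rw [heq (s - 2) (by omega)]
    simp only [hlast]
    have h5 := hout.cond5 _ (hlev ⟨s - 1, by omega⟩)
    rcases hleaf with h | h | h
    · exact h
    · rw [h] at h5; simp at h5
    · exact absurd h (hX _)
  · by_cases h1 : k - (j : ℕ) = 1
    · simp only [h1] at hL hLlast hleaf
      have hlev := fun i => hasLevel_onBackbone (α := α) hΔ hα ht c i
      simp only [h1] at hlev
      have heq := fun i hi => hout.cond3b _ _ (by omega) (hL i hi)
      refine ⟨?_, fun i hi _ => heq i hi⟩
      rw [heq (s - 2) (by omega)]
      simp only [hlast]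
      have h3 := hout.cond3a _ (by omega) (hlev ⟨s - 1, by omega⟩)
      rcases hleaf with h | h | h
      · exact Or.inl h
      · exact Or.inr ⟨h0, h⟩
      · rw [h] at h3; simp at h3
    · have h4 := fun i hi => hout.cond4 _ (by omega) (by omega) _ _ (hL i hi)
      have h4last := hout.cond4 _ (by omega) (by omega) _ _ hLlast
      refine ⟨?_, fun i hi hX => ?_⟩
      · rcases h4last with ⟨h, hne⟩ | h | h
        · rw [h] at hne ⊢
          rcases hleaf with h | h | h
          · exact Or.inl h
          · exact Or.inr ⟨h0, h⟩
          · rw [h] at hne; simp at hne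
        · exact absurd h.2 (hR _)
        · rw [hcol] at h
          rcases h.1 with h | h
          · exact Or.inl h
          · exact Or.inr ⟨h0, h⟩
      · rcases h4 i hi with h | h | h
        · exact h.1
        · exact absurd h.2 (hR _)
        · exact absurd h.2 hX

end Backbone

end BalNode

namespace BalNode

variable {Δ : ℕ} {α : ℝ} {k s : ℕ} (hΔ : 3 ≤ Δ) (hα : 1 ≤ α)

/-- No algorithm of distance cost less than `s - 2` is correct, for one fixed sequence of random
bits, on all the balanced forests that differ in the colors at the bottoms of the backbones. -/
theorem not_all_succeed (hk : 1 ≤ k) (hs : 3 ≤ s) {A : Algorithm (TreeLabel Δ) OutColor} {n : ℕ}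
    (hn : 4 * (k * s ^ k) ≤ n) (hcost : distCost Δ α A n < (s - 2 : ℕ))
    (r : Fin (4 * (k * s ^ k)) × ℕ → Bool)
    (h : ∀ c : Fin k → Color,
      Succeeds (hierarchicalTHC Δ α k) A (graph (α := α) hΔ hα k s c) r) : False := by
  choose out hout hvalid using h
  let flip : Color → Color := fun c => match c with | Color.R => Color.B | Color.B => Color.R
  have hflip : ∀ c, (flip c).toOut ≠ c.toOut := by intro c; cases c <;> simp [flip, Color.toOut]
  have hcD : ∀ c : Color, c.toOut ≠ OutColor.D := by intro c; cases c <;> simp [Color.toOut]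
  have htop : ∀ (j : Fin k) (t : Fin k → Fin s) (c : Fin k → Color),
      out (Function.update c j (flip (c j))) (toFin (onBackbone j t ⟨0, by omega⟩)) =
        out c (toFin (onBackbone j t ⟨0, by omega⟩)) := fun j t c =>
    (hout _ _).unique (outputs_congr hΔ hα hn hcost c _ j
      (fun i hi => by rw [Function.update_of_ne hi]) r _ (by simp [pos, onBackbone]) (hout c _))
  -- whatever the colors are, the top node of a backbone must decline, and must not for index `0`
  have main : ∀ (j : Fin k) (t : Fin k → Fin s), (∀ i, j < i → (t i : ℕ) = 0) →
      (∀ c i w, RightChild (graph (α := α) hΔ hα k s c) (toFin (onBackbone j t i)) w →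
        out c w = OutColor.D) →
      (j : ℕ) ≠ 0 ∧ ∀ c, out c (toFin (onBackbone j t ⟨0, by omega⟩)) = OutColor.D := by
    intro j t ht hD
    have key : ∀ c, (j : ℕ) ≠ 0 ∧
        out c (toFin (onBackbone j t ⟨0, by omega⟩)) = OutColor.D := by
      intro c
      have h1 := out_top hΔ hα ht hs c (hvalid c) (hD c)
      have h2 := out_top hΔ hα ht hs _ (hvalid _) (hD (Function.update c j (flip (c j))))
      rw [htop, Function.update_self] at h2
      rcases h1 with h1 | h1
      · rcases h2 with h2 | h2
        · exact absurd (h2.symm.trans h1) (hflip _)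
        · exact absurd (h1.symm.trans h2.2) (hcD _)
      · exact h1
    exact ⟨(key fun _ => Color.R).1, fun c => (key c).2⟩
  have hdesc : ∀ d (j : Fin k), (j : ℕ) + d + 1 = k → ∀ t : Fin k → Fin s,
      (∀ i, j < i → (t i : ℕ) = 0) → (j : ℕ) ≠ 0 ∧
        ∀ c, out c (toFin (onBackbone j t ⟨0, by omega⟩)) = OutColor.D := by
    intro d
    induction d with
    | zero =>
      intro j hj t ht
      refine main j t ht fun c i w hw => ?_
      obtain ⟨v, hv, -⟩ := (rightChild_iff hΔ hα c _ _).1 hw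
      obtain ⟨h, -⟩ := eq_of_right hv
      simp only [onBackbone] at h
      omega
    | succ d ih =>
      intro j hj t ht
      refine main j t ht fun c i w hw => ?_
      obtain ⟨v, hv, rfl⟩ := (rightChild_iff hΔ hα c _ _).1 hw
      obtain ⟨hj1, h0, rfl⟩ := eq_of_right hv
      simp only [onBackbone] at hj1 h0 ⊢
      have hz : ∀ i', (⟨j + 1, hj1⟩ : Fin k) < i' → ((Function.update t j i) i' : ℕ) = 0 := by
        intro i' hi'
        rw [Fin.lt_def] at hi'
        simp only at hi'
        rw [Function.update_of_ne (by rintro rfl; omega)]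
        exact ht i' (by rw [Fin.lt_def]; omega)
      have := (ih ⟨j + 1, hj1⟩ (by simp only; omega) (Function.update t j i) hz).2 c
      have e : onBackbone (⟨j + 1, hj1⟩ : Fin k) (Function.update t j i) ⟨0, by omega⟩ =
          (⟨j + 1, hj1⟩, Function.update t j i) := by
        unfold onBackbone
        congr 1
        rw [Function.update_eq_self_iff]
        exact Fin.ext h0.symm
      rwa [e] at this
  exact (hdesc (k - 1) ⟨0, by omega⟩ (by simp only; omega) (fun _ => ⟨0, by omega⟩)
    (fun _ _ => rfl)).1 rfl

end BalNode

theorem le_distCost_of_solvesRand {Δ : ℕ} {α : ℝ} {k s : ℕ} (hΔ : 3 ≤ Δ) (hα : 1 ≤ α) (hk : 1 ≤ k)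
    (hs : 3 ≤ s) {C : ℝ} (hC : 2 ^ k * C < s) {A : Algorithm (TreeLabel Δ) OutColor}
    (hA : SolvesRand (hierarchicalTHC Δ α k) C A) {n : ℕ} (hn : 4 * (k * s ^ k) ≤ n) :
    ((s - 2 : ℕ) : ℕ∞) ≤ distCost Δ α A n := by
  by_contra hcost
  push Not at hcost
  set m := 4 * (k * s ^ k) with hm
  let γ : Bool → Color := fun b => bif b then Color.B else Color.R
  let fail : (Fin k → Bool) → Set (Fin m × ℕ → Bool) := fun b =>
    {r | ¬ Succeeds (hierarchicalTHC Δ α k) A (BalNode.graph (α := α) hΔ hα k s (γ ∘ b)) r}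
  have hsm : (s : ℝ) ≤ m := by
    have : s ≤ m := by
      calc s = s ^ 1 := (pow_one s).symm
        _ ≤ s ^ k := Nat.pow_le_pow_right (by omega) hk
        _ ≤ k * s ^ k := Nat.le_mul_of_pos_left _ hk
        _ ≤ m := by omega
    exact_mod_cast this
  have hs0 : (0 : ℝ) < s := by exact_mod_cast (by omega : 0 < s)
  have hfail : coinMeasure m (⋃ b, fail b) < 1 := by
    calc coinMeasure m (⋃ b, fail b) ≤ ∑ b, coinMeasure m (fail b) := measure_iUnion_fintype_le _ _
      _ ≤ ∑ _b : Fin k → Bool, ENNReal.ofReal (C / m) := Finset.sum_le_sum fun b _ => hA m _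
      _ = ENNReal.ofReal (2 ^ k * (C / m)) := by
        rw [ENNReal.ofReal_mul (by positivity), ENNReal.ofReal_pow (by norm_num)]
        simp
      _ < 1 := by
        rw [ENNReal.ofReal_lt_one, ← mul_div_assoc, div_lt_one (hs0.trans_le hsm)]
        exact hC.trans_le hsm
  obtain ⟨r, hr⟩ : ∃ r, r ∉ ⋃ b, fail b := by
    by_contra! h
    rw [Set.eq_univ_of_forall h, measure_univ] at hfail
    exact lt_irrefl _ hfail
  simp only [Set.mem_iUnion, not_exists, fail, Set.mem_ofPred_eq, not_not] at hr
  refine BalNode.not_all_succeed hΔ hα hk hs hn hcost r fun c => ?_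
  have e : γ ∘ (fun i => match c i with | Color.R => false | Color.B => true) = c := by
    funext i; simp only [Function.comp_apply]; cases c i <;> rfl
  rw [← e]
  exact hr _

theorem isBigOmega_rDist {Δ : ℕ} {α : ℝ} {k : ℕ} (hΔ : 3 ≤ Δ) (hα : 1 ≤ α) (hk : 1 ≤ k) (C : ℝ) :
    IsBigOmega (RDist (hierarchicalTHC Δ α k) C) (fun n => (n : ℝ) ^ (1 / (k : ℝ))) := by
  have hk0 : (0 : ℝ) < k := by exact_mod_cast hk
  refine ⟨1 / (8 * k), by positivity, ?_⟩
  have hT : Tendsto (fun n : ℕ => (n : ℝ) ^ (1 / (k : ℝ))) atTop atTop :=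
    (tendsto_rpow_atTop (by positivity)).comp tendsto_natCast_atTop_atTop
  filter_upwards [hT.eventually_ge_atTop (8 * k * (3 + max 3 (2 ^ k * C)))] with n hn
  -- backbones of length about `(n / 4 k) ^ (1 / k)`
  set x : ℝ := (n : ℝ) ^ (1 / (k : ℝ)) with hx
  have hx0 : 0 ≤ x := by positivity
  set s := ⌊x / (4 * k)⌋₊ with hs
  have hs1 : (s : ℝ) ≤ x / (4 * k) := Nat.floor_le (by positivity)
  have hs2 : x / (4 * k) < s + 1 := Nat.lt_floor_add_one _
  have hx1 : 2 * (3 + max 3 (2 ^ k * C)) ≤ x / (4 * k) := by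
    rw [le_div_iff₀ (by positivity)]; linarith
  have h3 := le_max_left (3 : ℝ) (2 ^ k * C)
  have h4 := le_max_right (3 : ℝ) (2 ^ k * C)
  have hs3 : 3 ≤ s := by
    have : (3 : ℝ) ≤ s := by linarith
    exact_mod_cast this
  have hsn : 4 * (k * s ^ k) ≤ n := by
    have h5 : (s : ℝ) ^ k ≤ n / (4 * k) := by
      calc (s : ℝ) ^ k ≤ (x / (4 * k)) ^ k := pow_le_pow_left₀ (by positivity) hs1 k
        _ = x ^ k / (4 * k) ^ k := div_pow _ _ _
        _ ≤ x ^ k / (4 * k) := by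
          refine div_le_div_of_nonneg_left (by positivity) (by positivity) ?_
          refine le_self_pow₀ ?_ (by omega)
          have : (1 : ℝ) ≤ k := by exact_mod_cast hk
          linarith
        _ = n / (4 * k) := by
          rw [hx, ← Real.rpow_natCast, ← Real.rpow_mul (by positivity), one_div,
            inv_mul_cancel₀ hk0.ne', Real.rpow_one]
    rw [le_div_iff₀ (by positivity)] at h5
    have : ((4 * (k * s ^ k) : ℕ) : ℝ) ≤ n := by push_cast; linarith
    exact_mod_cast this
  have key : ((s - 2 : ℕ) : ℕ∞) ≤ RDist (hierarchicalTHC Δ α k) C n :=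
    le_iInf fun A => le_iInf fun hA =>
      le_distCost_of_solvesRand hΔ hα hk hs3 (by linarith) hA hsn
  refine le_trans ?_ (ENat.toENNReal_le.2 key)
  rw [ENat.toENNReal_coe, ← ENNReal.ofReal_natCast]
  refine ENNReal.ofReal_le_ofReal ?_
  rw [Nat.cast_sub (by omega)]
  have : 1 / (8 * (k : ℝ)) * x = x / (4 * k) / 2 := by field_simp; ring
  rw [this]
  push_cast
  linarith

/-! ### Growing frames -/

/-- A frame as it is built by the adversary. Each node carries an intended level `lev`, the mark
`leaf` if it is to have no left child, and an input color. The ports that are not pointers according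
to the label may nevertheless lead to further nodes. -/
structure GFrame {Δ : ℕ} (hΔ : 3 ≤ Δ) extends Frame Δ where
  lev : ℕ → ℕ
  leaf : ℕ → Bool
  col : ℕ → Color
  lab_eq : ∀ u, lab u = stdLabel hΔ (leaf u = false) (2 ≤ lev u) (col u)
  lev_left : ∀ {u v}, nb u 1 = some v → lev v = lev u
  lev_right : ∀ {u v}, nb u 2 = some v → lev v = lev u - 1

namespace GFrame

variable {Δ : ℕ} {hΔ : 3 ≤ Δ}

/-- `S'` extends the frame `S`. -/
structure Ext (S S' : GFrame hΔ) : Prop where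
  m_le : S.m ≤ S'.m
  nb : ∀ {u i v}, S.nb u i = some v → S'.nb u i = some v
  lev : ∀ {u}, u < S.m → S'.lev u = S.lev u
  leaf : ∀ {u}, u < S.m → S'.leaf u = S.leaf u
  col : ∀ {u}, u < S.m → S'.col u = S.col u

theorem Ext.refl (S : GFrame hΔ) : S.Ext S :=
  ⟨le_rfl, id, fun _ => rfl, fun _ => rfl, fun _ => rfl⟩

theorem Ext.trans {S S' S'' : GFrame hΔ} (h : S.Ext S') (h' : S'.Ext S'') : S.Ext S'' :=
  ⟨h.m_le.trans h'.m_le, fun hn => h'.nb (h.nb hn),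
    fun hu => (h'.lev (hu.trans_le h.m_le)).trans (h.lev hu),
    fun hu => (h'.leaf (hu.trans_le h.m_le)).trans (h.leaf hu),
    fun hu => (h'.col (hu.trans_le h.m_le)).trans (h.col hu)⟩

theorem Ext.lab {S S' : GFrame hΔ} (h : S.Ext S') {u : ℕ} (hu : u < S.m) : S'.lab u = S.lab u := by
  rw [S.lab_eq, S'.lab_eq, h.lev hu, h.leaf hu, h.col hu]

theorem grow_nb_iff (S : GFrame hΔ) {u : ℕ} {i : Fin 3} (hu : u < S.m) (h : S.nb u i = none)
    (x : ℕ) (j : Fin 3) (y : ℕ) :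
    (if x = S.m then (if j = (if i = 0 then 1 else 0) then some u else none)
      else if x = u ∧ j = i then some S.m else S.nb x j) = some y ↔
    (x = S.m ∧ j = (if i = 0 then 1 else 0) ∧ y = u) ∨ (x = u ∧ j = i ∧ y = S.m) ∨
      S.nb x j = some y := by
  have hm : ∀ j y, S.nb S.m j ≠ some y := fun j y h => lt_irrefl _ (S.nb_lt h).1
  by_cases hx : x = S.m
  · subst hx
    have := hm j y
    by_cases hj : j = (if i = 0 then 1 else 0)
    · simp [hj, hm, hu.ne', eq_comm (a := u) (b := y)]
    · simp [hj, hm, hu.ne']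
  · by_cases hxu : x = u ∧ j = i
    · obtain ⟨rfl, rfl⟩ := hxu
      simp [hx, h, eq_comm]
    · rw [if_neg hx, if_neg hxu]
      tauto

/-- Let a fresh node, with the leaf mark `lf` and the color `c`, be behind the open port `i` of
the node `u`: it is the left child, the right child, or a parent (along a left edge) of `u`. -/
def grow (S : GFrame hΔ) (u : ℕ) (i : Fin 3) (hu : u < S.m) (h : S.nb u i = none) (lf : Bool)
    (c : Color) : GFrame hΔ where
  m := S.m + 1
  nb := fun x j => if x = S.m then (if j = (if i = 0 then 1 else 0) then some u else none)
    else if x = u ∧ j = i then some S.m else S.nb x j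
  lev := fun x => if x = S.m then (if i = 2 then S.lev u - 1 else S.lev u) else S.lev x
  leaf := fun x => if x = S.m then lf else S.leaf x
  col := fun x => if x = S.m then c else S.col x
  lab := fun x => stdLabel hΔ ((if x = S.m then lf else S.leaf x) = false)
    (2 ≤ if x = S.m then (if i = 2 then S.lev u - 1 else S.lev u) else S.lev x)
    (if x = S.m then c else S.col x)
  lab_eq := fun _ => rfl
  nb_lt := by
    intro x j y hxy
    rw [S.grow_nb_iff hu h] at hxy
    rcases hxy with ⟨rfl, -, rfl⟩ | ⟨rfl, -, rfl⟩ | h'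
    · omega
    · omega
    · have := S.nb_lt h'; omega
  nb_ne := by
    intro x j y hxy
    rw [S.grow_nb_iff hu h] at hxy
    rcases hxy with ⟨rfl, -, rfl⟩ | ⟨rfl, -, rfl⟩ | h'
    · omega
    · omega
    · exact S.nb_ne h'
  nb_inj := by
    intro x j j' y hxy hxy'
    rw [S.grow_nb_iff hu h] at hxy hxy'
    rcases hxy with ⟨rfl, rfl, rfl⟩ | ⟨rfl, rfl, rfl⟩ | h' <;>
    rcases hxy' with ⟨h1, rfl, h2⟩ | ⟨h1, rfl, h2⟩ | h''
    all_goals first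
      | rfl
      | omega
      | exact S.nb_inj h' h''
      | (exfalso; have := S.nb_lt h''; omega)
      | (exfalso; have := S.nb_lt h'; omega)
  nb_down := by
    intro x j y hj hxy
    rw [S.grow_nb_iff hu h] at hxy ⊢
    rcases hxy with ⟨rfl, rfl, rfl⟩ | ⟨rfl, rfl, rfl⟩ | h'
    · by_cases hi : i = 0
      · exact Or.inr (Or.inl ⟨rfl, hi.symm, rfl⟩)
      · simp [hi] at hj
    · exact Or.inl ⟨rfl, by simp [hj], rfl⟩
    · exact Or.inr (Or.inr (S.nb_down hj h'))
  nb_up := by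
    intro x y hxy
    simp only [S.grow_nb_iff hu h] at hxy ⊢
    rcases hxy with ⟨rfl, h0, rfl⟩ | ⟨rfl, rfl, rfl⟩ | h'
    · have hi : i ≠ 0 := by rintro rfl; simp at h0
      exact ⟨i, hi, Or.inr (Or.inl ⟨rfl, rfl, rfl⟩)⟩
    · exact ⟨1, by simp, Or.inl ⟨rfl, by simp, rfl⟩⟩
    · obtain ⟨j, hj, h2⟩ := S.nb_up h'
      exact ⟨j, hj, Or.inr (Or.inr h2)⟩
  lev_left := by
    intro x y hxy
    rw [S.grow_nb_iff hu h] at hxy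
    rcases hxy with ⟨rfl, h1, rfl⟩ | ⟨rfl, rfl, rfl⟩ | h'
    · have hi : i = 0 := by by_contra hi; simp [hi] at h1
      subst hi
      simp [hu.ne]
    · simp [hu.ne]
    · have := S.nb_lt h'
      rw [if_neg (by omega), if_neg (by omega)]
      exact S.lev_left h'
  lev_right := by
    intro x y hxy
    rw [S.grow_nb_iff hu h] at hxy
    rcases hxy with ⟨rfl, h1, rfl⟩ | ⟨rfl, rfl, rfl⟩ | h'
    · split_ifs at h1 <;> simp at h1
    · simp [hu.ne]
    · have := S.nb_lt h'
      rw [if_neg (by omega), if_neg (by omega)]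
      exact S.lev_right h'

section grow

variable (S : GFrame hΔ) {u : ℕ} {i : Fin 3} (hu : u < S.m) (h : S.nb u i = none) (lf : Bool)
  (c : Color)

theorem ext_grow : S.Ext (S.grow u i hu h lf c) where
  m_le := Nat.le_succ _
  nb := fun hn => (S.grow_nb_iff hu h _ _ _).2 (Or.inr (Or.inr hn))
  lev := fun hx => if_neg hx.ne
  leaf := fun hx => if_neg hx.ne
  col := fun hx => if_neg hx.ne

theorem grow_nb : (S.grow u i hu h lf c).nb u i = some S.m :=
  (S.grow_nb_iff hu h _ _ _).2 (Or.inr (Or.inl ⟨rfl, rfl, rfl⟩))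

end grow

/-- All leaf marks are at levels above `l`. -/
def LeafAbove (S : GFrame hΔ) (l : ℕ) : Prop := ∀ u < S.m, S.leaf u = true → l < S.lev u

theorem LeafAbove.grow {S : GFrame hΔ} {l : ℕ} (hS : S.LeafAbove l) {u : ℕ} {i : Fin 3}
    (hu : u < S.m) (h : S.nb u i = none) (c : Color) :
    (S.grow u i hu h false c).LeafAbove l := by
  intro x hx hl
  by_cases hxm : x = S.m
  · simp [GFrame.grow, hxm] at hl
  · have hx' : x < S.m := by change x < S.m + 1 at hx; omega
    rw [(S.ext_grow hu h false c).leaf hx'] at hl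
    rw [(S.ext_grow hu h false c).lev hx']
    exact hS x hx' hl

section Graph

variable {α : ℝ} {n : ℕ} (hα : 1 ≤ α)

/-- The completion of the frame `S`. -/
noncomputable abbrev graph (S : GFrame hΔ) (hn : 4 * S.m ≤ n) :
    LabeledGraph Δ α (TreeLabel Δ) n := S.toFrame.toGraph hΔ hα hn

theorem lab_wf (S : GFrame hΔ) (u : ℕ) : (S.lab u).WellFormed := by
  rw [S.lab_eq]; exact stdLabel_wellFormed ..

theorem rightChild_iff {S : GFrame hΔ} (hn : 4 * S.m ≤ n) {u : Fin n} (hu : (u : ℕ) < S.m)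
    (hl : 2 ≤ S.lev u) (y : Fin n) :
    RightChild (S.graph hα hn) u y ↔ S.nb u 2 = some (y : ℕ) := by
  unfold RightChild
  rw [S.toFrame.label_toGraph hΔ hα hn hu]
  have : (S.lab u).right = some ⟨2, by omega⟩ := by simp [S.lab_eq, stdLabel, hl]
  rw [this]
  exact S.toFrame.child_toGraph hΔ hα hn hu (S.lab_wf u) (i := 2) (by simp; omega) (by simp)
    (fun v _ => ⟨S.lab_wf v, by simp [S.lab_eq, stdLabel]⟩) y

theorem not_rightChild {S : GFrame hΔ} (hn : 4 * S.m ≤ n) {u : Fin n} (hu : (u : ℕ) < S.m)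
    (hl : ¬ 2 ≤ S.lev u) (y : Fin n) : ¬ RightChild (S.graph hα hn) u y := by
  rintro ⟨⟨-, j, hj, h, -⟩, -⟩
  rw [S.toFrame.label_toGraph hΔ hα hn hu, S.lab_eq] at h
  simp [stdLabel, hl] at h

theorem leftChild'_iff {S : GFrame hΔ} (hn : 4 * S.m ≤ n) {u : Fin n} (hu : (u : ℕ) < S.m)
    (hl : S.leaf u = false) (y : Fin n) :
    LeftChild' (S.graph hα hn) u y ↔ S.nb u 1 = some (y : ℕ) := by
  unfold LeftChild'
  rw [S.toFrame.label_toGraph hΔ hα hn hu]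
  have : (S.lab u).left = some ⟨1, by omega⟩ := by simp [S.lab_eq, stdLabel, hl]
  rw [this]
  exact S.toFrame.child_toGraph hΔ hα hn hu (S.lab_wf u) (i := 1) (by simp; omega) (by simp)
    (fun v _ => ⟨S.lab_wf v, by simp [S.lab_eq, stdLabel]⟩) y

theorem not_leftChild' {S : GFrame hΔ} (hn : 4 * S.m ≤ n) {u : Fin n} (hu : (u : ℕ) < S.m)
    (hl : S.leaf u = true) (y : Fin n) : ¬ LeftChild' (S.graph hα hn) u y := by
  rintro ⟨⟨-, j, hj, h, -⟩, -⟩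
  rw [S.toFrame.label_toGraph hΔ hα hn hu, S.lab_eq] at h
  simp [stdLabel, hl] at h

theorem color_graph {S : GFrame hΔ} (hn : 4 * S.m ≤ n) {u : Fin n} (hu : (u : ℕ) < S.m) :
    ((S.graph hα hn).label u).color = S.col u := by
  rw [S.toFrame.label_toGraph hΔ hα hn hu, S.lab_eq]; rfl

/-- The level of `u` is `l` in the completions of all extensions of `S`. -/
def FixedLevel (α : ℝ) (n : ℕ) (hα : 1 ≤ α) (S : GFrame hΔ) (u l : ℕ) : Prop :=
  ∀ S' : GFrame hΔ, S.Ext S' → ∀ (hn : 4 * S'.m ≤ n) (hu : u < n),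
    HasLevel (S'.graph (α := α) hα hn) ⟨u, hu⟩ l

theorem FixedLevel.mono {S S' : GFrame hΔ} {u l : ℕ} (h : FixedLevel α n hα S u l)
    (hS : S.Ext S') : FixedLevel α n hα S' u l := fun S'' h'' => h S'' (hS.trans h'')

/-- Adding a chain of right children fixes the level of a node. -/
theorem exists_fixedLevel (l' : ℕ) (S : GFrame hΔ) (hS : S.LeafAbove l') {u l : ℕ} (hu : u < S.m)
    (hl : S.lev u = l + 1) :
    ∃ S' : GFrame hΔ, S.Ext S' ∧ S'.m ≤ S.m + l ∧ S'.LeafAbove l' ∧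
      FixedLevel α n hα S' u (l + 1) := by
  induction l generalizing S u with
  | zero =>
    refine ⟨S, Ext.refl S, le_rfl, hS, fun S' h' hn hun => HasLevel.one _ fun y => ?_⟩
    refine not_rightChild hα hn (hu.trans_le h'.m_le) ?_ y
    rw [h'.lev hu]; omega
  | succ l ih =>
    obtain ⟨S1, v, h1, h1m, h1l, hv⟩ : ∃ (S1 : GFrame hΔ) (v : ℕ), S.Ext S1 ∧ S1.m ≤ S.m + 1 ∧
        S1.LeafAbove l' ∧ S1.nb u 2 = some v := by
      rcases h : S.nb u 2 with _ | v
      · exact ⟨S.grow u 2 hu h false Color.R, S.m, S.ext_grow .., le_rfl, hS.grow hu h _,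
          S.grow_nb ..⟩
      · exact ⟨S, v, Ext.refl S, by omega, hS, h⟩
    have hlev : S1.lev u = l + 2 := by rw [h1.lev hu, hl]
    obtain ⟨S2, h2, h2m, h2l, hv2⟩ := ih S1 h1l (S1.nb_lt hv).2 (by rw [S1.lev_right hv, hlev]; rfl)
    refine ⟨S2, h1.trans h2, by omega, h2l, fun S' h' hn hun => ?_⟩
    have hvn : v < n := by have := (S'.nb_lt (h'.nb (h2.nb hv))).2; omega
    refine HasLevel.succ _ ⟨v, hvn⟩ _ ?_ (hv2 S' h' hn hvn)
    refine (rightChild_iff hα hn ?_ ?_ _).2 (h'.nb (h2.nb hv))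
    · exact (S'.nb_lt (h'.nb (h2.nb hv))).1
    · have h3 := (h2.trans h').lev (S1.nb_lt hv).1
      simp only
      rw [h3, hlev]; omega

end Graph

end GFrame

/-! ### Simulating an algorithm on a growing frame -/

namespace GFrame

variable {Δ : ℕ} {hΔ : 3 ≤ Δ} {α : ℝ} {n : ℕ} (hα : 1 ≤ α)
  (A : Algorithm (TreeLabel Δ) OutColor) (r : Fin n × ℕ → Bool)

/-- As long as an execution stays inside a frame, it is the same on all extensions. -/
theorem step_congr {S S' : GFrame hΔ} (hS : S.Ext S') (hn : 4 * S.m ≤ n) (hn' : 4 * S'.m ≤ n)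
    (st : ExecState (TreeLabel Δ) n)
    (h : ∀ x ∈ (step A (S.graph (α := α) hα hn) r st).visited, (x : ℕ) < S.m) :
    step A (S'.graph (α := α) hα hn') r st = step A (S.graph (α := α) hα hn) r st := by
  unfold step at h ⊢
  cases hA : A n st.history with
  | output o => rfl
  | coin w => rfl
  | query w j =>
    simp only [hA] at h ⊢
    have e : (fun x => decide ((S'.graph (α := α) hα hn').ident x = w)) =
      (fun x => decide ((S.graph (α := α) hα hn).ident x = w)) := rfl
    rw [e]
    cases hf : st.visited.find? (fun x => decide ((S.graph (α := α) hα hn).ident x = w)) with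
    | none => rfl
    | some x =>
      simp only [hf] at h ⊢
      have hxv := List.mem_of_find?_eq_some hf
      have hx : (x : ℕ) < S.m := by
        by_cases hj : j < (S.graph (α := α) hα hn).deg x
        · rw [dif_pos hj] at h
          exact h x (List.mem_append_left _ hxv)
        · rw [dif_neg hj] at h
          exact h x hxv
      have hx' : (x : ℕ) < S'.m := hx.trans_le hS.m_le
      have hd := S.toFrame.deg_toGraph hΔ hα hn hx
      have hd' := S'.toFrame.deg_toGraph hΔ hα hn' hx'
      by_cases hj : j < 3
      · have hj1 := hj
        have hj2 := hj
        rw [← hd] at hj1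
        rw [← hd'] at hj2
        rw [dif_pos hj1] at h
        rw [dif_pos hj1, dif_pos hj2]
        have hq := h _ (List.mem_append_right _ (List.mem_singleton.2 rfl))
        have hp := S.toFrame.port_toGraph hΔ hα hn hx j hj1
        have hp' := S'.toFrame.port_toGraph hΔ hα hn' hx' j hj2
        rw [hp] at hq
        rcases hnb : S.nb x ⟨j, hj⟩ with _ | y
        · rw [S.toFrame.q_eq_of_none hnb] at hq; omega
        · rw [S.toFrame.q_eq_of_some hnb] at hp hq
          rw [S'.toFrame.q_eq_of_some (hS.nb hnb)] at hp'
          have hy : ((S'.graph (α := α) hα hn').port x ⟨j, hj2⟩ : Fin n) =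
              ((S.graph (α := α) hα hn).port x ⟨j, hj1⟩ : Fin n) := Fin.ext (hp'.trans hp.symm)
          have hi : ∀ z : Fin n, (z : ℕ) < S.m → (S'.graph (α := α) hα hn').info z =
              (S.graph (α := α) hα hn).info z := fun z hz => by
            unfold LabeledGraph.info
            rw [S.toFrame.deg_toGraph hΔ hα hn hz,
              S'.toFrame.deg_toGraph hΔ hα hn' (hz.trans_le hS.m_le),
              S.toFrame.label_toGraph hΔ hα hn hz,
              S'.toFrame.label_toGraph hΔ hα hn' (hz.trans_le hS.m_le), hS.lab hz]
            rfl
          rw [hy, hi _ (by rw [hp]; exact hq)]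
      · rw [dif_neg (by rw [hd']; exact hj), dif_neg (by rw [hd]; exact hj)]

theorem exec_congr {S S' : GFrame hΔ} (hS : S.Ext S') (hn : 4 * S.m ≤ n) (hn' : 4 * S'.m ≤ n)
    {v : Fin n} {t : ℕ}
    (h : ∀ x ∈ (exec A (S.graph (α := α) hα hn) r v t).visited, (x : ℕ) < S.m) :
    exec A (S'.graph (α := α) hα hn') r v t = exec A (S.graph (α := α) hα hn) r v t := by
  induction t with
  | zero =>
    have hv : (v : ℕ) < S.m := h v (by simp [exec])
    simp only [exec, Function.iterate_zero, id_eq, LabeledGraph.info]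
    rw [S.toFrame.deg_toGraph hΔ hα hn hv,
      S'.toFrame.deg_toGraph hΔ hα hn' (hv.trans_le hS.m_le),
      S.toFrame.label_toGraph hΔ hα hn hv,
      S'.toFrame.label_toGraph hΔ hα hn' (hv.trans_le hS.m_le), hS.lab hv]
    rfl
  | succ t ih =>
    have h' := ih fun x hx => h x ((visited_prefix_exec A _ r v (Nat.le_succ t)).subset hx)
    rw [exec_succ, exec_succ, h']
    exact step_congr hα A r hS hn hn' _ (by rw [← exec_succ]; exact h)

/-- The output of `u` is `o` in the completions of all extensions of `S`. -/
def FixedOutput (S : GFrame hΔ) (u : ℕ) (o : OutColor) : Prop :=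
  ∀ S' : GFrame hΔ, S.Ext S' → ∀ (hn : 4 * S'.m ≤ n) (hu : u < n),
    Outputs A (S'.graph (α := α) hα hn) r ⟨u, hu⟩ o

variable {hα A r} in
theorem FixedOutput.mono {S S' : GFrame hΔ} {u : ℕ} {o : OutColor}
    (h : FixedOutput hα A r S u o) (hS : S.Ext S') : FixedOutput hα A r S' u o :=
  fun S'' h'' => h S'' (hS.trans h'')

theorem card_visited_le {M : ℕ} {G : LabeledGraph Δ α (TreeLabel Δ) n}
    {v : Fin n} (hM : (visitedSet A G r v).encard ≤ M) (t : ℕ) :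
    (exec A G r v t).visited.toFinset.card ≤ M := by
  have h : ((exec A G r v t).visited.toFinset : Set (Fin n)) ⊆ visitedSet A G r v := by
    intro u hu
    exact ⟨t, by simpa using hu⟩
  have := (Set.encard_le_encard h).trans hM
  rw [Set.encard_coe_eq_coe_finsetCard] at this
  exact_mod_cast this

/-- Whenever the execution leaves the frame, let a fresh node be there: an execution that visits at
most `M` nodes can be confined to an extension by at most `M` nodes. -/
theorem exists_fixedOutput_aux {k M l : ℕ}
    (hA : ∀ G : LabeledGraph Δ α (TreeLabel Δ) n, Succeeds (hierarchicalTHC Δ α k) A G r)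
    (hM : ∀ (G : LabeledGraph Δ α (TreeLabel Δ) n) v, (visitedSet A G r v).encard ≤ M)
    (d : ℕ) (S : GFrame hΔ) (hl : S.LeafAbove l) (hn : 4 * (S.m + d) ≤ n) (v : Fin n) (t : ℕ)
    (ht : ∀ x ∈ (exec A (S.graph (α := α) hα (by omega)) r v t).visited, (x : ℕ) < S.m)
    (hd : M < (exec A (S.graph (α := α) hα (by omega)) r v t).visited.toFinset.card + d) :
    ∃ S' : GFrame hΔ, S.Ext S' ∧ S'.m ≤ S.m + d ∧ S'.LeafAbove l ∧
      ∃ o, FixedOutput hα A r S' v o := by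
  induction d generalizing S t with
  | zero => have := card_visited_le A r (hM (S.graph (α := α) hα (by omega)) v) t; omega
  | succ d ih =>
    set G := S.graph (α := α) hα (by omega : 4 * S.m ≤ n) with hG
    obtain ⟨out, hout, -⟩ := hA G
    obtain ⟨T, hT⟩ := hout v
    by_cases hin : ∀ t, ∀ x ∈ (exec A G r v t).visited, (x : ℕ) < S.m
    · refine ⟨S, Ext.refl S, by omega, hl, out v, fun S' hS' hn' hv => ⟨T, ?_⟩⟩
      rw [← hT, exec_congr hα A r hS' (by omega) hn' (hin T)]
    · -- the first step that leaves the frame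
      push Not at hin
      classical
      obtain ⟨hx, hmin⟩ := And.intro (Nat.find_spec hin) (fun m => Nat.find_min (m := m) hin)
      generalize Nat.find hin = t' at hx hmin
      have htt' : t < t' := by
        by_contra hle
        obtain ⟨x, hx, hxm⟩ := hx
        exact absurd (ht x ((visited_prefix_exec A _ r v (not_lt.1 hle)).subset hx)) (not_lt.2 hxm)
      obtain ⟨t1, rfl⟩ : ∃ t1, t' = t1 + 1 := ⟨t' - 1, by omega⟩
      have ht1 : ∀ x ∈ (exec A G r v t1).visited, (x : ℕ) < S.m := by
        have := hmin t1 (by omega)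
        push Not at this
        exact this
      obtain ⟨x, hx, hxm⟩ := hx
      rw [exec_succ] at hx
      set st := exec A G r v t1 with hst
      have hcard : (exec A G r v t).visited.toFinset.card ≤ st.visited.toFinset.card :=
        Finset.card_le_card fun y hy => by
          rw [List.mem_toFinset] at hy ⊢
          exact (visited_prefix_exec A _ r v (by omega)).subset hy
      unfold step at hx
      cases hmv : A n st.history with
      | output o => simp only [hmv] at hx; exact absurd (ht1 x hx) (by omega)
      | coin w =>
        simp only [hmv] at hx
        split at hx <;> exact absurd (ht1 x hx) (by omega)
      | query w j =>
        simp only [hmv] at hx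
        cases hf : st.visited.find? (fun x => decide (G.ident x = w)) with
        | none => simp only [hf] at hx; exact absurd (ht1 x hx) (by omega)
        | some y =>
          simp only [hf] at hx
          have hy := ht1 y (List.mem_of_find?_eq_some hf)
          have hdeg := S.toFrame.deg_toGraph (n := n) (α := α) hΔ hα (by omega) hy
          by_cases hj : j < G.deg y
          swap
          · rw [dif_neg hj] at hx; exact absurd (ht1 x hx) (by omega)
          rw [dif_pos hj] at hx
          have hxq : x = (G.port y ⟨j, hj⟩ : Fin n) := by
            rcases List.mem_append.1 hx with h | h
            · exact absurd (ht1 x h) (by omega)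
            · exact List.mem_singleton.1 h
          have hj3 : j < 3 := by rw [← hdeg]; exact hj
          have hp := S.toFrame.port_toGraph hΔ hα (by omega : 4 * S.m ≤ n) hy j hj
          rw [← hxq] at hp
          have hnb : S.nb y ⟨j, hj3⟩ = none := by
            by_contra hne
            obtain ⟨z, hz⟩ := Option.ne_none_iff_exists'.1 hne
            rw [S.toFrame.q_eq_of_some hz] at hp
            have := (S.nb_lt hz).2
            omega
          set S1 := S.grow y ⟨j, hj3⟩ hy hnb false Color.B with hS1
          have hext : S.Ext S1 := S.ext_grow ..
          have hm1 : S1.m = S.m + 1 := rfl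
          have hn1 : 4 * S1.m ≤ n := by omega
          have hdeg1 := S1.toFrame.deg_toGraph (n := n) (α := α) hΔ hα hn1
            (hy.trans_le hext.m_le)
          have hj1 : j < (S1.graph (α := α) hα hn1).deg y := by rw [hdeg1]; exact hj3
          have hp1 := S1.toFrame.port_toGraph hΔ hα hn1 (hy.trans_le hext.m_le) j hj1
          rw [S1.toFrame.q_eq_of_some (S.grow_nb hy hnb false Color.B)] at hp1
          have e1 : exec A (S1.graph (α := α) hα hn1) r v t1 = st :=
            exec_congr hα A r hext (by omega) hn1 ht1
          have hvis : (exec A (S1.graph (α := α) hα hn1) r v (t1 + 1)).visited =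
              st.visited ++ [((S1.graph (α := α) hα hn1).port y ⟨j, hj1⟩ : Fin n)] := by
            rw [exec_succ, e1]
            unfold step
            have e : (fun x => decide ((S1.graph (α := α) hα hn1).ident x = w)) =
              (fun x => decide (G.ident x = w)) := rfl
            simp only [hmv, e, hf]
            rw [dif_pos hj1]
          obtain ⟨S', h1, h2, h3, h4⟩ := ih S1 (hl.grow hy hnb _) (by omega) (t1 + 1)
            (by
              rw [hvis]
              intro z hz
              rcases List.mem_append.1 hz with h | h
              · have := ht1 z h; omega
              · rw [List.mem_singleton.1 h, hp1]; omega)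
            (by
              have : (exec A (S1.graph (α := α) hα hn1) r v (t1 + 1)).visited.toFinset.card =
                  st.visited.toFinset.card + 1 := by
                rw [hvis, List.toFinset_append, List.toFinset_cons, List.toFinset_nil,
                  insert_empty_eq, Finset.union_comm, ← Finset.insert_eq,
                  Finset.card_insert_of_notMem]
                rw [List.mem_toFinset]
                intro h
                have := ht1 _ h
                rw [hp1] at this
                exact lt_irrefl _ this
              rw [this]
              omega)
          exact ⟨S', hext.trans h1, by omega, h3, h4⟩

theorem exists_fixedOutput {k M l : ℕ}
    (hA : ∀ G : LabeledGraph Δ α (TreeLabel Δ) n, Succeeds (hierarchicalTHC Δ α k) A G r)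
    (hM : ∀ (G : LabeledGraph Δ α (TreeLabel Δ) n) v, (visitedSet A G r v).encard ≤ M)
    (S : GFrame hΔ) (hl : S.LeafAbove l) (hn : 4 * (S.m + M) ≤ n) {u : ℕ} (hu : u < S.m) :
    ∃ S' : GFrame hΔ, S.Ext S' ∧ S'.m ≤ S.m + M ∧ S'.LeafAbove l ∧
      ∃ o, FixedOutput hα A r S' u o :=
  exists_fixedOutput_aux hα A r hA hM M S hl hn ⟨u, by omega⟩ 0 (by simpa [exec] using hu)
    (by simp [exec])

/-- Binary search for a change of the output along a path of left children. -/
theorem exists_change {k M l : ℕ}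
    (hA : ∀ G : LabeledGraph Δ α (TreeLabel Δ) n, Succeeds (hierarchicalTHC Δ α k) A G r)
    (hM : ∀ (G : LabeledGraph Δ α (TreeLabel Δ) n) v, (visitedSet A G r v).encard ≤ M)
    (p : ℕ → ℕ) (o : OutColor) (e : ℕ) (S : GFrame hΔ) (hl : S.LeafAbove l)
    (hn : 4 * (S.m + e * M) ≤ n) {a b : ℕ} (hab : a < b) (hbe : b ≤ a + 2 ^ e)
    (hp : ∀ i ≤ b, p i < S.m) (ha : FixedOutput hα A r S (p a) o) {o' : OutColor}
    (hb : FixedOutput hα A r S (p b) o') (ho : o' ≠ o) :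
    ∃ S' : GFrame hΔ, S.Ext S' ∧ S'.m ≤ S.m + e * M ∧ S'.LeafAbove l ∧
      ∃ i, i < b ∧ FixedOutput hα A r S' (p i) o ∧
        ∃ o'', o'' ≠ o ∧ FixedOutput hα A r S' (p (i + 1)) o'' := by
  induction e generalizing S a b o' with
  | zero =>
    obtain rfl : b = a + 1 := by simp at hbe; omega
    exact ⟨S, Ext.refl S, by omega, hl, a, hab, ha, o', ho, hb⟩
  | succ e ih =>
    have hem : (e + 1) * M = M + e * M := by ring
    rw [hem] at hn
    by_cases hsmall : b ≤ a + 2 ^ e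
    · obtain ⟨S', h1, h2, h3⟩ := ih S hl (by omega) hab hsmall hp ha hb ho
      exact ⟨S', h1, by omega, h3⟩
    · have he : 0 < 2 ^ e := by positivity
      obtain ⟨S1, h1, h1m, h1l, o1, ho1⟩ :=
        exists_fixedOutput hα A r hA hM S hl (by omega) (hp (a + 2 ^ e) (by omega))
      by_cases hoo : o1 = o
      · subst hoo
        obtain ⟨S', h2, h2m, h3⟩ := ih S1 h1l (by omega) (a := a + 2 ^ e) (b := b)
          (by omega) (by rw [pow_succ] at hbe; omega)
          (fun i hi => (hp i hi).trans_le h1.m_le) ho1 (hb.mono h1) ho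
        exact ⟨S', h1.trans h2, by omega, h3⟩
      · obtain ⟨S', h2, h2m, h3, i, hi, h4⟩ := ih S1 h1l (by omega) (a := a) (b := a + 2 ^ e)
          (by omega) le_rfl (fun i hi => (hp i (by omega)).trans_le h1.m_le) (ha.mono h1) ho1 hoo
        exact ⟨S', h1.trans h2, by omega, h3, i, by omega, h4⟩

end GFrame

namespace GFrame

variable {Δ : ℕ} {hΔ : 3 ≤ Δ}

/-- The backbone below a node that is not a left child is a path, not a cycle; its length is less
than the size of the frame. -/
theorem exists_leftPath (S : GFrame hΔ) {w : ℕ} (hw : w < S.m) (hroot : ∀ u, S.nb u 1 ≠ some w) :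
    ∃ (N : ℕ) (p : ℕ → ℕ), N < S.m ∧ p 0 = w ∧
      (∀ i < N, S.nb (p i) 1 = some (p (i + 1))) ∧ S.nb (p N) 1 = none := by
  classical
  let p : ℕ → ℕ := fun i => (fun x => (S.nb x 1).getD x)^[i] w
  have hstep : ∀ i, S.nb (p i) 1 ≠ none → S.nb (p i) 1 = some (p (i + 1)) := by
    intro i hi
    obtain ⟨y, hy⟩ := Option.ne_none_iff_exists'.1 hi
    simp only [p, Function.iterate_succ_apply'] at hy ⊢
    rw [hy]; rfl
  have hex : ∃ i < S.m, S.nb (p i) 1 = none := by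
    by_contra! hne
    have hs := fun i hi => hstep i (hne i hi)
    have hlt : ∀ i ≤ S.m, p i < S.m := by
      intro i hi
      rcases i with _ | i
      · exact hw
      · exact (S.nb_lt (hs i (by omega))).2
    have hinj : ∀ i j, i < j → j ≤ S.m → p i ≠ p j := by
      intro i
      induction i with
      | zero =>
        intro j hj hjm h
        obtain ⟨j, rfl⟩ : ∃ j', j = j' + 1 := ⟨j - 1, by omega⟩
        exact hroot (p j) (by rw [hs j (by omega), ← h]; rfl)
      | succ i ih =>
        intro j hj hjm h
        obtain ⟨j, rfl⟩ : ∃ j', j = j' + 1 := ⟨j - 1, by omega⟩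
        have h1 := S.nb_down (by simp) (hs i (by omega))
        have h2 := S.nb_down (by simp) (hs j (by omega))
        rw [h, h2] at h1
        exact ih j (by omega) (by omega) (Option.some_injective _ h1).symm
    have := Finset.card_le_card_of_injOn (s := Finset.range (S.m + 1)) (t := Finset.range S.m) p
      (fun i hi => by
        have := Finset.mem_range.1 (Finset.mem_coe.1 hi)
        exact Finset.mem_coe.2 (Finset.mem_range.2 (hlt i (by omega))))
      (fun i hi j hj h => by
        have hi' := Finset.mem_range.1 (Finset.mem_coe.1 hi)
        have hj' := Finset.mem_range.1 (Finset.mem_coe.1 hj)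
        by_contra hij
        rcases lt_or_gt_of_ne hij with h' | h'
        · exact hinj i j h' (by omega) h
        · exact hinj j i h' (by omega) h.symm)
    simp at this
  have hex' : ∃ i, S.nb (p i) 1 = none := hex.imp fun i hi => hi.2
  refine ⟨Nat.find hex', p, ?_, rfl, fun i hi => hstep i (Nat.find_min hex' hi),
    Nat.find_spec hex'⟩
  obtain ⟨i, hi, hi'⟩ := hex
  exact (Nat.find_min' hex' hi').trans_lt hi

/-- Extend the backbone below `w` by two nodes of the color `c`, the second of which is a leaf. -/
theorem exists_closedPath (S : GFrame hΔ) {w l : ℕ} (hw : w < S.m)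
    (hroot : ∀ u, S.nb u 1 ≠ some w) (hlev : S.lev w = l) (hl : S.LeafAbove l) (hl0 : 1 ≤ l)
    (c : Color) :
    ∃ (S' : GFrame hΔ) (N : ℕ) (p : ℕ → ℕ), S.Ext S' ∧ S'.m = S.m + 2 ∧ N + 2 ≤ S'.m ∧ p 0 = w ∧
      (∀ i ≤ N, S'.nb (p i) 1 = some (p (i + 1))) ∧ (∀ i ≤ N + 1, p i < S'.m) ∧
      (∀ i ≤ N + 1, S'.lev (p i) = l) ∧ (∀ i ≤ N, S'.leaf (p i) = false) ∧
      S'.leaf (p (N + 1)) = true ∧ S'.col (p N) = c ∧ S'.col (p (N + 1)) = c ∧ 1 ≤ N ∧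
      S'.LeafAbove (l - 1) := by
  obtain ⟨N, p, hN, hp0, hp, hpN⟩ := S.exists_leftPath hw hroot
  have hlt : ∀ i ≤ N, p i < S.m := by
    intro i hi
    rcases i with _ | i
    · rw [hp0]; exact hw
    · exact (S.nb_lt (hp i (by omega))).2
  have hlev' : ∀ i ≤ N, S.lev (p i) = l := by
    intro i
    induction i with
    | zero => intro _; rw [hp0]; exact hlev
    | succ i ih => intro hi; rw [S.lev_left (hp i (by omega))]; exact ih (by omega)
  have hleaf : ∀ i ≤ N, S.leaf (p i) = false := by
    intro i hi
    by_contra h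
    have := hl _ (hlt i hi) (by simpa using h)
    rw [hlev' i hi] at this
    exact lt_irrefl _ this
  set S1 := S.grow (p N) 1 (hlt N le_rfl) hpN false c with hS1
  have hnone : S1.nb S.m 1 = none := by
    change (if S.m = S.m then _ else _) = none
    simp
  have hy : S.m < S1.m := Nat.lt_succ_self _
  set S2 := S1.grow S.m 1 hy hnone true c with hS2
  have e1 : S.Ext S1 := S.ext_grow ..
  have e2 : S1.Ext S2 := S1.ext_grow ..
  have e := e1.trans e2
  have hm1 : S1.m = S.m + 1 := rfl
  have hm2 : S2.m = S.m + 2 := rfl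
  have h1 : S1.nb (p N) 1 = some S.m := S.grow_nb ..
  have h2 : S2.nb S.m 1 = some (S.m + 1) := S1.grow_nb ..
  have hlevy : S1.lev S.m = l := by rw [S1.lev_left h1, e1.lev (hlt N le_rfl), hlev' N le_rfl]
  have hlevz : S2.lev (S.m + 1) = l := by rw [S2.lev_left h2, e2.lev hy, hlevy]
  have hleafy : S1.leaf S.m = false := by change (if S.m = S.m then _ else _) = _; simp
  have hcoly : S1.col S.m = c := by change (if S.m = S.m then _ else _) = _; simp
  have hleafz : S2.leaf (S.m + 1) = true := by
    change (if S.m + 1 = S.m + 1 then _ else _) = _; simp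
  have hcolz : S2.col (S.m + 1) = c := by
    change (if S.m + 1 = S.m + 1 then _ else _) = _; simp
  refine ⟨S2, N + 1, fun i => if i ≤ N then p i else S.m + (i - (N + 1)), e, hm2, by omega,
    by simpa using hp0, fun i hi => ?_, fun i hi => ?_, fun i hi => ?_, fun i hi => ?_, ?_, ?_, ?_,
    by omega, fun x hx hxl => ?_⟩
  · dsimp only
    rcases lt_trichotomy i N with h | h | h
    · rw [if_pos h.le, if_pos (by omega)]; exact e.nb (hp i h)
    · subst h; simpa using e2.nb h1
    · obtain rfl : i = N + 1 := by omega
      simpa using h2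
  · dsimp only
    split_ifs with h
    · have := hlt i h; omega
    · omega
  · dsimp only
    split_ifs with h
    · rw [e.lev (hlt i h), hlev' i h]
    · obtain rfl | rfl : i = N + 1 ∨ i = N + 2 := by omega
      · simpa using (e2.lev hy).trans hlevy
      · simpa using hlevz
  · dsimp only
    split_ifs with h
    · rw [e.leaf (hlt i h), hleaf i h]
    · obtain rfl : i = N + 1 := by omega
      simpa using (e2.leaf hy).trans hleafy
  · simpa using hleafz
  · simpa using (e2.col hy).trans hcoly
  · simpa using hcolz
  · rcases (by omega : x < S.m ∨ x = S.m ∨ x = S.m + 1) with h | rfl | rfl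
    · rw [e.leaf h] at hxl
      rw [e.lev h]
      have := hl x h hxl
      omega
    · rw [e2.leaf hy, hleafy] at hxl; simp at hxl
    · rw [hlevz]; omega

variable {α : ℝ} {n : ℕ} (hα : 1 ≤ α) (A : Algorithm (TreeLabel Δ) OutColor)
  (r : Fin n × ℕ → Bool)

/-- Validity, as the adversary uses it: the outputs that are fixed by a frame satisfy the
constraints of the problem. -/
theorem exists_valid {k : ℕ}
    (hA : ∀ G : LabeledGraph Δ α (TreeLabel Δ) n, Succeeds (hierarchicalTHC Δ α k) A G r)
    (S : GFrame hΔ) (hn : 4 * S.m ≤ n) :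
    ∃ out, ValidTHC k (S.graph (α := α) hα hn) out ∧
      ∀ (u : ℕ) (hu : u < n) (o : OutColor), FixedOutput hα A r S u o → out ⟨u, hu⟩ = o := by
  obtain ⟨out, hout, hv⟩ := hA (S.graph hα hn)
  exact ⟨out, hv, fun u hu o ho => (hout _).unique (ho S (Ext.refl S) hn hu)⟩

theorem leftChild_graph {S : GFrame hΔ} (hn : 4 * S.m ≤ n) {u v l : ℕ} (hu : u < n) (hv : v < n)
    (h : S.nb u 1 = some v) (hleaf : S.leaf u = false) (hul : FixedLevel α n hα S u l)
    (hvl : FixedLevel α n hα S v l) :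
    LeftChild (S.graph (α := α) hα hn) l ⟨u, hu⟩ ⟨v, hv⟩ :=
  ⟨(leftChild'_iff hα hn (S.nb_lt h).1 hleaf _).2 h, hul S (Ext.refl S) hn hu,
    hvl S (Ext.refl S) hn hv⟩

/-- The color at the end of the backbone that contradicts the output `o` of its first node. -/
def opposite : OutColor → Color
  | OutColor.R => Color.B
  | _ => Color.R

theorem toOut_opposite (o : OutColor) : (opposite o).toOut ≠ o := by
  cases o <;> simp [opposite, Color.toOut]

/-- If the node `w`, the top of a backbone, does not decline, then its backbone can be completed so
that some node with a left child on the backbone must be exempt. -/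
theorem exists_exempt {k M l e : ℕ}
    (hA : ∀ G : LabeledGraph Δ α (TreeLabel Δ) n, Succeeds (hierarchicalTHC Δ α k) A G r)
    (hM : ∀ (G : LabeledGraph Δ α (TreeLabel Δ) n) v, (visitedSet A G r v).encard ≤ M)
    (S : GFrame hΔ) {w : ℕ} (hw : w < S.m)
    (hroot : ∀ u, S.nb u 1 ≠ some w) (hlev : S.lev w = l) (hl : S.LeafAbove l) (hl0 : 1 ≤ l)
    (hlk : l ≤ k) {o : OutColor} (ho : FixedOutput hα A r S w o) (hoD : o ≠ OutColor.D)
    (hn : 4 * (S.m + 2 + (e + 1) * M + 4 * k) ≤ n) (he : n ≤ 2 ^ e) :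
    ∃ (S' : GFrame hΔ) (b b' : ℕ), S.Ext S' ∧ S'.m ≤ S.m + 2 + (e + 1) * M + 4 * k ∧
      S'.LeafAbove (l - 1) ∧ S'.nb b 1 = some b' ∧ S'.leaf b = false ∧ S'.lev b = l ∧
      FixedLevel α n hα S' b l ∧ FixedLevel α n hα S' b' l ∧
      ∀ (S'' : GFrame hΔ), S'.Ext S'' → ∀ (hn : 4 * S''.m ≤ n) (hb : b < n)
        (out : Fin n → OutColor),
        (∀ v, Outputs A (S''.graph (α := α) hα hn) r v (out v)) →
        ValidTHC k (S''.graph (α := α) hα hn) out → out ⟨b, hb⟩ = OutColor.X := by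
  obtain ⟨S1, N, p, e1, hm1, hN, hp0, hp, hplt, hplev, hpleaf, hpleaf', hc1, hc2, hN1, hl1⟩ :=
    S.exists_closedPath hw hroot hlev hl hl0 (opposite o)
  obtain ⟨l', rfl⟩ : ∃ l', l = l' + 1 := ⟨l - 1, by omega⟩
  have heM : (e + 1) * M = M + e * M := by ring
  rw [heM] at hn ⊢
  by_cases hX : o = OutColor.X
  · -- the top node itself is exempt
    subst hX
    obtain ⟨S2, e2, h2m, h2l, hf2⟩ := exists_fixedLevel (α := α) (n := n) hα _ S1 hl1
      (hplt 0 (by omega)) (hplev 0 (by omega))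
    obtain ⟨S3, e3, h3m, h3l, hf3⟩ := exists_fixedLevel (α := α) (n := n) hα _ S2 h2l
      ((hplt 1 (by omega)).trans_le e2.m_le)
      ((e2.lev (hplt 1 (by omega))).trans (hplev 1 (by omega)))
    have e13 := e2.trans e3
    refine ⟨S3, p 0, p 1, e1.trans e13, by omega, h3l, e13.nb (hp 0 (by omega)), ?_, ?_,
      hf2.mono hα e3, hf3, fun S'' e'' hn'' hb out hout _ => ?_⟩
    · rw [e13.leaf (hplt 0 (by omega)), hpleaf 0 (by omega)]
    · rw [e13.lev (hplt 0 (by omega)), hplev 0 (by omega)]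
    · refine (hout _).unique ?_
      simp only [hp0]
      exact ho S'' (e1.trans (e13.trans e'')) hn'' _
  · -- the output changes somewhere between the top node and the leaf
    obtain ⟨S2, e2, h2m, h2l, hf2⟩ := exists_fixedLevel (α := α) (n := n) hα _ S1 hl1
      (hplt (N + 1) le_rfl) (hplev (N + 1) le_rfl)
    obtain ⟨S3, e3, h3m, h3l, oz, hoz⟩ := exists_fixedOutput hα A r hA hM S2 h2l (by omega)
      ((hplt (N + 1) le_rfl).trans_le e2.m_le)
    have e13 := e2.trans e3
    have hozne : oz ≠ o := by
      rintro rfl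
      have hn3 : 4 * S3.m ≤ n := by omega
      have hzn : p (N + 1) < n := by
        have := hplt (N + 1) le_rfl; have := e13.m_le; omega
      obtain ⟨out, hv, hout⟩ := exists_valid hα A r hA S3 hn3
      have hz3 := (hplt (N + 1) le_rfl).trans_le e13.m_le
      have := hv.cond2 ⟨p (N + 1), hzn⟩ (l' + 1) hlk
        ⟨hf2 S3 e3 hn3 hzn, fun u hu => not_leftChild' hα hn3 hz3
          (by simp only; rw [e13.leaf (hplt _ le_rfl), hpleaf']) u hu.1⟩
      rw [hout _ hzn _ hoz, color_graph hα hn3 hz3, e13.col (hplt _ le_rfl), hc2] at this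
      rcases this with h | h | h
      · exact toOut_opposite _ h.symm
      · exact hoD h
      · exact hX h
    obtain ⟨S4, e4, h4m, h4l, i, hi, hoi, oi', hne, hoi'⟩ := exists_change hα A r hA hM p o e S3 h3l
      (by omega) (a := 0) (b := N + 1) (by omega) (by omega)
      (fun i hi => (hplt i hi).trans_le e13.m_le)
      (by rw [hp0]; exact ho.mono (e1.trans e13)) hoz hozne
    have e14 := e13.trans e4
    obtain ⟨S5, e5, h5m, h5l, hf5⟩ := exists_fixedLevel (α := α) (n := n) hα _ S4 h4l
      ((hplt i (by omega)).trans_le e14.m_le)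
      ((e14.lev (hplt i (by omega))).trans (hplev i (by omega)))
    have e15 := e14.trans e5
    obtain ⟨S6, e6, h6m, h6l, hf6⟩ := exists_fixedLevel (α := α) (n := n) hα _ S5 h5l
      ((hplt (i + 1) (by omega)).trans_le e15.m_le)
      ((e15.lev (hplt (i + 1) (by omega))).trans (hplev (i + 1) (by omega)))
    have e16 := e15.trans e6
    -- at the change, the lower node is exempt and the upper one has its own input color
    have hchange : ∀ (S'' : GFrame hΔ), S6.Ext S'' → ∀ (hn : 4 * S''.m ≤ n) (hb : p (i + 1) < n)
        (out : Fin n → OutColor), (∀ v, Outputs A (S''.graph (α := α) hα hn) r v (out v)) →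
        ValidTHC k (S''.graph (α := α) hα hn) out →
        out ⟨p (i + 1), hb⟩ = OutColor.X ∧ (S1.col (p i)).toOut = o := by
      intro S'' e'' hn'' hb out hout hv
      have e1'' := e16.trans e''
      have hpi : p i < S''.m := (hplt i (by omega)).trans_le e1''.m_le
      have hpin : p i < n := by omega
      have hL := leftChild_graph hα hn'' hpin hb (e1''.nb (hp i (by omega)))
        (by rw [e1''.leaf (hplt i (by omega)), hpleaf i (by omega)])
        (hf5.mono hα (e6.trans e'')) (hf6.mono hα e'')
      have ho1 : out ⟨p i, hpin⟩ = o :=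
        (hout _).unique (hoi S'' ((e5.trans e6).trans e'') hn'' hpin)
      have ho2 : out ⟨p (i + 1), hb⟩ = oi' :=
        (hout _).unique (hoi' S'' ((e5.trans e6).trans e'') hn'' hb)
      have hcol : ((S''.graph (α := α) hα hn'').label ⟨p i, hpin⟩).color = S1.col (p i) := by
        rw [color_graph hα hn'' hpi, e1''.col (hplt i (by omega))]
      rcases Nat.eq_zero_or_pos l' with rfl | hl'
      · have := hv.cond3b _ _ (by omega) hL
        rw [ho1, ho2] at this
        exact absurd this.symm hne
      · rcases hlk.eq_or_lt with h | h
        · rw [h] at hL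
          have := hv.cond5b _ _ hL (by rw [ho1]; exact hX)
          rw [ho1, ho2, hcol] at this
          rcases this with h | h
          · exact absurd h.2.symm hne
          · exact ⟨ho2.trans h.1, h.2.symm⟩
        · have := hv.cond4 _ (by omega) h _ _ hL
          rw [ho1, ho2, hcol] at this
          rcases this with h | h | h
          · exact absurd h.1.symm hne
          · exact absurd h.1 hX
          · exact ⟨ho2.trans h.2, h.1.resolve_right hoD |>.symm⟩
    have hiN : i + 1 ≤ N := by
      by_contra hiN
      obtain rfl : i = N := by omega
      have hn6 : 4 * S6.m ≤ n := by omega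
      have hzn : p (i + 1) < n := by
        have := hplt (i + 1) le_rfl; have := e16.m_le; omega
      obtain ⟨out, hout, hv⟩ := hA (S6.graph hα hn6)
      have := (hchange S6 (Ext.refl _) hn6 hzn out hout hv).2
      rw [hc1] at this
      exact toOut_opposite _ this
    obtain ⟨S7, e7, h7m, h7l, hf7⟩ := exists_fixedLevel (α := α) (n := n) hα _ S6 h6l
      ((hplt (i + 2) (by omega)).trans_le e16.m_le)
      ((e16.lev (hplt (i + 2) (by omega))).trans (hplev (i + 2) (by omega)))
    have e17 := e16.trans e7
    refine ⟨S7, p (i + 1), p (i + 2), e1.trans e17, by omega, h7l, e17.nb (hp _ hiN), ?_, ?_,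
      hf6.mono hα e7, hf7, fun S'' e'' hn'' hb out hout hv =>
        (hchange S'' (e7.trans e'') hn'' hb out hout hv).1⟩
    · rw [e17.leaf (hplt _ (by omega)), hpleaf _ hiN]
    · rw [e17.lev (hplt _ (by omega)), hplev _ (by omega)]

/-- The induction over the levels: if the right child `w` of some node, at level `l`, does not
decline, then the frame can be extended by a node with the same properties at level `l - 1`. At
level `1` this is impossible. -/
theorem false_of_fixedOutput {k M l e : ℕ}
    (hA : ∀ G : LabeledGraph Δ α (TreeLabel Δ) n, Succeeds (hierarchicalTHC Δ α k) A G r)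
    (hM : ∀ (G : LabeledGraph Δ α (TreeLabel Δ) n) v, (visitedSet A G r v).encard ≤ M)
    (S : GFrame hΔ) {w₀ w : ℕ} (hw : S.nb w₀ 2 = some w)
    (hlev : S.lev w = l) (hl : S.LeafAbove l) (hl0 : 1 ≤ l)
    (hlk : l ≤ k) {o : OutColor} (ho : FixedOutput hα A r S w o) (hoD : o ≠ OutColor.D)
    (hn : 4 * (S.m + l * ((e + 2) * M + 4 * k + 3)) ≤ n) (he : n ≤ 2 ^ e) : False := by
  induction l generalizing S w₀ w o with
  | zero => omega
  | succ l ih =>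
    have hroot : ∀ u, S.nb u 1 ≠ some w := by
      intro u hu
      have h1 := S.nb_down (by simp) hu
      rw [S.nb_down (by simp) hw] at h1
      obtain rfl := Option.some_injective _ h1
      simpa using S.nb_inj hu hw
    have hexp : (l + 1) * ((e + 2) * M + 4 * k + 3) =
        l * ((e + 2) * M + 4 * k + 3) + ((e + 1) * M + M + 4 * k + 3) := by ring
    rw [hexp] at hn
    obtain ⟨S1, b, b', e1, h1m, h1l, hbb, hbleaf, hblev, hfb, hfb', hbX⟩ :=
      exists_exempt hα A r hA hM S (S.nb_lt hw).2 hroot hlev hl hl0 hlk ho hoD (e := e)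
        (by omega) he
    have hbm := (S1.nb_lt hbb).1
    have hbm' := (S1.nb_lt hbb).2
    -- a non-declining right child of an exempt node
    have hright : ∀ (S2 : GFrame hΔ) (_ : S1.Ext S2) (hn2 : 4 * S2.m ≤ n) (hb : b < n)
        (out : Fin n → OutColor), (∀ v, Outputs A (S2.graph (α := α) hα hn2) r v (out v)) →
        ValidTHC k (S2.graph (α := α) hα hn2) out → 1 ≤ l ∧
        ∃ u, RightChild (S2.graph (α := α) hα hn2) ⟨b, hb⟩ u ∧ out u ≠ OutColor.D := by
      intro S2 e2 hn2 hb out hout hv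
      have hX := hbX S2 e2 hn2 hb out hout hv
      have hb2 := hbm.trans_le e2.m_le
      have hlevb := hfb S2 e2 hn2 hb
      have hL := leftChild_graph (α := α) hα hn2 hb (by have := e2.m_le; omega) (e2.nb hbb)
        (by rw [e2.leaf hbm, hbleaf]) (hfb.mono hα e2) (hfb'.mono hα e2)
      rcases Nat.eq_zero_or_pos l with rfl | hl'
      · have := hv.cond3a _ (by omega) hlevb
        rw [hX] at this
        simp at this
      · refine ⟨hl', ?_⟩
        have : ∃ u, RightChild (S2.graph (α := α) hα hn2) ⟨b, hb⟩ u ∧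
            (out u = OutColor.R ∨ out u = OutColor.B ∨ out u = OutColor.X) := by
          rcases hlk.eq_or_lt with h | h
          · exact hv.cond5a _ (h ▸ hlevb) hX
          · rcases hv.cond4 _ (by omega) h _ _ hL with h | h | h
            · have := h.2; rw [hX] at this; simp at this
            · exact h.2
            · have := h.1
              rw [hX] at this
              rcases this with h | h
              · cases hc : ((S2.graph (α := α) hα hn2).label ⟨b, hb⟩).color <;>
                  rw [hc] at h <;> simp [Color.toOut] at h
              · simp at h
        obtain ⟨u, hu, h⟩ := this
        refine ⟨u, hu, fun hD => ?_⟩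
        rw [hD] at h
        simp at h
    have hl' : 1 ≤ l := by
      have hn1 : 4 * S1.m ≤ n := by omega
      obtain ⟨out, hout, hv⟩ := hA (S1.graph hα hn1)
      exact (hright S1 (Ext.refl _) hn1 (by omega) out hout hv).1
    obtain ⟨S2, w', e2, h2m, h2l, hw'⟩ : ∃ (S2 : GFrame hΔ) (w' : ℕ), S1.Ext S2 ∧
        S2.m ≤ S1.m + 1 ∧ S2.LeafAbove l ∧ S2.nb b 2 = some w' := by
      rcases h : S1.nb b 2 with _ | v
      · exact ⟨S1.grow b 2 hbm h false Color.R, S1.m, S1.ext_grow .., le_rfl,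
          LeafAbove.grow h1l hbm h _, S1.grow_nb ..⟩
      · exact ⟨S1, v, Ext.refl S1, by omega, h1l, h⟩
    obtain ⟨S3, e3, h3m, h3l, o', ho'⟩ := exists_fixedOutput hα A r hA hM S2 h2l (by omega)
      (S2.nb_lt hw').2
    have hlev' : S3.lev w' = l := by
      rw [e3.lev (S2.nb_lt hw').2, S2.lev_right hw', e2.lev hbm, hblev]; rfl
    refine ih S3 (e3.nb hw') hlev' h3l hl' (by omega) ho' ?_ (by omega)
    have hn3 : 4 * S3.m ≤ n := by omega
    obtain ⟨out, hout, hv⟩ := hA (S3.graph hα hn3)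
    have hb3 := hbm.trans_le (e2.trans e3).m_le
    obtain ⟨-, u, hu, huD⟩ := hright S3 (e2.trans e3) hn3 (by omega) out hout hv
    rw [rightChild_iff hα hn3 hb3 (by simp only; rw [(e2.trans e3).lev hbm, hblev]; omega),
      e3.nb hw'] at hu
    obtain rfl := Option.some_injective _ hu
    intro hD
    exact huD (by rw [← hD]; exact (hout _).unique (ho' S3 (Ext.refl _) hn3 _))

/-- A single node of level `l`. -/
def single (hΔ : 3 ≤ Δ) (l : ℕ) : GFrame hΔ where
  m := 1
  nb := fun _ _ => none
  lev := fun _ => l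
  leaf := fun _ => false
  col := fun _ => Color.R
  lab := fun _ => stdLabel hΔ (false = false) (2 ≤ l) Color.R
  lab_eq := fun _ => rfl
  nb_lt := by simp
  nb_ne := by simp
  nb_inj := by simp
  nb_down := by simp
  nb_up := by simp
  lev_left := by simp
  lev_right := by simp

/-- The adversary defeats every algorithm that visits at most `M` nodes. -/
theorem lt_of_succeeds {Δ : ℕ} (hΔ : 3 ≤ Δ) {α : ℝ} (hα : 1 ≤ α) {n : ℕ}
    (A : Algorithm (TreeLabel Δ) OutColor) (r : Fin n × ℕ → Bool) {k M e : ℕ} (hk : 1 ≤ k)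
    (hA : ∀ G : LabeledGraph Δ α (TreeLabel Δ) n, Succeeds (hierarchicalTHC Δ α k) A G r)
    (hM : ∀ (G : LabeledGraph Δ α (TreeLabel Δ) n) v, (visitedSet A G r v).encard ≤ M)
    (he : n ≤ 2 ^ e) : n < 4 * (2 + k + M + k * ((e + 2) * M + 4 * k + 3)) := by
  by_contra hn
  push Not at hn
  set S0 := single hΔ (k + 1) with hS0
  have hl0 : S0.LeafAbove k := fun u _ h => by simp [hS0, single] at h
  have hS0m : S0.m = 1 := rfl
  set S1 := S0.grow 0 2 (by simp [hS0, single]) rfl false Color.R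
  have hw : S1.nb 0 2 = some 1 := S0.grow_nb ..
  have hm1 : S1.m = 2 := rfl
  have hlev : S1.lev 1 = k := by rw [S1.lev_right hw]; rfl
  have hl1 : S1.LeafAbove k := LeafAbove.grow hl0 (by simp [hS0, single]) rfl _
  obtain ⟨k', rfl⟩ : ∃ k', k = k' + 1 := ⟨k - 1, by omega⟩
  obtain ⟨S2, e2, h2m, h2l, hf⟩ := exists_fixedLevel (α := α) (n := n) hα _ S1 hl1
    (S1.nb_lt hw).2 hlev
  obtain ⟨S3, e3, h3m, h3l, o, ho⟩ := exists_fixedOutput hα A r hA hM S2 h2l (by omega)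
    ((S1.nb_lt hw).2.trans_le e2.m_le)
  have e13 := e2.trans e3
  refine false_of_fixedOutput hα A r hA hM S3 (e13.nb hw)
    ((e13.lev (S1.nb_lt hw).2).trans hlev) h3l hk le_rfl ho ?_ (by omega) he
  have hn3 : 4 * S3.m ≤ n := by omega
  obtain ⟨out, hv, hout⟩ := exists_valid hα A r hA S3 hn3
  have hn1 : 1 < n := by omega
  have := hv.cond5 _ (hf S3 e3 hn3 hn1)
  rw [hout 1 hn1 o ho] at this
  rintro rfl
  simp at this

end GFrame

theorem le_dVol {Δ : ℕ} (hΔ : 3 ≤ Δ) {α : ℝ} (hα : 1 ≤ α) {k : ℕ} (hk : 1 ≤ k) :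
    ∀ᶠ n : ℕ in atTop, ENNReal.ofReal (1 / 100 * ((n : ℝ) / (k * Real.log n))) ≤
      (DVol (hierarchicalTHC Δ α k) n : ℝ≥0∞) := by
  have hlog : Tendsto (fun n : ℕ => Real.log n) atTop atTop :=
    Real.tendsto_log_atTop.comp tendsto_natCast_atTop_atTop
  filter_upwards [hlog.eventually_ge_atTop 4, eventually_ge_atTop (1000 * k ^ 2)] with n hn hnk
  by_contra hlt
  push Not at hlt
  set x : ℝ := 1 / 100 * ((n : ℝ) / (k * Real.log n)) with hx
  have hk0 : (0 : ℝ) < k := by exact_mod_cast hk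
  have hx0 : 0 ≤ x := by positivity
  -- an algorithm of volume cost at most `M`, where `M ≤ x`
  have h1 : ∃ A, SolvesDet (hierarchicalTHC Δ α k) A ∧
      (volCost Δ α A n : ℝ≥0∞) < ENNReal.ofReal x := by
    by_contra! hall
    refine absurd hlt (not_lt.2 ?_)
    have : ((⌈x⌉₊ : ℕ) : ℕ∞) ≤ DVol (hierarchicalTHC Δ α k) n := by
      refine le_iInf fun A => le_iInf fun hA => ?_
      have h := hall A hA
      induction hc : volCost Δ α A n with
      | top => simp
      | coe m =>
        rw [hc, ENat.toENNReal_coe, ← ENNReal.ofReal_natCast,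
          ENNReal.ofReal_le_ofReal_iff (by positivity)] at h
        exact_mod_cast Nat.ceil_le.2 h
    refine le_trans ?_ (ENat.toENNReal_le.2 this)
    rw [ENat.toENNReal_coe, ← ENNReal.ofReal_natCast]
    exact ENNReal.ofReal_le_ofReal (Nat.le_ceil x)
  obtain ⟨A, hA, hcost⟩ := h1
  obtain ⟨M, hM⟩ : ∃ M : ℕ, volCost Δ α A n = M := by
    refine ⟨(volCost Δ α A n).toNat, (ENat.natCast_toNat ?_).symm⟩
    intro h
    rw [h] at hcost
    simp at hcost
  have hMx : (M : ℝ) ≤ x := by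
    rw [hM, ENat.toENNReal_coe, ← ENNReal.ofReal_natCast] at hcost
    exact ((ENNReal.ofReal_lt_ofReal_iff_of_nonneg (by positivity)).1 hcost).le
  have key := GFrame.lt_of_succeeds hΔ hα A (fun _ : Fin n × ℕ => false) hk
    (fun G => hA.2 n G _) (M := M) (e := Nat.clog 2 n)
    (fun G v => by
      rw [← hM]
      exact le_iSup_of_le n <| le_iSup_of_le le_rfl <| le_iSup_of_le G <| le_iSup_of_le _ <|
        le_iSup_of_le v le_rfl) (Nat.le_pow_clog (by norm_num) n)
  have hk1 : (1 : ℝ) ≤ k := by exact_mod_cast hk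
  have hn0 : 0 < n := lt_of_lt_of_le (by positivity) hnk
  have he : (Nat.clog 2 n : ℝ) ≤ 2 * Real.log n + 1 := by
    have h2 : Nat.clog 2 n ≤ Nat.log 2 n + 1 := by
      rw [Nat.clog_le_iff_le_pow (by norm_num)]
      exact (Nat.lt_pow_succ_log_self (by norm_num) n).le
    have h3 : (Nat.log 2 n : ℝ) ≤ 2 * Real.log n := by
      have h4 : (2 : ℝ) ^ Nat.log 2 n ≤ n := by exact_mod_cast Nat.pow_log_le_self 2 hn0.ne'
      have h5 := Real.log_le_log (by positivity) h4
      rw [Real.log_pow] at h5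
      have h6 : (1 / 2 : ℝ) ≤ Real.log 2 := by have := Real.log_two_gt_d9; linarith
      have h7 : (0 : ℝ) ≤ Nat.log 2 n := by positivity
      nlinarith
    have : (Nat.clog 2 n : ℝ) ≤ Nat.log 2 n + 1 := by exact_mod_cast h2
    linarith
  have key' : (n : ℝ) < 4 * (2 + k + M + k * ((Nat.clog 2 n + 2) * M + 4 * k + 3)) := by
    exact_mod_cast key
  have hL : (0 : ℝ) < Real.log n := by linarith
  have hxkl : k * Real.log n * x = n / 100 := by rw [hx]; field_simp
  have hkl : k * Real.log n * M ≤ n / 100 := by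
    rw [← hxkl]; exact mul_le_mul_of_nonneg_left hMx (by positivity)
  have hM0 : (0 : ℝ) ≤ M := by positivity
  have b1 : (M : ℝ) ≤ k * Real.log n * M := by
    have : 1 ≤ k * Real.log n := by nlinarith
    nlinarith
  have b2 : k * ((Nat.clog 2 n + 2) * M) ≤ 3 * (k * Real.log n * M) := by
    have : (Nat.clog 2 n : ℝ) + 2 ≤ 3 * Real.log n := by linarith
    have := mul_le_mul_of_nonneg_right this (by positivity : 0 ≤ (k : ℝ) * M)
    nlinarith
  have hnk' : 1000 * (k : ℝ) ^ 2 ≤ n := by exact_mod_cast hnk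
  nlinarith

/-! ### Walks along partial injections -/

section Walk

variable {V : Type*}

/-- The point reached from `v` by `i` steps along the partial function `f`. -/
def walk (f : V → Option V) (i : ℕ) (v : V) : Option V := (fun x => x.bind f)^[i] (some v)

@[simp] theorem walk_zero (f : V → Option V) (v : V) : walk f 0 v = some v := rfl

theorem walk_succ (f : V → Option V) (i : ℕ) (v : V) : walk f (i + 1) v = (walk f i v).bind f :=
  Function.iterate_succ_apply' _ _ _

theorem walk_none (f : V → Option V) (i : ℕ) : (fun x => x.bind f)^[i] none = none := by
  induction i with
  | zero => rfl
  | succ i ih => rw [Function.iterate_succ_apply', ih]; rfl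

theorem walk_succ' (f : V → Option V) (i : ℕ) (v : V) :
    walk f (i + 1) v = (f v).bind (walk f i) := by
  unfold walk
  rw [Function.iterate_succ_apply]
  cases h : f v with
  | none => simp [h, walk_none]
  | some u => simp [h]

theorem walk_add (f : V → Option V) (i j : ℕ) (v : V) :
    walk f (i + j) v = (walk f i v).bind (walk f j) := by
  induction i generalizing v with
  | zero => simp
  | succ i ih =>
    rw [Nat.succ_add, walk_succ', walk_succ']
    cases f v with
    | none => rfl
    | some u => exact ih u

theorem walk_ne_none_of_le {f : V → Option V} {i j : ℕ} {v : V} (h : walk f j v ≠ none)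
    (hij : i ≤ j) : walk f i v ≠ none := by
  obtain ⟨d, rfl⟩ := Nat.exists_eq_add_of_le hij
  intro h0
  rw [walk_add, h0] at h
  exact h rfl

variable {f g : V → Option V}


theorem walk_inv (hfg : ∀ u v, f v = some u ↔ g u = some v) (i : ℕ) (u v : V) :
    walk f i v = some u ↔ walk g i u = some v := by
  induction i generalizing u v with
  | zero => simp [eq_comm]
  | succ i ih =>
    rw [walk_succ, walk_succ']
    simp only [Option.bind_eq_some_iff]
    exact exists_congr fun x => by rw [ih, hfg, and_comm]

/-- A walk against the direction of a walk that has come to its end cannot be periodic. -/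
theorem walk_ne_self_of_end {j : ℕ} {v t : V} (hj : walk g j v = some t) (ht : g t = none)
    {c : ℕ} (hc : 1 ≤ c) : walk g c v ≠ some v := by
  intro h
  have hper : ∀ i, walk g (i * c) v = some v := by
    intro i
    induction i with
    | zero => simp
    | succ i ih => rw [Nat.succ_mul, walk_add, ih]; exact h
  have h1 : walk g (j + 1) v = none := by rw [walk_succ, hj]; exact ht
  refine absurd h1 (walk_ne_none_of_le (j := (j + 1) * c) ?_ (Nat.le_mul_of_pos_right _ hc))
  rw [hper]; simp

/-- The points of an injective walk are distinct if it does not return to its origin. -/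
theorem walk_injOn (hfg : ∀ u v, f v = some u ↔ g u = some v) {s : ℕ} {v : V}
    (hret : ∀ i, 1 ≤ i → i < s → walk g i v ≠ some v) {i j : ℕ} (hj : j < s)
    (hij : i < j) {u : V} (hi : walk g i v = some u) : walk g j v ≠ some u := by
  intro h
  obtain ⟨d, rfl⟩ := Nat.exists_eq_add_of_le hij.le
  refine hret d (by omega) (by omega) ?_
  -- walk back `i` steps from `u`
  rw [add_comm, walk_add] at h
  obtain ⟨x, hx, hxu⟩ := Option.bind_eq_some_iff.1 h
  have h1 := (walk_inv hfg i v u).2 hi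
  have h2 := (walk_inv hfg i x u).2 hxu
  rw [h1] at h2
  rw [hx, ← h2]

theorem walk_end_unique {i j : ℕ} {v u w : V} (hi : walk f i v = some u) (hu : f u = none)
    (hj : walk f j v = some w) (hw : f w = none) : u = w := by
  wlog hij : i ≤ j generalizing i j u w
  · exact (this hj hw hi hu (by omega)).symm
  obtain ⟨d, rfl⟩ := Nat.exists_eq_add_of_le hij
  rw [walk_add, hi] at hj
  cases d with
  | zero => simpa using hj
  | succ d =>
    rw [Option.bind_some, walk_succ', hu] at hj
    simp at hj

theorem exists_end_or_periodic [Finite V] (hfg : ∀ u v, f v = some u ↔ g u = some v) (v : V) :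
    (∃ j t, walk g j v = some t ∧ g t = none) ∨ ∃ c, 1 ≤ c ∧ walk g c v = some v := by
  by_contra! h
  obtain ⟨h1, h2⟩ := h
  have hs : ∀ j, ∃ t, walk g j v = some t := by
    intro j
    induction j with
    | zero => exact ⟨v, rfl⟩
    | succ j ih =>
      obtain ⟨t, ht⟩ := ih
      obtain ⟨u, hu⟩ := Option.ne_none_iff_exists'.1 (h1 j t ht)
      exact ⟨u, by rw [walk_succ, ht]; exact hu⟩
  choose p hp using hs
  refine not_injective_infinite_finite p fun i j hij => ?_
  by_contra hne
  wlog hlt : i < j generalizing i j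
  · exact this j i hij.symm (Ne.symm hne) (by omega)
  refine walk_injOn hfg (s := j + 1) (fun i hi _ => h2 i hi) (Nat.lt_succ_self j) hlt (hp i) ?_
  rw [hp j, hij]

/-! ### The color of a run -/

/-- The result of the search for the first node of a run. -/
inductive TopResult (V : Type*) where
  | top (t : V)
  | cycle
  | long

/-- Walk from `v` along `f`, for less than `i` steps, until a point where `f` is not defined. -/
def findEnd (f : V → Option V) : ℕ → V → Option V
  | 0, _ => none
  | i + 1, v =>
    match f v with
    | none => some v
    | some u => findEnd f i u

theorem findEnd_eq_some {s : ℕ} {v w : V} (h : findEnd f s v = some w) :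
    ∃ i, i < s ∧ walk f i v = some w ∧ f w = none := by
  induction s generalizing v with
  | zero => simp [findEnd] at h
  | succ s ih =>
    unfold findEnd at h
    cases hv : f v with
    | none => simp only [hv] at h; cases h; exact ⟨0, by omega, rfl, hv⟩
    | some u =>
      simp only [hv] at h
      obtain ⟨i, hi, h1, h2⟩ := ih h
      exact ⟨i + 1, by omega, by rw [walk_succ', hv]; exact h1, h2⟩

theorem findEnd_eq_none_iff {s : ℕ} {v : V} : findEnd f s v = none ↔ walk f s v ≠ none := by
  induction s generalizing v with
  | zero => simp [findEnd]
  | succ s ih =>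
    unfold findEnd
    rw [walk_succ']
    cases f v with
    | none => simp
    | some u => exact ih

open scoped Classical in
/-- The set of the points that are reached from `v` by less than `s` steps along `f`. -/
noncomputable def window [Fintype V] (f : V → Option V) (s : ℕ) (v : V) : Finset V :=
  Finset.univ.filter fun u => ∃ i < s, walk f i v = some u

theorem mem_window [Fintype V] {s : ℕ} {u v : V} :
    u ∈ window f s v ↔ ∃ i < s, walk f i v = some u := by simp [window]

theorem card_window_le [Fintype V] (f : V → Option V) (s : ℕ) (v : V) :
    (window f s v).card ≤ s := by
  classical
  have h : window f s v ⊆ (Finset.range s).image fun i => (walk f i v).getD v := by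
    intro u hu
    obtain ⟨i, hi, h⟩ := mem_window.1 hu
    exact Finset.mem_image.2 ⟨i, Finset.mem_range.2 hi, by simp [h]⟩
  exact (Finset.card_le_card h).trans (Finset.card_image_le.trans (Finset.card_range s).le)

theorem card_window_of_walk [Fintype V] (hfg : ∀ u v, f v = some u ↔ g u = some v) {s : ℕ} {v : V}
    (hw : walk g (s - 1) v ≠ none) (hret : ∀ i, 1 ≤ i → i < s → walk g i v ≠ some v) :
    (window g s v).card = s := by
  refine le_antisymm (card_window_le g s v) ?_
  have hs : ∀ i < s, ∃ u, walk g i v = some u := fun i hi =>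
    Option.ne_none_iff_exists'.1 (walk_ne_none_of_le hw (by omega))
  have := Finset.card_le_card_of_injOn (s := Finset.range s) (t := window g s v)
    (fun i => (walk g i v).getD v)
    (fun i hi => by
      have hi' := Finset.mem_range.1 (Finset.mem_coe.1 hi)
      obtain ⟨u, hu⟩ := hs i hi'
      exact Finset.mem_coe.2 (mem_window.2 ⟨i, hi', by simp [hu]⟩))
    (fun i hi j hj h => by
      have hi' := Finset.mem_range.1 (Finset.mem_coe.1 hi)
      have hj' := Finset.mem_range.1 (Finset.mem_coe.1 hj)
      obtain ⟨u, hu⟩ := hs i hi'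
      obtain ⟨w, hw⟩ := hs j hj'
      simp only [hu, hw, Option.getD_some] at h
      subst h
      by_contra hne
      rcases lt_or_gt_of_ne hne with hlt | hlt
      · exact walk_injOn hfg hret hj' hlt hu hw
      · exact walk_injOn hfg hret hi' hlt hw hu)
  simpa using this

variable [DecidableEq V]

/-- Walk from `v` along `g`, for less than `i` steps, until a point where `g` is not defined. Stop
if the point `v₀` is met. -/
def findTop (g : V → Option V) (v₀ : V) : ℕ → V → TopResult V
  | 0, _ => .long
  | i + 1, v =>
    match g v with
    | none => .top v
    | some u => if u = v₀ then .cycle else findTop g v₀ i u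

/-- The common color of a run: the color of its last node if the run has a first node and at most
`s` nodes, red if the run is a cycle of length at most `s`, and `D` otherwise. -/
def runColor (f g : V → Option V) (χ : V → OutColor) (s : ℕ) (v : V) : OutColor :=
  match findTop g v s v with
  | .long => .D
  | .cycle => .R
  | .top t =>
    match findEnd f s t with
    | none => .D
    | some w => χ w

theorem findTop_of_end {v₀ : V} {j : ℕ} {v t : V} (hj : walk g j v = some t) (ht : g t = none)
    (h0 : ∀ i, 1 ≤ i → walk g i v ≠ some v₀) (s : ℕ) :
    findTop g v₀ s v = if j < s then .top t else .long := by
  induction s generalizing v j with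
  | zero => simp [findTop]
  | succ s ih =>
    unfold findTop
    cases hv : g v with
    | none =>
      cases j with
      | zero => simp at hj; simp [hj]
      | succ j => rw [walk_succ', hv] at hj; simp at hj
    | some u =>
      cases j with
      | zero => simp at hj; subst hj; rw [ht] at hv; simp at hv
      | succ j =>
        have hu : u ≠ v₀ := by
          rintro rfl; exact h0 1 le_rfl (by rw [walk_succ']; simp [hv])
        rw [walk_succ', hv] at hj
        simp only [if_neg hu]
        rw [ih hj fun i hi h => h0 (i + 1) (by omega) (by rw [walk_succ', hv]; exact h)]
        simp

theorem findTop_of_periodic {v₀ : V} {c : ℕ} {v : V} (hc : 1 ≤ c) (h : walk g c v = some v₀)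
    (hmin : ∀ i, 1 ≤ i → i < c → walk g i v ≠ some v₀) (s : ℕ) :
    findTop g v₀ s v = if c ≤ s then .cycle else .long := by
  induction s generalizing v c with
  | zero => simp [findTop]; omega
  | succ s ih =>
    obtain ⟨c, rfl⟩ : ∃ c', c = c' + 1 := ⟨c - 1, by omega⟩
    unfold findTop
    rw [walk_succ'] at h
    obtain ⟨u, hu, hcu⟩ := Option.bind_eq_some_iff.1 h
    simp only [hu]
    by_cases huv : u = v₀
    · have : c = 0 := by
        by_contra hc0
        exact hmin 1 le_rfl (by omega) (by rw [walk_succ']; simp [hu, huv])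
      subst this
      simp [huv]
    · rw [if_neg huv, ih (c := c) ?_ hcu ?_]
      · simp
      · by_contra hc0
        obtain rfl : c = 0 := by omega
        simp at hcu
        exact huv hcu
      · intro i hi hic h'
        exact hmin (i + 1) (by omega) (by omega) (by rw [walk_succ', hu]; exact h')

theorem runColor_congr [Finite V] (hfg : ∀ u v, f v = some u ↔ g u = some v) (χ : V → OutColor)
    (s : ℕ) {u v : V} (h : f v = some u) : runColor f g χ s v = runColor f g χ s u := by
  have hg := (hfg _ _).1 h
  have hgf : ∀ u v, g v = some u ↔ f u = some v := fun u v => (hfg v u).symm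
  rcases exists_end_or_periodic hfg v with ⟨j, t, hj, ht⟩ | hper
  · have hju : walk g (j + 1) u = some t := by rw [walk_succ', hg]; exact hj
    unfold runColor
    rw [findTop_of_end hj ht (fun i hi => walk_ne_self_of_end hj ht hi),
      findTop_of_end hju ht (fun i hi => walk_ne_self_of_end hju ht hi)]
    by_cases h1 : j + 1 < s
    · rw [if_pos h1, if_pos (by omega)]
    · rw [if_neg h1]
      split_ifs with h2
      · have : findEnd f s t = none := by
          rw [findEnd_eq_none_iff]
          obtain rfl : s = j + 1 := by omega
          rw [(walk_inv hfg _ _ _).2 hju]; simp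
        simp [this]
      · rfl
  · have hiff : ∀ c, walk g c v = some v ↔ walk g c u = some u := by
      intro c
      constructor
      · intro hc
        have : walk g (c + 1) u = some v := by rw [walk_succ', hg]; exact hc
        rw [walk_succ] at this
        obtain ⟨x, hx, hxv⟩ := Option.bind_eq_some_iff.1 this
        have := (hfg _ _).2 hxv
        rw [h] at this
        rw [hx, ← this]
      · intro hc
        have : walk g (c + 1) u = some v := by rw [walk_succ, hc]; exact hg
        rw [walk_succ', hg] at this
        exact this
    classical
    obtain ⟨h1, h2⟩ := Nat.find_spec hper
    have h3 : ∀ i, 1 ≤ i → i < Nat.find hper → walk g i v ≠ some v := fun i hi hlt h' =>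
      Nat.find_min hper hlt ⟨hi, h'⟩
    unfold runColor
    rw [findTop_of_periodic h1 h2 h3, findTop_of_periodic h1 ((hiff _).1 h2)
      (fun i hi hlt h' => h3 i hi hlt ((hiff _).2 h'))]

/-- At the end of a run, the color is the one of the node itself or `D`. -/
theorem runColor_of_end [Finite V] (hfg : ∀ u v, f v = some u ↔ g u = some v) (χ : V → OutColor)
    (s : ℕ) {v : V} (h : f v = none) :
    runColor f g χ s v = χ v ∨ runColor f g χ s v = .D := by
  rcases exists_end_or_periodic hfg v with ⟨j, t, hj, ht⟩ | ⟨c, hc, hcv⟩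
  · unfold runColor
    rw [findTop_of_end hj ht (fun i hi => walk_ne_self_of_end hj ht hi)]
    split_ifs
    · dsimp only
      cases he : findEnd f s t with
      | none => exact Or.inr rfl
      | some w =>
        obtain ⟨i, -, hi, hw⟩ := findEnd_eq_some he
        left
        rw [walk_end_unique hi hw ((walk_inv hfg _ _ _).2 hj) h]
    · exact Or.inr rfl
  · have := (walk_inv hfg _ _ _).2 hcv
    obtain ⟨c, rfl⟩ : ∃ c', c = c' + 1 := ⟨c - 1, by omega⟩
    rw [walk_succ', h] at this
    simp at this

theorem runColor_range (χ : V → OutColor) (hχ : ∀ v, χ v = .R ∨ χ v = .B) (s : ℕ) (v : V) :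
    runColor f g χ s v = .R ∨ runColor f g χ s v = .B ∨ runColor f g χ s v = .D := by
  unfold runColor
  cases findTop g v s v with
  | long => simp
  | cycle => simp
  | top t =>
    dsimp only
    cases findEnd f s t with
    | none => simp
    | some w => rcases hχ w with h | h <;> simp [h]

theorem findTop_eq_long {v₀ : V} {s : ℕ} {v : V} (h : findTop g v₀ s v = .long) :
    walk g s v ≠ none ∧ ∀ i, 1 ≤ i → i ≤ s → walk g i v ≠ some v₀ := by
  induction s generalizing v with
  | zero => exact ⟨by simp, fun i hi hi' => by omega⟩
  | succ s ih =>
    unfold findTop at h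
    cases hv : g v with
    | none => simp [hv] at h
    | some u =>
      simp only [hv] at h
      split_ifs at h with hu
      obtain ⟨h1, h2⟩ := ih h
      refine ⟨by rw [walk_succ', hv]; exact h1, fun i hi hi' => ?_⟩
      obtain ⟨i, rfl⟩ : ∃ i', i = i' + 1 := ⟨i - 1, by omega⟩
      rw [walk_succ', hv]
      rcases Nat.eq_zero_or_pos i with rfl | hi0
      · simpa using hu
      · exact h2 i hi0 (by omega)

theorem findTop_eq_top {v₀ : V} {s : ℕ} {v t : V} (h : findTop g v₀ s v = .top t) :
    ∃ i < s, walk g i v = some t ∧ g t = none := by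
  induction s generalizing v with
  | zero => simp [findTop] at h
  | succ s ih =>
    unfold findTop at h
    cases hv : g v with
    | none => simp only [hv] at h; cases h; exact ⟨0, by omega, rfl, hv⟩
    | some u =>
      simp only [hv] at h
      split_ifs at h with hu
      obtain ⟨i, hi, h1, h2⟩ := ih h
      exact ⟨i + 1, by omega, by rw [walk_succ', hv]; exact h1, h2⟩

/-- A run of the color `D` has at least `s` nodes: those above `v`, or those below its first
node. -/
theorem card_window_of_runColor_eq_D [Fintype V] (hfg : ∀ u v, f v = some u ↔ g u = some v)
    {χ : V → OutColor} (hχ : ∀ v, χ v ≠ .D) {s : ℕ} {v : V} (h : runColor f g χ s v = .D) :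
    (g v ≠ none ∧ walk g (s - 1) v ≠ none ∧ (window g s v).card = s) ∨
    ∃ t i, walk g i v = some t ∧ g t = none ∧ walk f (s - 1) t ≠ none ∧
      (window f s t).card = s := by
  have hgf : ∀ u v, g v = some u ↔ f u = some v := fun u v => (hfg v u).symm
  unfold runColor at h
  cases ht : findTop g v s v with
  | long =>
    obtain ⟨h1, h2⟩ := findTop_eq_long ht
    have h3 := walk_ne_none_of_le h1 (Nat.sub_le s 1)
    by_cases hv : g v = none
    · rcases s with _ | s
      · exact Or.inr ⟨v, 0, rfl, hv, by simp, by simp [window]⟩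
      · exact absurd (by rw [walk_succ', hv]; rfl) h1
    · exact Or.inl ⟨hv, h3, card_window_of_walk hfg h3 fun i hi hi' => h2 i hi hi'.le⟩
  | cycle => simp [ht] at h
  | top t =>
    simp only [ht] at h
    obtain ⟨i, -, hi, hgt⟩ := findTop_eq_top ht
    cases he : findEnd f s t with
    | none =>
      have h1 := walk_ne_none_of_le (findEnd_eq_none_iff.1 he) (Nat.sub_le s 1)
      refine Or.inr ⟨t, i, hi, hgt, h1, card_window_of_walk hgf h1 fun c hc _ hct => ?_⟩
      obtain ⟨c, rfl⟩ : ∃ c', c = c' + 1 := ⟨c - 1, by omega⟩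
      have := (walk_inv hfg _ _ _).1 hct
      rw [walk_succ', hgt] at this
      simp at this
    | some w => simp only [he] at h; exact absurd h (hχ w)

end Walk

/-! ### The hierarchical forest as a system of partial functions -/

section Forest

variable {Δ : ℕ} {α : ℝ} {n : ℕ} (G : LabeledGraph Δ α (TreeLabel Δ) n)

open scoped Classical in
/-- The neighbour of `v` at the port `p`, if `v` has a well-formed label and the port exists. -/
noncomputable def nbr (v : Fin n) (p : Option (Fin Δ)) : Option (Fin n) :=
  if (G.label v).WellFormed then
    p.bind fun j => if h : (j : ℕ) < G.deg v then some (G.port v ⟨j, h⟩ : Fin n) else none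
  else none

theorem nbr_eq_some_iff {v u : Fin n} {p : Option (Fin Δ)} :
    nbr G v p = some u ↔ PointsTo G v p u := by
  unfold nbr PointsTo
  by_cases hw : (G.label v).WellFormed
  · rw [if_pos hw]
    simp only [hw, true_and, Option.bind_eq_some_iff]
    refine exists_congr fun j => ?_
    by_cases h : (j : ℕ) < G.deg v <;> simp [h]
  · simp [hw]

/-- The node that the parent pointer of `v` leads to. -/
noncomputable def par (v : Fin n) : Option (Fin n) := nbr G v (G.label v).parent

/-- The right child of `v`. -/
noncomputable def rc (v : Fin n) : Option (Fin n) :=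
  (nbr G v (G.label v).right).bind fun u => if par G u = some v then some u else none

/-- The left child of `v`, regardless of its level. -/
noncomputable def lc (v : Fin n) : Option (Fin n) :=
  (nbr G v (G.label v).left).bind fun u => if par G u = some v then some u else none

theorem rc_eq_some_iff {v u : Fin n} : rc G v = some u ↔ RightChild G v u := by
  unfold rc RightChild
  rw [← nbr_eq_some_iff, ← nbr_eq_some_iff]
  simp only [Option.bind_eq_some_iff]
  constructor
  · rintro ⟨x, h1, h2⟩
    split_ifs at h2 with h3
    cases h2
    exact ⟨h1, h3⟩
  · rintro ⟨h1, h2⟩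
    exact ⟨u, h1, if_pos h2⟩

theorem lc_eq_some_iff {v u : Fin n} : lc G v = some u ↔ LeftChild' G v u := by
  unfold lc LeftChild'
  rw [← nbr_eq_some_iff, ← nbr_eq_some_iff]
  simp only [Option.bind_eq_some_iff]
  constructor
  · rintro ⟨x, h1, h2⟩
    split_ifs at h2 with h3
    cases h2
    exact ⟨h1, h3⟩
  · rintro ⟨h1, h2⟩
    exact ⟨u, h1, if_pos h2⟩

variable {G}

theorem par_of_rc {v u : Fin n} (h : rc G v = some u) : par G u = some v :=
  (nbr_eq_some_iff G).2 ((rc_eq_some_iff G).1 h).2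

theorem par_of_lc {v u : Fin n} (h : lc G v = some u) : par G u = some v :=
  (nbr_eq_some_iff G).2 ((lc_eq_some_iff G).1 h).2

theorem lc_ne_rc {v v' u : Fin n} (h : lc G v = some u) : rc G v' ≠ some u := by
  intro h'
  have h1 := par_of_lc h
  rw [par_of_rc h'] at h1
  obtain rfl := Option.some_injective _ h1
  obtain ⟨hw, j, hj, e, hp⟩ := ((lc_eq_some_iff G).1 h).1
  obtain ⟨-, j', hj', e', hp'⟩ := ((rc_eq_some_iff G).1 h').1
  have : (⟨j, hj⟩ : Fin (G.deg v')) = ⟨j', hj'⟩ :=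
    (G.port v').injective (Subtype.ext (hp.trans hp'.symm))
  have hjj : j = j' := Fin.ext (by simpa using this)
  subst hjj
  exact hw.2.2 j ⟨e, e'⟩

variable (G)

/-- The level of `v`, or `f + 1` if the level is larger than `f`. -/
noncomputable def capLevel : ℕ → Fin n → ℕ
  | 0, _ => 1
  | f + 1, v => match rc G v with
    | none => 1
    | some u => capLevel f u + 1

theorem one_le_capLevel (f : ℕ) (v : Fin n) : 1 ≤ capLevel G f v := by
  cases f with
  | zero => simp [capLevel]
  | succ f => unfold capLevel; split <;> simp

theorem capLevel_eq_iff {f l : ℕ} {v : Fin n} (hl : l ≤ f) :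
    capLevel G f v = l ↔ HasLevel G v l := by
  induction f generalizing v l with
  | zero =>
    obtain rfl : l = 0 := by omega
    simp only [capLevel, one_ne_zero, false_iff]
    intro h
    cases h
  | succ f ih =>
    unfold capLevel
    cases h : rc G v with
    | none =>
      have h' : ∀ u, ¬ RightChild G v u := fun u hu => by
        rw [← rc_eq_some_iff, h] at hu; simp at hu
      constructor
      · rintro rfl; exact .one v h'
      · intro hv
        cases hv with
        | one => rfl
        | succ _ u _ hu _ => exact absurd hu (h' u)
    | some u =>
      have hu := (rc_eq_some_iff G).1 h
      dsimp only
      constructor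
      · rintro rfl
        exact .succ v u _ hu ((ih (by omega)).1 rfl)
      · intro hv
        cases hv with
        | one _ h' => exact absurd hu (h' u)
        | succ _ u' l' hu' hl' =>
          obtain rfl := hu.unique hu'
          rw [(ih (by omega)).2 hl']

theorem capLevel_eq_min (f : ℕ) (v : Fin n) :
    capLevel G f v = min (capLevel G (f + 1) v) (f + 1) := by
  induction f generalizing v with
  | zero =>
    have := one_le_capLevel G 1 v
    simp only [capLevel] at this ⊢
    omega
  | succ f ih =>
    rw [capLevel, capLevel]
    cases h : rc G v with
    | none => simp
    | some u => simp only [ih u]; omega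

variable (k : ℕ)

/-- The left child of `v` in the hierarchical forest. -/
noncomputable def next (v : Fin n) : Option (Fin n) :=
  (lc G v).bind fun u => if capLevel G k u = capLevel G k v then some u else none

/-- The node of the same level whose left child is `v`. -/
noncomputable def prev (v : Fin n) : Option (Fin n) :=
  (par G v).bind fun u => if lc G u = some v ∧ capLevel G k u = capLevel G k v then some u else none

variable {G k}

theorem next_eq_some_iff {v u : Fin n} :
    next G k v = some u ↔ lc G v = some u ∧ capLevel G k u = capLevel G k v := by
  unfold next
  simp only [Option.bind_eq_some_iff]
  constructor
  · rintro ⟨x, h1, h2⟩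
    split_ifs at h2 with h3
    cases h2
    exact ⟨h1, h3⟩
  · rintro ⟨h1, h2⟩
    exact ⟨u, h1, if_pos h2⟩

theorem next_iff_prev (u v : Fin n) : next G k v = some u ↔ prev G k u = some v := by
  rw [next_eq_some_iff]
  unfold prev
  simp only [Option.bind_eq_some_iff]
  constructor
  · rintro ⟨h1, h2⟩
    exact ⟨v, par_of_lc h1, if_pos ⟨h1, h2.symm⟩⟩
  · rintro ⟨x, h1, h2⟩
    split_ifs at h2 with h3
    cases h2
    exact ⟨h3.1, h3.2.symm⟩

theorem prev_of_rc {v u : Fin n} (h : rc G v = some u) : prev G k u = none := by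
  by_contra hne
  obtain ⟨x, hx⟩ := Option.ne_none_iff_exists'.1 hne
  exact lc_ne_rc (next_eq_some_iff.1 ((next_iff_prev _ _).2 hx)).1 h

theorem capLevel_of_rc {v u : Fin n} (h : rc G v = some u) :
    capLevel G k v = min (capLevel G k u + 1) (k + 1) := by
  cases k with
  | zero => have := one_le_capLevel G 0 u; simp [capLevel]
  | succ k =>
    have e := capLevel_eq_min G k u
    rw [show capLevel G (k + 1) v = capLevel G k u + 1 by rw [capLevel, h]]
    omega

theorem exists_rc {v : Fin n} (h : 2 ≤ capLevel G k v) : ∃ u, rc G v = some u := by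
  cases hv : rc G v with
  | some u => exact ⟨u, rfl⟩
  | none =>
    cases k with
    | zero => simp [capLevel] at h
    | succ k => rw [capLevel, hv] at h; simp at h

theorem walk_next_level {i : ℕ} {u v : Fin n} (h : walk (next G k) i v = some u) :
    capLevel G k u = capLevel G k v := by
  induction i generalizing u with
  | zero => simp at h; rw [h]
  | succ i ih =>
    rw [walk_succ] at h
    obtain ⟨x, hx, hu⟩ := Option.bind_eq_some_iff.1 h
    rw [(next_eq_some_iff.1 hu).2, ih hx]

theorem walk_prev_level {i : ℕ} {u v : Fin n} (h : walk (prev G k) i v = some u) :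
    capLevel G k u = capLevel G k v :=
  (walk_next_level ((walk_inv next_iff_prev _ _ _).2 h)).symm

theorem leftChild_iff_next {l : ℕ} {v u : Fin n} (hl : l ≤ k) (hv : HasLevel G v l) :
    LeftChild G l v u ↔ next G k v = some u := by
  rw [next_eq_some_iff, lc_eq_some_iff, (capLevel_eq_iff G hl).2 hv, capLevel_eq_iff G hl]
  exact ⟨fun h => ⟨h.1, h.2.2⟩, fun h => ⟨h.1, hv, h.2⟩⟩

/-! ### Subtrees -/

variable (G k)

/-- The parent of `x` in the hierarchical forest. -/
noncomputable def treeParent (x : Fin n) : Option (Fin n) :=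
  (par G x).bind fun y => if rc G y = some x ∨ next G k y = some x then some y else none

open scoped Classical in
/-- The nodes of the subtree that consists of the backbone below `w` and everything hanging from
it. -/
noncomputable def desc (w : Fin n) : Finset (Fin n) :=
  Finset.univ.filter fun x => ∃ i, walk (treeParent G k) i x = some w

/-- The node `u` together with the subtree of its right child. -/
noncomputable def hang (u : Fin n) : Finset (Fin n) :=
  insert u ((rc G u).elim ∅ (desc G k))

variable {G k}

theorem mem_desc {x w : Fin n} : x ∈ desc G k w ↔ ∃ i, walk (treeParent G k) i x = some w := by
  simp [desc]

theorem mem_hang {x u : Fin n} :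
    x ∈ hang G k u ↔ x = u ∨ ∃ w, rc G u = some w ∧ x ∈ desc G k w := by
  unfold hang
  cases rc G u <;> simp

theorem treeParent_of_rc {x y : Fin n} (h : rc G y = some x) : treeParent G k x = some y := by
  simp [treeParent, par_of_rc h, h]

theorem treeParent_of_next {x y : Fin n} (h : next G k y = some x) :
    treeParent G k x = some y := by
  simp [treeParent, par_of_lc (next_eq_some_iff.1 h).1, h]

theorem capLevel_le_of_treeParent {x y : Fin n} (h : treeParent G k x = some y) :
    capLevel G k x ≤ capLevel G k y := by
  unfold treeParent at h
  obtain ⟨z, -, h2⟩ := Option.bind_eq_some_iff.1 h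
  split_ifs at h2 with h3
  cases h2
  rcases h3 with h3 | h3
  · have hk : capLevel G k x ≤ k + 1 := by
      have := capLevel_eq_min G k x; omega
    rw [capLevel_of_rc h3]; omega
  · exact (next_eq_some_iff.1 h3).2.le

theorem capLevel_le_of_walk {i : ℕ} {x y : Fin n} (h : walk (treeParent G k) i x = some y) :
    capLevel G k x ≤ capLevel G k y := by
  induction i generalizing y with
  | zero => simp at h; rw [h]
  | succ i ih =>
    rw [walk_succ] at h
    obtain ⟨z, hz, hy⟩ := Option.bind_eq_some_iff.1 h
    exact (ih hz).trans (capLevel_le_of_treeParent hy)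

theorem hang_disjoint {u u' : Fin n} (hne : u ≠ u') (hlev : capLevel G k u = capLevel G k u')
    (hk : capLevel G k u ≤ k) : Disjoint (hang G k u) (hang G k u') := by
  have hlow : ∀ {u w : Fin n}, capLevel G k u ≤ k → rc G u = some w →
      capLevel G k w < capLevel G k u := by
    intro u w hu hw
    have := capLevel_of_rc (k := k) hw
    omega
  have key : ∀ {u u' w w' : Fin n} {i j : ℕ} {x : Fin n}, u ≠ u' →
      capLevel G k u = capLevel G k u' → capLevel G k u ≤ k → rc G u = some w →
      rc G u' = some w' → walk (treeParent G k) i x = some w →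
      walk (treeParent G k) j x = some w' → i ≤ j → False := by
    intro u u' w w' i j x hne hlev hk hw hw' hi hj hij
    obtain ⟨d, rfl⟩ := Nat.exists_eq_add_of_le hij
    rw [walk_add, hi] at hj
    cases d with
    | zero =>
      obtain rfl : w = w' := by simpa using hj
      have h1 := par_of_rc hw
      rw [par_of_rc hw'] at h1
      exact hne (Option.some_injective _ h1).symm
    | succ d =>
      rw [Option.bind_some, walk_succ', treeParent_of_rc hw] at hj
      have h1 := capLevel_le_of_walk hj
      have h2 := hlow (hlev ▸ hk) hw'
      omega
  rw [Finset.disjoint_left]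
  intro x hx hx'
  rw [mem_hang] at hx hx'
  rcases hx with rfl | ⟨w, hw, hx⟩
  · rcases hx' with rfl | ⟨w', hw', hx'⟩
    · exact hne rfl
    · obtain ⟨i, hi⟩ := mem_desc.1 hx'
      have h1 := capLevel_le_of_walk hi
      have h2 := hlow (hlev ▸ hk) hw'
      omega
  · obtain ⟨i, hi⟩ := mem_desc.1 hx
    rcases hx' with rfl | ⟨w', hw', hx'⟩
    · have h1 := capLevel_le_of_walk hi
      have h2 := hlow hk hw
      omega
    · obtain ⟨j, hj⟩ := mem_desc.1 hx'
      rcases le_total i j with hij | hij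
      · exact key hne hlev hk hw hw' hi hj hij
      · exact key hne.symm hlev.symm (hlev ▸ hk) hw' hw hj hi hij

theorem hang_subset_desc {i : ℕ} {u w : Fin n} (h : walk (next G k) i w = some u) :
    hang G k u ⊆ desc G k w := by
  have hu : ∃ j, walk (treeParent G k) j u = some w := by
    induction i generalizing u with
    | zero => simp at h; exact ⟨0, by simp [h]⟩
    | succ i ih =>
      rw [walk_succ] at h
      obtain ⟨x, hx, hxu⟩ := Option.bind_eq_some_iff.1 h
      obtain ⟨j, hj⟩ := ih hx
      exact ⟨j + 1, by rw [walk_succ', treeParent_of_next hxu]; exact hj⟩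
  obtain ⟨j, hj⟩ := hu
  intro x hx
  rcases mem_hang.1 hx with rfl | ⟨y, hy, hx⟩
  · exact mem_desc.2 ⟨j, hj⟩
  · obtain ⟨i', hi'⟩ := mem_desc.1 hx
    refine mem_desc.2 ⟨i' + (j + 1), ?_⟩
    rw [walk_add, hi', Option.bind_some, walk_succ', treeParent_of_rc hy]
    exact hj

end Forest

/-! ### The rule for the output colors -/

/-- Does a node with the output `o` decline? -/
def OutColor.isD : OutColor → Bool
  | .D => true
  | _ => false

theorem OutColor.isD_eq_false_iff {o : OutColor} :
    o.isD = false ↔ o = .R ∨ o = .B ∨ o = .X := by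
  cases o <;> simp [isD]

theorem OutColor.isD_eq_true_iff {o : OutColor} : o.isD = true ↔ o = .D := by
  cases o <;> simp [isD]

section Rule

variable {Δ : ℕ} {α : ℝ} {n : ℕ} (G : LabeledGraph Δ α (TreeLabel Δ) n) (k : ℕ)
  (W : Fin n → Bool) (s : ℕ)

/-- A way-point `v` is exempt if its right child, with the outputs `o`, does not decline. -/
noncomputable def exempt (o : Fin n → OutColor) (v : Fin n) : Bool :=
  W v && (rc G v).elim false fun w => !(o w).isD

/-- The partial function `f` restricted to the points where `e` is false. -/
def restrict {V : Type*} (e : V → Bool) (f : V → Option V) (v : V) : Option V :=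
  if e v then none else (f v).bind fun u => if e u then none else some u

theorem restrict_eq_some_iff {V : Type*} {e : V → Bool} {f : V → Option V} {u v : V} :
    restrict e f v = some u ↔ f v = some u ∧ e v = false ∧ e u = false := by
  unfold restrict
  by_cases hv : e v = true
  · simp [hv]
  · rw [if_neg hv]
    simp only [Option.bind_eq_some_iff, Option.ite_none_left_eq_some, Option.some.injEq]
    constructor
    · rintro ⟨x, h1, h2, rfl⟩; exact ⟨h1, by simpa using hv, by simpa using h2⟩
    · rintro ⟨h1, -, h2⟩; exact ⟨u, h1, by simpa using h2, rfl⟩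

theorem walk_restrict {V : Type*} {e : V → Bool} {f : V → Option V} {i : ℕ} {u v : V}
    (h : walk (restrict e f) i v = some u) (hv : e v = false) :
    walk f i v = some u ∧ e u = false := by
  induction i generalizing u with
  | zero => simp at h; subst h; exact ⟨rfl, hv⟩
  | succ i ih =>
    rw [walk_succ] at h ⊢
    obtain ⟨x, hx, hu⟩ := Option.bind_eq_some_iff.1 h
    rw [restrict_eq_some_iff] at hu
    rw [(ih hx).1]
    exact ⟨hu.1, hu.2.2⟩

theorem window_restrict {V : Type*} [Fintype V] {e : V → Bool} {f : V → Option V} {s : ℕ} {v : V}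
    (h : walk (restrict e f) (s - 1) v ≠ none) (hv : e v = false) :
    window (restrict e f) s v = window f s v ∧ ∀ u ∈ window f s v, e u = false := by
  have key : ∀ i < s, ∃ u, walk (restrict e f) i v = some u ∧ walk f i v = some u ∧
      e u = false := fun i hi => by
    obtain ⟨u, hu⟩ := Option.ne_none_iff_exists'.1 (walk_ne_none_of_le h (by omega : i ≤ s - 1))
    exact ⟨u, hu, walk_restrict hu hv⟩
  constructor
  · ext u
    rw [mem_window, mem_window]
    refine exists_congr fun i => and_congr_right fun hi => ?_
    obtain ⟨x, h1, h2, -⟩ := key i hi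
    rw [h1, h2]
  · intro u hu
    obtain ⟨i, hi, hiu⟩ := mem_window.1 hu
    obtain ⟨x, h1, h2, h3⟩ := key i hi
    rw [h2] at hiu
    rwa [← Option.some_injective _ hiu]

/-- The input color of a node as an output color. -/
def inColor (v : Fin n) : OutColor := (G.label v).color.toOut

theorem inColor_eq (v : Fin n) : inColor G v = .R ∨ inColor G v = .B := by
  unfold inColor; cases (G.label v).color <;> simp [Color.toOut]

theorem inColor_ne (v : Fin n) : inColor G v ≠ .D := by
  rcases inColor_eq G v with h | h <;> simp [h]

/-- The outputs of the nodes of level `l`, computed from those of the nodes of level `l - 1`: exempt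
nodes get the color `X`, and each maximal run of nodes that are not exempt on a backbone has a
common color. -/
noncomputable def ruleColor : ℕ → Fin n → OutColor
  | 0, _ => .X
  | l + 1, v =>
    if exempt G W (ruleColor l) v then .X
    else runColor (restrict (exempt G W (ruleColor l)) (next G k))
      (restrict (exempt G W (ruleColor l)) (prev G k)) (inColor G) s v

/-- The output of the node `v`. -/
noncomputable def rule (v : Fin n) : OutColor :=
  if capLevel G k v ≤ k then ruleColor G k W s (capLevel G k v) v else .X

/-- The node `u` is light if, for its level, few nodes are hanging from it. -/
def IsLight (h : ℕ) (u : Fin n) : Prop := (hang G k u).card < h ^ (capLevel G k u - 1)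

open scoped Classical in
/-- In each window with at least `q` light nodes, one of them is a way-point. -/
def Hits (h q : ℕ) : Prop :=
  ∀ v, ∀ N ∈ ({window (next G k) s v, window (prev G k) s v} : Set (Finset (Fin n))),
    q ≤ (N.filter (IsLight G k h)).card → ∃ u ∈ N, IsLight G k h u ∧ W u = true

variable {G k W s}

theorem restrict_inv (e : Fin n → Bool) (u v : Fin n) :
    restrict e (next G k) v = some u ↔ restrict e (prev G k) u = some v := by
  rw [restrict_eq_some_iff, restrict_eq_some_iff, next_iff_prev]; tauto

theorem exempt_eq_true_iff {o : Fin n → OutColor} {v : Fin n} :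
    exempt G W o v = true ↔ W v = true ∧ ∃ w, rc G v = some w ∧ (o w).isD = false := by
  unfold exempt
  cases rc G v <;> simp

/-- If a node of level `l + 1` declines, then there are many nodes of its level from each of which
many nodes are hanging. -/
theorem exists_heavy_of_ruleColor_eq_D {h q : ℕ} (hs : h + q ≤ s + 1) (hits : Hits G k W s h q)
    {l : ℕ} (ih : ∀ w, capLevel G k w = l → prev G k w = none → 1 ≤ l →
      ruleColor G k W s l w = .D → h ^ l ≤ (desc G k w).card)
    {v : Fin n} (hv : capLevel G k v = l + 1) (hlk : l + 1 ≤ k)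
    (hD : ruleColor G k W s (l + 1) v = .D) :
    ∃ N : Finset (Fin n), h ≤ N.card ∧ (∀ u ∈ N, capLevel G k u = l + 1) ∧
      (∀ u ∈ N, h ^ l ≤ (hang G k u).card) ∧
      (prev G k v = none → ∀ u ∈ N, ∃ i, walk (next G k) i v = some u) := by
  classical
  unfold ruleColor at hD
  split_ifs at hD with he
  set e := exempt G W (ruleColor G k W s l) with hedef
  have hev : e v = false := by simpa using he
  -- a window of `s` nodes that are not exempt
  obtain ⟨v', N, hN, hcard, hNe, hlev, hroot⟩ : ∃ v', ∃ N ∈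
      ({window (next G k) s v', window (prev G k) s v'} : Set (Finset (Fin n))), N.card = s ∧
      (∀ u ∈ N, e u = false) ∧ (∀ u ∈ N, capLevel G k u = l + 1) ∧
      (prev G k v = none → ∀ u ∈ N, ∃ i, walk (next G k) i v = some u) := by
    rcases card_window_of_runColor_eq_D (restrict_inv e) (inColor_ne G) hD with
      ⟨h1, h2, h3⟩ | ⟨t, i, h1, h2, h3, h4⟩
    · obtain ⟨h5, h6⟩ := window_restrict h2 hev
      refine ⟨v, window (prev G k) s v, by simp, by rw [← h5, h3], h6, fun u hu => ?_, ?_⟩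
      · obtain ⟨i, -, hi⟩ := mem_window.1 hu
        rw [walk_prev_level hi, hv]
      · intro h0
        exact absurd (by simp [restrict, h0]) h1
    · obtain ⟨h5, h6⟩ := walk_restrict h1 hev
      obtain ⟨h7, h8⟩ := window_restrict h3 h6
      refine ⟨t, window (next G k) s t, by simp, by rw [← h7, h4], h8, fun u hu => ?_, ?_⟩
      · obtain ⟨i, -, hi⟩ := mem_window.1 hu
        rw [walk_next_level hi, walk_prev_level h5, hv]
      · intro h0 u hu
        obtain ⟨j, -, hj⟩ := mem_window.1 hu
        cases i with
        | zero => simp at h5; subst h5; exact ⟨j, hj⟩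
        | succ i => rw [walk_succ', h0] at h5; simp at h5
  -- no light way-point is in the window, as it would be exempt
  have hno : ¬ ∃ u ∈ N, IsLight G k h u ∧ W u = true := by
    rintro ⟨u, hu, hlight, hW⟩
    unfold IsLight at hlight
    rw [hlev u hu, Nat.add_sub_cancel] at hlight
    have hu0 : 0 < (hang G k u).card := Finset.card_pos.2 ⟨u, mem_hang.2 (Or.inl rfl)⟩
    have hl : 1 ≤ l := by
      by_contra hl
      obtain rfl : l = 0 := by omega
      rw [pow_zero] at hlight
      omega
    obtain ⟨w, hw⟩ := exists_rc (G := G) (k := k) (v := u) (by rw [hlev u hu]; omega)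
    have hwl : capLevel G k w = l := by
      have h1 := capLevel_of_rc (k := k) hw
      rw [hlev u hu] at h1
      omega
    have hnD : ruleColor G k W s l w ≠ .D := fun hD' => by
      have h1 := ih w hwl (prev_of_rc hw) hl hD'
      have h2 : desc G k w ⊆ hang G k u := fun x hx => mem_hang.2 (Or.inr ⟨w, hw, hx⟩)
      have := Finset.card_le_card h2
      omega
    have : e u = true := exempt_eq_true_iff.2 ⟨hW, w, hw, by
      by_contra hD'
      exact hnD (OutColor.isD_eq_true_iff.1 (by simpa using hD'))⟩
    rw [hNe u hu] at this
    simp at this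
  have hq : (N.filter (IsLight G k h)).card < q := by
    by_contra hq
    exact hno (hits v' N hN (not_lt.1 hq))
  refine ⟨N.filter fun u => ¬ IsLight G k h u, ?_, fun u hu => hlev u (Finset.mem_filter.1 hu).1,
    fun u hu => ?_, fun h0 u hu => hroot h0 u (Finset.mem_filter.1 hu).1⟩
  · have := Finset.card_filter_add_card_filter_not (s := N) (IsLight G k h)
    omega
  · have h1 := (Finset.mem_filter.1 hu).2
    unfold IsLight at h1
    rw [hlev u (Finset.mem_filter.1 hu).1, Nat.add_sub_cancel] at h1
    exact not_lt.1 h1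

theorem mul_pow_le_card {h l : ℕ} {N X : Finset (Fin n)} (hN : h ≤ N.card)
    (hlev : ∀ u ∈ N, capLevel G k u = l + 1) (hlk : l + 1 ≤ k)
    (hh : ∀ u ∈ N, h ^ l ≤ (hang G k u).card) (hX : ∀ u ∈ N, hang G k u ⊆ X) :
    h ^ (l + 1) ≤ X.card := by
  classical
  calc h ^ (l + 1) = h * h ^ l := by ring
    _ ≤ N.card * h ^ l := Nat.mul_le_mul_right _ hN
    _ = ∑ _u ∈ N, h ^ l := by simp
    _ ≤ ∑ u ∈ N, (hang G k u).card := Finset.sum_le_sum hh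
    _ = (N.biUnion (hang G k)).card := by
      refine (Finset.card_biUnion fun u hu u' hu' hne => ?_).symm
      exact hang_disjoint hne ((hlev u hu).trans (hlev u' hu').symm) (by rw [hlev u hu]; exact hlk)
    _ ≤ X.card := Finset.card_le_card (Finset.biUnion_subset.2 hX)

theorem pow_le_card_desc {h q : ℕ} (hs : h + q ≤ s + 1) (hits : Hits G k W s h q) (l : ℕ)
    (hlk : l ≤ k) (w : Fin n) (hw : capLevel G k w = l) (hroot : prev G k w = none) (hl : 1 ≤ l)
    (hD : ruleColor G k W s l w = .D) : h ^ l ≤ (desc G k w).card := by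
  induction l generalizing w with
  | zero => omega
  | succ l ih =>
    obtain ⟨N, h1, h2, h3, h4⟩ :=
      exists_heavy_of_ruleColor_eq_D hs hits (ih (by omega)) hw hlk hD
    refine mul_pow_le_card h1 h2 hlk h3 fun u hu => ?_
    obtain ⟨i, hi⟩ := h4 hroot u hu
    exact hang_subset_desc hi

/-- A node of level `k` that declines would force the graph to have at least `h ^ k` nodes. -/
theorem ruleColor_ne_D {h q : ℕ} (hs : h + q ≤ s + 1) (hits : Hits G k W s h q) (hk : 1 ≤ k)
    (hn : n < h ^ k) {v : Fin n} (hv : capLevel G k v = k) : ruleColor G k W s k v ≠ .D := by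
  intro hD
  obtain ⟨l, rfl⟩ : ∃ l, k = l + 1 := ⟨k - 1, by omega⟩
  obtain ⟨N, h1, h2, h3, -⟩ := exists_heavy_of_ruleColor_eq_D hs hits
    (pow_le_card_desc hs hits l (by omega)) hv le_rfl hD
  have := mul_pow_le_card (X := Finset.univ) h1 h2 le_rfl h3 fun u _ => Finset.subset_univ _
  rw [Finset.card_univ, Fintype.card_fin] at this
  omega

theorem rule_eq {v : Fin n} {l : ℕ} (hl : l + 1 ≤ k) (hv : HasLevel G v (l + 1)) :
    rule G k W s v = if exempt G W (ruleColor G k W s l) v then .X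
      else runColor (restrict (exempt G W (ruleColor G k W s l)) (next G k))
        (restrict (exempt G W (ruleColor G k W s l)) (prev G k)) (inColor G) s v := by
  unfold rule
  rw [(capLevel_eq_iff G hl).2 hv, if_pos hl, ruleColor]

theorem exists_of_exempt {v : Fin n} {l : ℕ} (hl : l + 1 ≤ k) (hv : HasLevel G v (l + 1))
    (he : exempt G W (ruleColor G k W s l) v = true) :
    1 ≤ l ∧ ∃ w, RightChild G v w ∧
      (rule G k W s w = .R ∨ rule G k W s w = .B ∨ rule G k W s w = .X) := by
  obtain ⟨-, w, hw, hD⟩ := exempt_eq_true_iff.1 he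
  rw [rc_eq_some_iff] at hw
  cases hv with
  | one _ h => exact absurd hw (h w)
  | succ _ u _ hu hlu =>
    obtain rfl := hu.unique hw
    have h1 := (capLevel_eq_iff G (by omega : l ≤ k)).2 hlu
    have h2 := one_le_capLevel G k u
    refine ⟨by omega, u, hw, ?_⟩
    unfold rule
    rw [h1, if_pos (by omega)]
    exact OutColor.isD_eq_false_iff.1 hD

/-- The outputs are valid if the way-points hit all windows with many light nodes. -/
theorem validTHC_rule {h q : ℕ} (hs : h + q ≤ s + 1) (hits : Hits G k W s h q) (hk : 1 ≤ k)
    (hn : n < h ^ k) : ValidTHC k G (rule G k W s) := by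
  have hrange : ∀ (l : ℕ) (v : Fin n),
      let c := runColor (restrict (exempt G W (ruleColor G k W s l)) (next G k))
        (restrict (exempt G W (ruleColor G k W s l)) (prev G k)) (inColor G) s v
      c = .R ∨ c = .B ∨ c = .D := fun l v => runColor_range _ (inColor_eq G) s v
  have hpos : ∀ {l v}, HasLevel G v l → ∃ l', l = l' + 1 := by
    intro l v h; cases h <;> exact ⟨_, rfl⟩
  -- the outputs of a node and of its left child
  have hstep : ∀ l, l + 1 ≤ k → ∀ v u, LeftChild G (l + 1) v u →
      (exempt G W (ruleColor G k W s l) v = true ∧ rule G k W s v = .X) ∨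
      (exempt G W (ruleColor G k W s l) v = false ∧
        exempt G W (ruleColor G k W s l) u = true ∧ rule G k W s u = .X ∧
        (rule G k W s v = inColor G v ∨ rule G k W s v = .D)) ∨
      (exempt G W (ruleColor G k W s l) v = false ∧ rule G k W s v = rule G k W s u ∧
        (rule G k W s v = .R ∨ rule G k W s v = .B ∨ rule G k W s v = .D)) := by
    intro l hl v u huv
    have hnext := (leftChild_iff_next hl huv.2.1).1 huv
    rw [rule_eq hl huv.2.1, rule_eq hl huv.2.2]
    cases hv : exempt G W (ruleColor G k W s l) v with
    | true => simp
    | false =>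
      cases hu : exempt G W (ruleColor G k W s l) u with
      | true =>
        have hend : restrict (exempt G W (ruleColor G k W s l)) (next G k) v = none := by
          simp [restrict, hv, hnext, hu]
        have := runColor_of_end (restrict_inv _) (inColor G) s hend
        exact Or.inr (Or.inl (by simpa using this))
      | false =>
        have hne : restrict (exempt G W (ruleColor G k W s l)) (next G k) v = some u :=
          restrict_eq_some_iff.2 ⟨hnext, hv, hu⟩
        have h1 := runColor_congr (restrict_inv _) (inColor G) s hne
        have h2 := hrange l v
        right; right
        simp only [Bool.false_eq_true, if_false, true_and]
        exact ⟨h1, h2⟩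
  have hkD : ∀ v, HasLevel G v k → rule G k W s v ≠ .D := by
    intro v hv
    have hc := (capLevel_eq_iff G le_rfl).2 hv
    unfold rule
    rw [hc, if_pos le_rfl]
    exact ruleColor_ne_D hs hits hk hn hc
  constructor
  · intro v hv
    unfold rule
    rw [if_neg]
    intro hle
    exact hv _ hle ((capLevel_eq_iff G hle).1 rfl)
  · intro v l hl hleaf
    obtain ⟨l, rfl⟩ := hpos hleaf.1
    rw [rule_eq hl hleaf.1]
    split_ifs with he
    · exact Or.inr (Or.inr rfl)
    · have hend : restrict (exempt G W (ruleColor G k W s l)) (next G k) v = none := by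
        have : next G k v = none := by
          by_contra hne
          obtain ⟨u, hu⟩ := Option.ne_none_iff_exists'.1 hne
          exact hleaf.2 u ((leftChild_iff_next hl hleaf.1).2 hu)
        simp [restrict, this]
      rcases runColor_of_end (restrict_inv _) (inColor G) s hend with h | h
      · exact Or.inl h
      · exact Or.inr (Or.inl h)
  · intro v _ hv
    rw [rule_eq hk hv]
    split_ifs with he
    · have := (exists_of_exempt hk hv he).1; omega
    · exact hrange 0 v
  · intro v u _ huv
    rcases hstep 0 hk v u huv with h | h | h
    · have := (exists_of_exempt hk huv.2.1 h.1).1; omega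
    · have := (exists_of_exempt hk huv.2.2 h.2.1).1; omega
    · exact h.2.1
  · intro l hl hlk v u huv
    obtain ⟨l, rfl⟩ : ∃ l', l = l' + 1 := ⟨l - 1, by omega⟩
    rcases hstep l hlk.le v u huv with h | h | h
    · exact Or.inr (Or.inl ⟨h.2, (exists_of_exempt hlk.le huv.2.1 h.1).2⟩)
    · exact Or.inr (Or.inr ⟨h.2.2.2, h.2.2.1⟩)
    · exact Or.inl h.2
  · intro v hv
    have h1 := hkD v hv
    cases h2 : rule G k W s v <;> simp_all
  · intro v hv hX
    obtain ⟨l, rfl⟩ := hpos hv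
    refine (exists_of_exempt (W := W) (s := s) le_rfl hv ?_).2
    rw [rule_eq le_rfl hv] at hX
    by_contra he
    rw [if_neg he] at hX
    have := hrange l v
    simp only [hX] at this
    simp at this
  · intro v u huv hX
    obtain ⟨l, rfl⟩ := hpos huv.2.1
    rcases hstep l le_rfl v u huv with h | h | h
    · exact absurd h.2 hX
    · exact Or.inr ⟨h.2.2.1, h.2.2.2.resolve_right (hkD v huv.2.1)⟩
    · exact Or.inl ⟨by rw [← h.2.1]; exact hX, h.2.1⟩

end Rule

/-! ### Query programs -/

/-- Programs of an algorithm that reads its random bits one by one. -/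
inductive CoinProg (L β : Type) where
  | pure (b : β)
  | query (w j : ℕ) (f : NodeInfo L → CoinProg L β)
  | coin (w : ℕ) (f : Bool → CoinProg L β)

/-- Programs that, instead of reading random bits, ask whether a visited node is a way-point. -/
inductive Prog (L β : Type) where
  | pure (b : β)
  | query (w j : ℕ) (f : NodeInfo L → Prog L β)
  | way (w : ℕ) (f : Bool → Prog L β)

namespace CoinProg

variable {L β : Type}

/-- The program that is left after the given answers; `none` if they are of a wrong kind. -/
def rest : CoinProg L β → List (Answer L) → Option (CoinProg L β)
  | p, [] => some p
  | query _ _ f, Answer.node i :: h => rest (f i) h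
  | coin _ f, Answer.bit b :: h => rest (f b) h
  | _, _ :: _ => none

theorem rest_append {p p' : CoinProg L β} {h h' : List (Answer L)} (hp : p.rest h = some p') :
    p.rest (h ++ h') = p'.rest h' := by
  induction h generalizing p with
  | nil => simp only [rest, Option.some.injEq] at hp; subst hp; rfl
  | cons a h ih =>
    cases p with
    | pure b => simp [rest] at hp
    | query w j f => cases a <;> simp only [rest] at hp <;> first | exact ih hp | simp at hp
    | coin w f => cases a <;> simp only [rest] at hp <;> first | exact ih hp | simp at hp

/-- The next move of an algorithm that has to execute a program. -/
def move : CoinProg L β → Move β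
  | pure b => Move.output b
  | query w j _ => Move.query w j
  | coin w _ => Move.coin w

/-- The algorithm that executes the program `P n i` for a node with the information `i`. -/
def toAlgorithm [Inhabited β] (P : ℕ → NodeInfo L → CoinProg L β) : Algorithm L β := fun n h =>
  match h with
  | Answer.node i :: h' => ((rest (P n i) h').elim (Move.output default) move)
  | _ => Move.output default

variable {Δ : ℕ} {α : ℝ} {n : ℕ}

/-- The weakest precondition: when the program `p` is executed on the graph `G` with the random bits
`r`, after the nodes in the list `S` have been visited and `u x` bits of each node `x` have been
read, then all its moves are legal, and the result and the final list of visited nodes satisfy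
`Q`. -/
def wp (G : LabeledGraph Δ α L n) (r : Fin n × ℕ → Bool) (Q : β → List (Fin n) → Prop) :
    CoinProg L β → List (Fin n) → (Fin n → ℕ) → Prop
  | pure b, S, _ => Q b S
  | query w j f, S, u => ∃ x ∈ S, G.ident x = w ∧ ∃ h : j < G.deg x,
      wp G r Q (f (G.info (G.port x ⟨j, h⟩))) (S ++ [(G.port x ⟨j, h⟩ : Fin n)]) u
  | coin w f, S, u => ∃ x ∈ S, G.ident x = w ∧
      wp G r Q (f (r (x, u x))) S (Function.update u x (u x + 1))

theorem find?_eq (G : LabeledGraph Δ α L n) {S : List (Fin n)} {x : Fin n} (hx : x ∈ S) :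
    S.find? (fun y => decide (G.ident y = G.ident x)) = some x := by
  cases h : S.find? (fun y => decide (G.ident y = G.ident x)) with
  | none =>
    rw [List.find?_eq_none] at h
    exact absurd (by simp) (h x hx)
  | some y =>
    have : G.ident y = G.ident x := by simpa using List.find?_some h
    rw [G.ident_injective this]

theorem exists_output_aux [Inhabited β] {P : ℕ → NodeInfo L → CoinProg L β}
    {G : LabeledGraph Δ α L n} {r : Fin n × ℕ → Bool} {v : Fin n}
    {Q : β → List (Fin n) → Prop} (p : CoinProg L β) (t : ℕ) (h : List (Answer L))
    (hh : (exec (toAlgorithm P) G r v t).history = Answer.node (G.info v) :: h)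
    (hp : (P n (G.info v)).rest h = some p)
    (hwp : wp G r Q p (exec (toAlgorithm P) G r v t).visited (exec (toAlgorithm P) G r v t).used) :
    ∃ t' b, (toAlgorithm P) n (exec (toAlgorithm P) G r v t').history = Move.output b ∧
      Q b (exec (toAlgorithm P) G r v t').visited := by
  induction p generalizing t h with
  | pure b =>
    refine ⟨t, b, ?_, hwp⟩
    rw [hh]
    simp [toAlgorithm, hp, move]
  | query w j f ih =>
    obtain ⟨x, hx, rfl, hj, hwp⟩ := hwp
    have hmove : toAlgorithm P n (exec (toAlgorithm P) G r v t).history =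
        Move.query (G.ident x) j := by
      rw [hh]
      simp [toAlgorithm, hp, move]
    have hstep : exec (toAlgorithm P) G r v (t + 1) =
        { history := (exec (toAlgorithm P) G r v t).history ++
            [Answer.node (G.info (G.port x ⟨j, hj⟩))]
          visited := (exec (toAlgorithm P) G r v t).visited ++ [(G.port x ⟨j, hj⟩ : Fin n)]
          used := (exec (toAlgorithm P) G r v t).used } := by
      rw [exec_succ]
      conv_lhs => unfold step
      simp only [hmove, find?_eq G hx]
      rw [dif_pos hj]
    refine ih (G.info (G.port x ⟨j, hj⟩)) (t + 1)
      (h ++ [Answer.node (G.info (G.port x ⟨j, hj⟩))]) ?_ ?_ ?_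
    · rw [hstep, hh]; rfl
    · rw [rest_append hp]; simp [rest]
    · rw [hstep]; exact hwp
  | coin w f ih =>
    obtain ⟨x, hx, rfl, hwp⟩ := hwp
    have hmove : toAlgorithm P n (exec (toAlgorithm P) G r v t).history =
        Move.coin (G.ident x) := by
      rw [hh]
      simp [toAlgorithm, hp, move]
    have hstep : exec (toAlgorithm P) G r v (t + 1) =
        { history := (exec (toAlgorithm P) G r v t).history ++
            [Answer.bit (r (x, (exec (toAlgorithm P) G r v t).used x))]
          visited := (exec (toAlgorithm P) G r v t).visited
          used := Function.update (exec (toAlgorithm P) G r v t).used x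
            ((exec (toAlgorithm P) G r v t).used x + 1) } := by
      rw [exec_succ]
      conv_lhs => unfold step
      simp only [hmove, find?_eq G hx]
    refine ih (r (x, (exec (toAlgorithm P) G r v t).used x)) (t + 1)
      (h ++ [Answer.bit (r (x, (exec (toAlgorithm P) G r v t).used x))]) ?_ ?_ ?_
    · rw [hstep, hh]; rfl
    · rw [rest_append hp]; simp [rest]
    · rw [hstep]; exact hwp

/-- The weakest precondition describes the executions of the algorithm. -/
theorem exists_output [Inhabited β] {P : ℕ → NodeInfo L → CoinProg L β}
    {G : LabeledGraph Δ α L n} {r : Fin n × ℕ → Bool} {v : Fin n}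
    {Q : β → List (Fin n) → Prop} (hwp : wp G r Q (P n (G.info v)) [v] fun _ => 0) :
    ∃ b S, Outputs (toAlgorithm P) G r v b ∧ visitedSet (toAlgorithm P) G r v ⊆ {x | x ∈ S} ∧
      Q b S := by
  obtain ⟨t, b, h1, h2⟩ := exists_output_aux (P := P) (G := G) (r := r) (v := v)
    (P n (G.info v)) 0 [] (by simp [exec]) (by simp [rest]) (by simpa [exec] using hwp)
  refine ⟨b, _, ⟨t, h1⟩, ?_, h2⟩
  rintro x ⟨t', hx⟩
  rcases le_total t' t with hle | hle
  · exact (visited_prefix_exec _ _ _ _ hle).subset hx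
  · rwa [exec_eq_of_output hle h1] at hx

end CoinProg

namespace Prog

variable {L β γ : Type}

/-- Sequential composition. -/
def bind : Prog L β → (β → Prog L γ) → Prog L γ
  | pure b, g => g b
  | query w j f, g => query w j fun i => (f i).bind g
  | way w f, g => way w fun b => (f b).bind g

/-- Stop with the result `b₀` instead of making more than `M` queries. -/
def truncate (b₀ : β) : ℕ → Prog L β → Prog L β
  | _, pure b => pure b
  | 0, query _ _ _ => pure b₀
  | M + 1, query w j f => query w j fun i => truncate b₀ M (f i)
  | M, way w f => way w fun b => truncate b₀ M (f b)

/-- Read `b` random bits of the node `w` and continue with the answer to the question whether all of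
them are true. -/
def readBits (w : ℕ) : ℕ → (Bool → CoinProg L β) → CoinProg L β
  | 0, f => f true
  | b + 1, f => .coin w fun x => readBits w b fun y => f (x && y)

/-- Replace the questions for way-points, where a node is a way-point if its first `b` random bits
are true. The answers are kept in the table `tbl`, since a random bit can be read only once. -/
def toCoin (b : ℕ) : Prog L β → (ℕ → Option Bool) → CoinProg L β
  | pure c, _ => .pure c
  | query w j f, tbl => .query w j fun i => toCoin b (f i) tbl
  | way w f, tbl =>
    match tbl w with
    | some x => toCoin b (f x) tbl
    | none => readBits w b fun x => toCoin b (f x) (Function.update tbl w (some x))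

variable {Δ : ℕ} {α : ℝ} {n : ℕ}

/-- The weakest precondition of a program, where `W` is the set of the way-points. -/
def wp (G : LabeledGraph Δ α L n) (W : Fin n → Bool) :
    Prog L β → List (Fin n) → (β → List (Fin n) → Prop) → Prop
  | pure b, S, Q => Q b S
  | query w j f, S, Q => ∃ x ∈ S, G.ident x = w ∧ ∃ h : j < G.deg x,
      wp G W (f (G.info (G.port x ⟨j, h⟩))) (S ++ [(G.port x ⟨j, h⟩ : Fin n)]) Q
  | way w f, S, Q => ∃ x ∈ S, G.ident x = w ∧ wp G W (f (W x)) S Q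

variable {G : LabeledGraph Δ α L n} {W : Fin n → Bool}

theorem wp_mono {p : Prog L β} {S : List (Fin n)} {Q Q' : β → List (Fin n) → Prop}
    (h : wp G W p S Q) (hQ : ∀ b S, Q b S → Q' b S) : wp G W p S Q' := by
  induction p generalizing S with
  | pure b => exact hQ _ _ h
  | query w j f ih =>
    obtain ⟨x, hx, hw, hj, h⟩ := h
    exact ⟨x, hx, hw, hj, ih _ h⟩
  | way w f ih =>
    obtain ⟨x, hx, hw, h⟩ := h
    exact ⟨x, hx, hw, ih _ h⟩

theorem wp_bind {p : Prog L β} {g : β → Prog L γ} {S : List (Fin n)}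
    {Q : γ → List (Fin n) → Prop} (h : wp G W p S fun b S' => wp G W (g b) S' Q) :
    wp G W (p.bind g) S Q := by
  induction p generalizing S with
  | pure b => exact h
  | query w j f ih =>
    obtain ⟨x, hx, hw, hj, h⟩ := h
    exact ⟨x, hx, hw, hj, ih _ h⟩
  | way w f ih =>
    obtain ⟨x, hx, hw, h⟩ := h
    exact ⟨x, hx, hw, ih _ h⟩

theorem wp_truncate (b₀ : β) {p : Prog L β} {M : ℕ} {S : List (Fin n)}
    {Q : β → List (Fin n) → Prop} (h : wp G W p S Q) :
    wp G W (p.truncate b₀ M) S fun b S' =>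
      S'.length ≤ S.length + M ∧ (Q b S' ∨ ¬ wp G W p S fun _ S' => S'.length ≤ S.length + M) := by
  induction p generalizing S M with
  | pure b => cases M <;> exact ⟨by omega, Or.inl h⟩
  | query w j f ih =>
    obtain ⟨x, hx, hw, hj, h⟩ := h
    have huniq : ∀ (K : ℕ), (wp G W (query w j f) S fun _ S' => S'.length ≤ K) →
        wp G W (f (G.info (G.port x ⟨j, hj⟩))) (S ++ [(G.port x ⟨j, hj⟩ : Fin n)])
          fun _ S' => S'.length ≤ K := by
      rintro K ⟨y, hy, hw', hj', h'⟩
      obtain rfl := G.ident_injective (hw'.trans hw.symm)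
      exact h'
    cases M with
    | zero =>
      refine ⟨by omega, Or.inr fun h' => ?_⟩
      have h1 := huniq _ h'
      -- the list of visited nodes only grows
      have hlen : ∀ (p : Prog L β) (S : List (Fin n)) (K : ℕ),
          (wp G W p S fun _ S' => S'.length ≤ K) → S.length ≤ K := by
        intro p
        induction p with
        | pure b => intro S K h; exact h
        | query w j f ih =>
          rintro S K ⟨x, -, -, hj, h⟩
          have := ih _ _ _ h
          rw [List.length_append] at this
          omega
        | way w f ih =>
          rintro S K ⟨x, -, -, h⟩
          exact ih _ _ _ h
      have := hlen _ _ _ h1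
      rw [List.length_append, List.length_singleton] at this
      omega
    | succ M =>
      refine ⟨x, hx, hw, hj, wp_mono (ih _ (M := M) h) fun b S' hS' => ?_⟩
      rw [List.length_append, List.length_singleton] at hS'
      have e : S.length + 1 + M = S.length + (M + 1) := by ring
      rw [e] at hS'
      exact ⟨hS'.1, hS'.2.imp_right fun h1 h2 => h1 (huniq _ h2)⟩
  | way w f ih =>
    obtain ⟨x, hx, hw, h⟩ := h
    have : truncate b₀ M (way w f) = way w fun b => truncate b₀ M (f b) := by cases M <;> rfl
    rw [this]
    refine ⟨x, hx, hw, wp_mono (ih _ (M := M) h) fun b S' hS' => ⟨hS'.1, hS'.2.imp_right ?_⟩⟩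
    rintro h1 ⟨y, hy, hw', h'⟩
    obtain rfl := G.ident_injective (hw'.trans hw.symm)
    exact h1 h'

/-- The way-points for the random bits `r`. -/
def wayPoint (b : ℕ) (r : Fin n × ℕ → Bool) (x : Fin n) : Bool :=
  decide (∀ i < b, r (x, i) = true)

theorem wp_readBits {r : Fin n × ℕ → Bool} {Q : β → List (Fin n) → Prop} {S : List (Fin n)}
    {x : Fin n} (hx : x ∈ S) (b c : ℕ) (f : Bool → CoinProg L β) (u : Fin n → ℕ) (hu : u x = c)
    (h : CoinProg.wp G r Q (f (decide (∀ i < b, r (x, c + i) = true))) S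
      (Function.update u x (c + b))) :
    CoinProg.wp G r Q (readBits (G.ident x) b f) S u := by
  induction b generalizing c f u with
  | zero =>
    subst hu
    simpa [readBits] using h
  | succ b ih =>
    refine ⟨x, hx, rfl, ?_⟩
    refine ih (c + 1) _ _ (by simp [hu]) ?_
    rw [Function.update_idem, show c + 1 + b = c + (b + 1) by ring]
    convert h using 2
    · rw [hu]
      cases hr : r (x, c) with
      | false =>
        simp only [Bool.false_and, Bool.false_eq, decide_eq_false_iff_not]
        intro hall
        have := hall 0 (by omega)
        rw [add_zero, hr] at this
        simp at this
      | true =>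
        simp only [Bool.true_and, decide_eq_decide]
        constructor
        · intro hall i hi
          cases i with
          | zero => simpa using hr
          | succ i => rw [← hall i (by omega)]; congr 2; ring
        · intro hall i hi
          rw [← hall (i + 1) (by omega)]; congr 2; ring

theorem wp_toCoin {b : ℕ} {r : Fin n × ℕ → Bool} {Q : β → List (Fin n) → Prop} (p : Prog L β)
    (tbl : ℕ → Option Bool) (S : List (Fin n)) (u : Fin n → ℕ)
    (htbl : ∀ x y, tbl (G.ident x) = some y → y = wayPoint b r x)
    (hu : ∀ x, tbl (G.ident x) = none → u x = 0)
    (h : wp G (wayPoint b r) p S Q) : CoinProg.wp G r Q (p.toCoin b tbl) S u := by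
  induction p generalizing tbl S u with
  | pure c => exact h
  | query w j f ih =>
    obtain ⟨x, hx, hw, hj, h⟩ := h
    exact ⟨x, hx, hw, hj, ih _ _ _ _ htbl hu h⟩
  | way w f ih =>
    obtain ⟨x, hx, rfl, h⟩ := h
    unfold toCoin
    cases ht : tbl (G.ident x) with
    | some y =>
      rw [← htbl x y ht] at h
      exact ih _ _ _ _ htbl hu h
    | none =>
      refine wp_readBits hx b 0 _ _ (hu x ht) ?_
      have e : decide (∀ i < b, r (x, 0 + i) = true) = wayPoint b r x := by simp [wayPoint]
      rw [e]
      refine ih _ _ _ _ ?_ ?_ h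
      · intro y z hyz
        by_cases hxy : y = x
        · subst hxy
          simpa [eq_comm] using hyz
        · rw [Function.update_of_ne (fun h => hxy (G.ident_injective h))] at hyz
          exact htbl y z hyz
      · intro y hy
        by_cases hxy : y = x
        · subst hxy
          simp at hy
        · rw [Function.update_of_ne (fun h => hxy (G.ident_injective h))] at hy
          rw [Function.update_of_ne hxy]
          exact hu y hy

/-- A program without questions for way-points becomes an algorithm without random bits. -/
theorem isDeterministic [Inhabited β] (P : ℕ → NodeInfo L → Prog L β) :
    (CoinProg.toAlgorithm fun n i => (P n i).toCoin 0 fun _ => none).IsDeterministic := by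
  have key : ∀ (p : Prog L β) (tbl : ℕ → Option Bool) (h : List (Answer L)) (p' : CoinProg L β),
      (p.toCoin 0 tbl).rest h = some p' → ∀ w, p'.move ≠ Move.coin w := by
    intro p
    induction p with
    | pure c =>
      intro tbl h p' hp w
      cases h with
      | nil =>
        simp only [CoinProg.rest, Option.some.injEq] at hp
        subst hp
        simp [toCoin, CoinProg.move]
      | cons a h => simp [toCoin, CoinProg.rest] at hp
    | query w' j f ih =>
      intro tbl h p' hp w
      cases h with
      | nil =>
        simp only [CoinProg.rest, Option.some.injEq] at hp
        subst hp
        simp [toCoin, CoinProg.move]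
      | cons a h =>
        cases a with
        | node i => exact ih i tbl h p' (by simpa [toCoin, CoinProg.rest] using hp) w
        | bit c => simp [toCoin, CoinProg.rest] at hp
    | way w' f ih =>
      intro tbl h p' hp w
      unfold toCoin at hp
      cases ht : tbl w' with
      | some y => rw [ht] at hp; exact ih _ _ _ _ hp w
      | none => rw [ht] at hp; exact ih _ _ _ _ hp w
  intro n h w
  unfold CoinProg.toAlgorithm
  split
  · rename_i i h'
    cases hr : (((P n i).toCoin 0 fun _ => none).rest h') with
    | none => simp
    | some p' => exact key _ _ _ _ hr w
  · simp

end Prog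

/-! ### A program for the rule -/

instance : Inhabited OutColor := ⟨.D⟩

/-- The image of the result of a search. -/
def TopResult.map {V V' : Type*} (f : V → V') : TopResult V → TopResult V'
  | .top t => .top (f t)
  | .cycle => .cycle
  | .long => .long

section Programs

variable {Δ : ℕ}

open scoped Classical in
/-- Query the port `p` of a node. -/
noncomputable def nbrProg (x : NodeInfo (TreeLabel Δ)) (p : Option (Fin Δ)) :
    Prog (TreeLabel Δ) (Option (NodeInfo (TreeLabel Δ))) :=
  match p with
  | none => .pure none
  | some j =>
    if x.label.WellFormed ∧ (j : ℕ) < x.deg then .query x.ident j fun u => .pure (some u)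
    else .pure none

/-- The program for `par`. -/
noncomputable def parProg (x : NodeInfo (TreeLabel Δ)) :
    Prog (TreeLabel Δ) (Option (NodeInfo (TreeLabel Δ))) :=
  nbrProg x x.label.parent

/-- Query the port `p` of a node, and check whether the node at this port points back. -/
noncomputable def childProg (x : NodeInfo (TreeLabel Δ)) (p : Option (Fin Δ)) :
    Prog (TreeLabel Δ) (Option (NodeInfo (TreeLabel Δ))) :=
  (nbrProg x p).bind fun o => match o with
    | none => .pure none
    | some u => (parProg u).bind fun o' =>
      .pure (if o'.map NodeInfo.ident = some x.ident then some u else none)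

/-- The program for `capLevel`. -/
noncomputable def capLevelProg : ℕ → NodeInfo (TreeLabel Δ) → Prog (TreeLabel Δ) ℕ
  | 0, _ => .pure 1
  | f + 1, x => (childProg x x.label.right).bind fun o => match o with
    | none => .pure 1
    | some u => (capLevelProg f u).bind fun l => .pure (l + 1)

/-- The program for `next`. -/
noncomputable def nextProg (k : ℕ) (x : NodeInfo (TreeLabel Δ)) :
    Prog (TreeLabel Δ) (Option (NodeInfo (TreeLabel Δ))) :=
  (childProg x x.label.left).bind fun o => match o with
    | none => .pure none
    | some u => (capLevelProg k u).bind fun l => (capLevelProg k x).bind fun l' =>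
      .pure (if l = l' then some u else none)

/-- The program for `prev`. -/
noncomputable def prevProg (k : ℕ) (x : NodeInfo (TreeLabel Δ)) :
    Prog (TreeLabel Δ) (Option (NodeInfo (TreeLabel Δ))) :=
  (parProg x).bind fun o => match o with
    | none => .pure none
    | some u => (childProg u u.label.left).bind fun o' =>
      (capLevelProg k u).bind fun l => (capLevelProg k x).bind fun l' =>
        .pure (if o'.map NodeInfo.ident = some x.ident ∧ l = l' then some u else none)

/-- The program for `exempt`. The right child is visited only if the node is a way-point. -/
noncomputable def exemptProg (o : NodeInfo (TreeLabel Δ) → Prog (TreeLabel Δ) OutColor)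
    (x : NodeInfo (TreeLabel Δ)) : Prog (TreeLabel Δ) Bool :=
  .way x.ident fun b =>
    if b then (childProg x x.label.right).bind fun o' => match o' with
      | none => .pure false
      | some w => (o w).bind fun c => .pure (!c.isD)
    else .pure false

/-- The program for the search along `g` among the nodes for which `e` is false. -/
noncomputable def findTopProg
    (g : NodeInfo (TreeLabel Δ) → Prog (TreeLabel Δ) (Option (NodeInfo (TreeLabel Δ))))
    (e : NodeInfo (TreeLabel Δ) → Prog (TreeLabel Δ) Bool) (w : ℕ) :
    ℕ → NodeInfo (TreeLabel Δ) → Prog (TreeLabel Δ) (TopResult (NodeInfo (TreeLabel Δ)))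
  | 0, _ => .pure .long
  | i + 1, x => (g x).bind fun o => match o with
    | none => .pure (.top x)
    | some u =>
      if u.ident = w then .pure .cycle
      else (e u).bind fun b => if b then .pure (.top x) else findTopProg g e w i u

/-- The program for `ruleColor`: search the first node of the run, and from there its last node. -/
noncomputable def ruleColorProg (k s : ℕ) :
    ℕ → NodeInfo (TreeLabel Δ) → Prog (TreeLabel Δ) OutColor
  | 0, _ => .pure .X
  | l + 1, x => (exemptProg (ruleColorProg k s l) x).bind fun b =>
    if b then .pure .X
    else (findTopProg (prevProg k) (exemptProg (ruleColorProg k s l)) x.ident s x).bind fun r =>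
      match r with
      | .long => .pure .D
      | .cycle => .pure .R
      | .top t =>
        (findTopProg (nextProg k) (exemptProg (ruleColorProg k s l)) t.ident s t).bind fun r' =>
          match r' with
          | .top w => .pure w.label.color.toOut
          | _ => .pure .D

/-- The program for `rule`. -/
noncomputable def ruleProg (k s : ℕ) (x : NodeInfo (TreeLabel Δ)) :
    Prog (TreeLabel Δ) OutColor :=
  (capLevelProg k x).bind fun l => if l ≤ k then ruleColorProg k s l x else .pure .X

end Programs

/-! ### The cost of the program -/

section Runs

variable {Δ : ℕ} {α : ℝ} {n : ℕ} {L β γ : Type}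

/-- The program `p`, executed after the nodes in `S` have been visited, makes at most `c` queries
and visits nodes at distance at most `R` from the node `a`; its result and the final list of visited
nodes satisfy `P`. -/
def Runs (G : LabeledGraph Δ α L n) (W : Fin n → Bool) (a : Fin n) (R c : ℕ) (p : Prog L β)
    (S : List (Fin n)) (P : β → List (Fin n) → Prop) : Prop :=
  Prog.wp G W p S fun b S' => (∃ l, S' = S ++ l ∧ l.length ≤ c ∧
    ∀ y ∈ l, G.graph.edist a y ≤ R) ∧ P b S'

variable {G : LabeledGraph Δ α L n} {W : Fin n → Bool} {a : Fin n} {R c c' : ℕ}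
  {S : List (Fin n)}

theorem Runs.pure {b : β} {P : β → List (Fin n) → Prop} (h : P b S) :
    Runs G W a R c (.pure b) S P :=
  ⟨⟨[], by simp⟩, h⟩

theorem Runs.mono {p : Prog L β} {P P' : β → List (Fin n) → Prop} (h : Runs G W a R c p S P)
    (hc : c ≤ c') (hP : ∀ b S', P b S' → P' b S') : Runs G W a R c' p S P' :=
  Prog.wp_mono h fun b S' ⟨⟨l, h1, h2, h3⟩, h4⟩ => ⟨⟨l, h1, h2.trans hc, h3⟩, hP b S' h4⟩

theorem Runs.bind {p : Prog L β} {g : β → Prog L γ} {P : β → List (Fin n) → Prop}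
    {P' : γ → List (Fin n) → Prop} {c₁ c₂ : ℕ} (h : Runs G W a R c₁ p S P) (hc : c₁ + c₂ ≤ c)
    (hg : ∀ b S', (∀ x ∈ S, x ∈ S') → P b S' → Runs G W a R c₂ (g b) S' P') :
    Runs G W a R c (p.bind g) S P' := by
  refine Prog.wp_bind (Prog.wp_mono h fun b S' hS' => ?_)
  obtain ⟨⟨l, rfl, h2, h3⟩, h4⟩ := hS'
  refine Prog.wp_mono (hg b _ (fun x hx => List.mem_append_left _ hx) h4) fun b S' hS' => ?_
  obtain ⟨⟨l', rfl, h2', h3'⟩, h4'⟩ := hS'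
  refine ⟨⟨l ++ l', by simp, by rw [List.length_append]; omega, fun y hy => ?_⟩, h4'⟩
  rcases List.mem_append.1 hy with hy | hy
  · exact h3 y hy
  · exact h3' y hy

/-- The result `b` of a program describes the node `o`, which has been visited. -/
def Found (G : LabeledGraph Δ α L n) (o : Option (Fin n)) (b : Option (NodeInfo L))
    (S : List (Fin n)) : Prop :=
  b = o.map G.info ∧ ∀ u, o = some u → u ∈ S

end Runs

section RuleCost

variable {Δ : ℕ} {α : ℝ} {n : ℕ} {G : LabeledGraph Δ α (TreeLabel Δ) n} {W : Fin n → Bool}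
  {a : Fin n} {R k s : ℕ} {S : List (Fin n)} {x : Fin n} {ρ : ℕ}

theorem edist_of_nbr {p : Option (Fin Δ)} {u : Fin n} (h : nbr G x p = some u)
    (hx : G.graph.edist a x ≤ ρ) : G.graph.edist a u ≤ (ρ + 1 : ℕ) := by
  obtain ⟨-, j, hj, -, rfl⟩ := (nbr_eq_some_iff G).1 h
  have hadj : G.graph.Adj x (G.port x ⟨j, hj⟩ : Fin n) := (G.port x ⟨j, hj⟩).2
  calc G.graph.edist a _ ≤ G.graph.edist a x + G.graph.edist x _ := SimpleGraph.edist_triangle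
    _ ≤ (ρ : ℕ∞) + 1 := add_le_add hx (by rw [SimpleGraph.edist_eq_one_iff_adj.2 hadj])
    _ = ((ρ + 1 : ℕ) : ℕ∞) := by push_cast; rfl

theorem edist_of_par {u : Fin n} (h : par G x = some u) (hx : G.graph.edist a x ≤ ρ) :
    G.graph.edist a u ≤ (ρ + 1 : ℕ) := edist_of_nbr h hx

theorem edist_of_rc {u : Fin n} (h : rc G x = some u) (hx : G.graph.edist a x ≤ ρ) :
    G.graph.edist a u ≤ (ρ + 1 : ℕ) :=
  edist_of_nbr (Option.bind_eq_some_iff.1 h |>.elim fun y hy => by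
    have := hy.2; split_ifs at this; cases this; exact hy.1) hx

theorem edist_of_lc {u : Fin n} (h : lc G x = some u) (hx : G.graph.edist a x ≤ ρ) :
    G.graph.edist a u ≤ (ρ + 1 : ℕ) :=
  edist_of_nbr (Option.bind_eq_some_iff.1 h |>.elim fun y hy => by
    have := hy.2; split_ifs at this; cases this; exact hy.1) hx

theorem edist_of_next {u : Fin n} (h : next G k x = some u) (hx : G.graph.edist a x ≤ ρ) :
    G.graph.edist a u ≤ (ρ + 1 : ℕ) :=
  edist_of_lc (next_eq_some_iff.1 h).1 hx

theorem edist_of_prev {u : Fin n} (h : prev G k x = some u) (hx : G.graph.edist a x ≤ ρ) :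
    G.graph.edist a u ≤ (ρ + 1 : ℕ) :=
  edist_of_par (par_of_lc (next_eq_some_iff.1 ((next_iff_prev x u).2 h)).1) hx

theorem runs_nbrProg (p : Option (Fin Δ)) (hx : x ∈ S) (hρ : G.graph.edist a x ≤ ρ)
    (hR : ρ + 1 ≤ R) : Runs G W a R 1 (nbrProg (G.info x) p) S (Found G (nbr G x p)) := by
  unfold nbrProg
  cases p with
  | none =>
    refine Runs.pure ?_
    have : nbr G x none = none := by simp [nbr]
    rw [this]
    exact ⟨rfl, by simp⟩
  | some j =>
    dsimp only
    split_ifs with h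
    · have he : nbr G x (some j) = some (G.port x ⟨j, h.2⟩ : Fin n) :=
        (nbr_eq_some_iff G).2 ⟨h.1, j, h.2, rfl, rfl⟩
      refine ⟨x, hx, rfl, h.2, ⟨⟨[_], rfl, by simp, ?_⟩, ?_⟩⟩
      · intro y hy
        rw [List.mem_singleton] at hy
        subst hy
        exact (edist_of_nbr he hρ).trans (by exact_mod_cast hR)
      · rw [he]
        exact ⟨rfl, fun u hu => by cases hu; simp⟩
    · refine Runs.pure ?_
      have : nbr G x (some j) = none := by
        by_contra hne
        obtain ⟨u, hu⟩ := Option.ne_none_iff_exists'.1 hne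
        obtain ⟨h1, j', h2, h3, -⟩ := (nbr_eq_some_iff G).1 hu
        cases h3
        exact h ⟨h1, h2⟩
      rw [this]
      exact ⟨rfl, by simp⟩

theorem runs_parProg (hx : x ∈ S) (hρ : G.graph.edist a x ≤ ρ) (hR : ρ + 1 ≤ R) :
    Runs G W a R 1 (parProg (G.info x)) S (Found G (par G x)) :=
  runs_nbrProg _ hx hρ hR

theorem ident_map_info {o : Option (Fin n)} {y : Fin n} :
    (o.map G.info).map NodeInfo.ident = some (G.info y).ident ↔ o = some y := by
  cases o with
  | none => simp
  | some z =>
    simp only [Option.map_some, Option.some.injEq]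
    exact ⟨fun h => G.ident_injective h, fun h => by rw [h]⟩

theorem runs_childProg (p : Option (Fin Δ)) (hx : x ∈ S) (hρ : G.graph.edist a x ≤ ρ)
    (hR : ρ + 2 ≤ R) : Runs G W a R 2 (childProg (G.info x) p) S
      (Found G ((nbr G x p).bind fun u => if par G u = some x then some u else none)) := by
  refine Runs.bind (c₂ := 1) (runs_nbrProg p hx hρ (by omega)) le_rfl ?_
  rintro b S' hS ⟨rfl, hu⟩
  cases hn : nbr G x p with
  | none => exact Runs.pure ⟨rfl, by simp⟩
  | some u =>
    refine Runs.bind (c₂ := 0) (runs_parProg (hu u hn) (edist_of_nbr hn hρ) (by omega)) le_rfl ?_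
    rintro b S'' hS' ⟨rfl, -⟩
    refine Runs.pure ?_
    simp only [ident_map_info, Option.bind_some]
    split_ifs with h
    · exact ⟨rfl, fun y hy => by cases hy; exact hS' _ (hu _ hn)⟩
    · exact ⟨rfl, by simp⟩

theorem runs_rc (hx : x ∈ S) (hρ : G.graph.edist a x ≤ ρ) (hR : ρ + 2 ≤ R) :
    Runs G W a R 2 (childProg (G.info x) (G.info x).label.right) S (Found G (rc G x)) :=
  runs_childProg _ hx hρ hR

theorem runs_lc (hx : x ∈ S) (hρ : G.graph.edist a x ≤ ρ) (hR : ρ + 2 ≤ R) :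
    Runs G W a R 2 (childProg (G.info x) (G.info x).label.left) S (Found G (lc G x)) :=
  runs_childProg _ hx hρ hR

theorem runs_capLevelProg (f : ℕ) (hx : x ∈ S) (hρ : G.graph.edist a x ≤ ρ)
    (hR : ρ + (f + 1) ≤ R) : Runs G W a R (2 * f) (capLevelProg f (G.info x)) S
      fun b _ => b = capLevel G f x := by
  induction f generalizing x S ρ with
  | zero => exact Runs.pure rfl
  | succ f ih =>
    refine Runs.bind (c₂ := 2 * f) (runs_rc hx hρ (by omega)) (by omega) ?_
    rintro b S' hS ⟨rfl, hu⟩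
    unfold capLevel
    cases hn : rc G x with
    | none => exact Runs.pure rfl
    | some u =>
      refine Runs.bind (c₂ := 0) (ih (hu u hn) (edist_of_rc hn hρ) (by omega)) le_rfl ?_
      rintro b S'' hS' rfl
      exact Runs.pure rfl

theorem runs_nextProg (hx : x ∈ S) (hρ : G.graph.edist a x ≤ ρ) (hR : ρ + (k + 2) ≤ R) :
    Runs G W a R (4 * k + 3) (nextProg k (G.info x)) S (Found G (next G k x)) := by
  refine Runs.bind (c₂ := 4 * k) (runs_lc hx hρ (by omega)) (by omega) ?_
  rintro b S₁ hS₁ ⟨rfl, hu⟩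
  unfold next
  cases hn : lc G x with
  | none => exact Runs.pure ⟨rfl, by simp⟩
  | some u =>
    refine Runs.bind (c₂ := 2 * k) (runs_capLevelProg k (hu u hn) (edist_of_lc hn hρ) (by omega))
      (by omega) ?_
    rintro _ S₂ hS₂ rfl
    refine Runs.bind (c₂ := 0) (runs_capLevelProg k (hS₂ _ (hS₁ _ hx)) hρ (by omega)) le_rfl ?_
    rintro _ S₃ hS₃ rfl
    refine Runs.pure ?_
    simp only [Option.bind_some]
    split_ifs with h
    · exact ⟨rfl, fun y hy => by cases hy; exact hS₃ _ (hS₂ _ (hu _ hn))⟩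
    · exact ⟨rfl, by simp⟩

theorem runs_prevProg (hx : x ∈ S) (hρ : G.graph.edist a x ≤ ρ) (hR : ρ + (k + 3) ≤ R) :
    Runs G W a R (4 * k + 3) (prevProg k (G.info x)) S (Found G (prev G k x)) := by
  refine Runs.bind (c₂ := 4 * k + 2) (runs_parProg hx hρ (by omega)) (by omega) ?_
  rintro b S₁ hS₁ ⟨rfl, hu⟩
  unfold prev
  cases hn : par G x with
  | none => exact Runs.pure ⟨rfl, by simp⟩
  | some u =>
    have hd := edist_of_par hn hρ
    refine Runs.bind (c₂ := 4 * k) (runs_lc (hu u hn) hd (by omega)) (by omega) ?_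
    rintro _ S₂ hS₂ ⟨rfl, -⟩
    refine Runs.bind (c₂ := 2 * k) (runs_capLevelProg k (hS₂ _ (hu u hn)) hd (by omega))
      (by omega) ?_
    rintro _ S₃ hS₃ rfl
    refine Runs.bind (c₂ := 0) (runs_capLevelProg k (hS₃ _ (hS₂ _ (hS₁ _ hx))) hρ (by omega))
      le_rfl ?_
    rintro _ S₄ hS₄ rfl
    refine Runs.pure ?_
    simp only [ident_map_info, Option.bind_some]
    split_ifs with h
    · exact ⟨rfl, fun y hy => by cases hy; exact hS₄ _ (hS₃ _ (hS₂ _ (hu _ hn)))⟩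
    · exact ⟨rfl, by simp⟩

theorem runs_exemptProg {oP : NodeInfo (TreeLabel Δ) → Prog (TreeLabel Δ) OutColor}
    {o : Fin n → OutColor} {c d : ℕ}
    (ho : ∀ (x : Fin n) (S : List (Fin n)) (ρ : ℕ), x ∈ S → G.graph.edist a x ≤ ρ → ρ + d ≤ R →
      Runs G W a R c (oP (G.info x)) S fun b _ => b = o x)
    (hx : x ∈ S) (hρ : G.graph.edist a x ≤ ρ) (hR : ρ + (d + 2) ≤ R) :
    Runs G W a R (if W x then c + 2 else 0) (exemptProg oP (G.info x)) S
      fun b _ => b = exempt G W o x := by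
  refine ⟨x, hx, rfl, ?_⟩
  cases hW : W x with
  | false => exact Runs.pure (by simp [exempt, hW])
  | true =>
    simp only [if_true]
    refine Runs.bind (c₂ := c) (runs_rc hx hρ (by omega)) (by omega) ?_
    rintro b S₁ hS₁ ⟨rfl, hu⟩
    unfold exempt
    cases hn : rc G x with
    | none => exact Runs.pure (by simp)
    | some u =>
      refine Runs.bind (c₂ := 0) (ho u S₁ (ρ + 1) (hu u hn) (edist_of_rc hn hρ) (by omega))
        le_rfl ?_
      rintro _ S₂ hS₂ rfl
      exact Runs.pure (by simp [hW])

/-- The number of way-points among the points that are reached by at most `j` steps. -/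
noncomputable def wayCount (W : Fin n → Bool) (g : Fin n → Option (Fin n)) (j : ℕ)
    (v : Fin n) : ℕ :=
  ((window g (j + 1) v).filter fun u => W u = true).card

theorem wayCount_succ {f g : Fin n → Option (Fin n)}
    (hfg : ∀ u v, f v = some u ↔ g u = some v) {j : ℕ} {v u : Fin n}
    (hret : ∀ i, 1 ≤ i → i ≤ j + 1 → walk g i v ≠ some v) (hu : walk g (j + 1) v = some u) :
    wayCount W g (j + 1) v = wayCount W g j v + if W u then 1 else 0 := by
  have hmem : u ∉ window g (j + 1) v := by
    intro h
    obtain ⟨i, hi, hiu⟩ := mem_window.1 h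
    exact walk_injOn (s := j + 2) hfg (fun i h1 h2 => hret i h1 (by omega)) (by omega) hi hiu hu
  have hins : window g (j + 1 + 1) v = insert u (window g (j + 1) v) := by
    ext y
    rw [Finset.mem_insert, mem_window, mem_window]
    constructor
    · rintro ⟨i, hi, hiy⟩
      rcases Nat.lt_succ_iff_lt_or_eq.1 hi with h | h
      · exact Or.inr ⟨i, h, hiy⟩
      · subst h; rw [hu] at hiy; cases hiy; exact Or.inl rfl
    · rintro (rfl | ⟨i, hi, hiy⟩)
      · exact ⟨j + 1, by omega, hu⟩
      · exact ⟨i, by omega, hiy⟩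
  unfold wayCount
  rw [hins, Finset.filter_insert]
  cases W u with
  | false => simp
  | true =>
    simp only [if_true]
    rw [Finset.card_insert_of_notMem fun h => hmem (Finset.mem_filter.1 h).1]

/-- The cost of a search: all visited nodes are distinct, so each way-point is paid for once. -/
theorem runs_findTopProg {f g : Fin n → Option (Fin n)} {e : Fin n → Bool}
    (hfg : ∀ u v, f v = some u ↔ g u = some v)
    {gP : NodeInfo (TreeLabel Δ) → Prog (TreeLabel Δ) (Option (NodeInfo (TreeLabel Δ)))}
    {eP : NodeInfo (TreeLabel Δ) → Prog (TreeLabel Δ) Bool} {c₀ c₁ d : ℕ}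
    (hg : ∀ (x : Fin n) (S : List (Fin n)) (ρ : ℕ), x ∈ S → G.graph.edist a x ≤ ρ → ρ + d ≤ R →
      Runs G W a R c₀ (gP (G.info x)) S (Found G (g x)))
    (hd : ∀ (x u : Fin n) (ρ : ℕ), g x = some u → G.graph.edist a x ≤ ρ →
      G.graph.edist a u ≤ (ρ + 1 : ℕ))
    (he : ∀ (x : Fin n) (S : List (Fin n)) (ρ : ℕ), x ∈ S → G.graph.edist a x ≤ ρ → ρ + d ≤ R →
      Runs G W a R (if W x then c₁ else 0) (eP (G.info x)) S fun b _ => b = e x)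
    {v₀ : Fin n} (h₀ : e v₀ = false) (i j : ℕ) {x : Fin n} (hj : walk g j v₀ = some x)
    (hret : ∀ i, 1 ≤ i → i ≤ j → walk g i v₀ ≠ some v₀) (hex : e x = false) {S : List (Fin n)}
    {ρ : ℕ} (hx : x ∈ S) (hρ : G.graph.edist a x ≤ ρ) (hR : ρ + i + d ≤ R) (c : ℕ)
    (hc : i * c₀ + c₁ * wayCount W g (j + i) v₀ ≤ c + c₁ * wayCount W g j v₀) :
    Runs G W a R c (findTopProg gP eP (G.ident v₀) i (G.info x)) S fun b S' =>
      b = (findTop (restrict e g) v₀ i x).map G.info ∧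
      ∀ t, findTop (restrict e g) v₀ i x = .top t → t ∈ S' ∧ G.graph.edist a t ≤ (ρ + i : ℕ) := by
  induction i generalizing j x S ρ c with
  | zero => exact Runs.pure ⟨rfl, by simp [findTop]⟩
  | succ i ih =>
    have hmono : wayCount W g j v₀ ≤ wayCount W g (j + (i + 1)) v₀ := by
      refine Finset.card_le_card (Finset.filter_subset_filter _ fun y hy => ?_)
      obtain ⟨i', hi', h⟩ := mem_window.1 hy
      exact mem_window.2 ⟨i', by omega, h⟩
    have hmul := Nat.mul_le_mul_left c₁ hmono
    have hexp : (i + 1) * c₀ = i * c₀ + c₀ := by ring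
    refine Runs.bind (c₁ := c₀) (c₂ := c - c₀) (hg x S ρ hx hρ (by omega)) (by omega) ?_
    rintro _ S₁ hS₁ ⟨rfl, hu⟩
    have hle : G.graph.edist a x ≤ (ρ + (i + 1) : ℕ) := hρ.trans (by exact_mod_cast by omega)
    unfold findTop
    cases hn : g x with
    | none =>
      have hr : restrict e g x = none := by simp [restrict, hn]
      rw [hr]
      exact Runs.pure ⟨rfl, fun t ht => by cases ht; exact ⟨hS₁ _ hx, hle⟩⟩
    | some u =>
      have hju : walk g (j + 1) v₀ = some u := by rw [walk_succ, hj]; exact hn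
      simp only [Option.map_some]
      by_cases huv : u = v₀
      · subst huv
        have hr : restrict e g x = some u := by simp [restrict, hn, hex, h₀]
        rw [hr, if_pos (show (G.info u).ident = G.ident u from rfl)]
        simp only [if_true]
        exact Runs.pure ⟨rfl, by simp⟩
      · rw [if_neg (show ¬ (G.info u).ident = G.ident v₀ from fun h => huv (G.ident_injective h))]
        have hret' : ∀ i, 1 ≤ i → i ≤ j + 1 → walk g i v₀ ≠ some v₀ := fun i h1 h2 h3 => by
          rcases Nat.le_succ_iff.1 h2 with h | rfl
          · exact hret i h1 h h3
          · rw [hju] at h3; exact huv (Option.some_injective _ h3)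
        have hcount := wayCount_succ (W := W) hfg hret' hju
        have hcW : c₁ * wayCount W g (j + 1) v₀ =
            c₁ * wayCount W g j v₀ + if W u then c₁ else 0 := by
          rw [hcount, mul_add]; split_ifs <;> simp
        have hmono' : wayCount W g (j + 1) v₀ ≤ wayCount W g (j + (i + 1)) v₀ := by
          refine Finset.card_le_card (Finset.filter_subset_filter _ fun y hy => ?_)
          obtain ⟨i', hi', h⟩ := mem_window.1 hy
          exact mem_window.2 ⟨i', by omega, h⟩
        have hmul' := Nat.mul_le_mul_left c₁ hmono'
        have hdu := hd x u ρ hn hρ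
        refine Runs.bind (c₁ := if W u then c₁ else 0) (c₂ := c - c₀ - if W u then c₁ else 0)
          (he u S₁ (ρ + 1) (hu u hn) hdu (by omega)) (by omega) ?_
        rintro _ S₂ hS₂ rfl
        cases heu : e u with
        | true =>
          have hr : restrict e g x = none := by simp [restrict, hn, heu]
          rw [hr]
          simp only [if_true]
          exact Runs.pure ⟨rfl, fun t ht => by cases ht; exact ⟨hS₂ _ (hS₁ _ hx), hle⟩⟩
        | false =>
          have hr : restrict e g x = some u := by simp [restrict, hn, heu, hex]
          rw [hr]
          simp only [Bool.false_eq_true, if_false, if_neg huv]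
          refine Runs.mono (ih (j + 1) hju hret' heu (hS₂ _ (hu u hn)) hdu (by omega)
            (c - c₀ - if W u then c₁ else 0) ?_) le_rfl fun b S' hb => ⟨hb.1, fun t ht => ?_⟩
          · rw [show j + 1 + i = j + (i + 1) by ring]
            omega
          · rw [show ρ + (i + 1) = ρ + 1 + i by ring]
            exact hb.2 t ht

/-- The search along a function for a point from which the starting point is not reached. -/
theorem findEnd_eq_findTop {V : Type*} [DecidableEq V] {f : V → Option V} {t : V}
    (ht : ∀ u, f u ≠ some t) (i : ℕ) (v : V) :
    findEnd f i v = match findTop f t i v with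
      | .top w => some w
      | _ => none := by
  induction i generalizing v with
  | zero => rfl
  | succ i ih =>
    unfold findEnd findTop
    cases h : f v with
    | none => rfl
    | some u =>
      have : u ≠ t := fun hu => ht v (hu ▸ h)
      simp only [if_neg this]
      exact ih u

/-- A bound for the number of queries of the program for the nodes of level `l`. -/
def ruleCost (k s T : ℕ) : ℕ → ℕ
  | 0 => 0
  | l + 1 => 2 * (s * (4 * k + 3)) + (2 * T + 1) * (ruleCost k s T l + 2)

theorem runs_ruleColorProg {T : ℕ} (hT : ∀ v, wayCount W (next G k) s v ≤ T)
    (hT' : ∀ v, wayCount W (prev G k) s v ≤ T) (l : ℕ) (hx : x ∈ S)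
    (hρ : G.graph.edist a x ≤ ρ) (hR : ρ + l * (2 * s + k + 3) ≤ R) :
    Runs G W a R (ruleCost k s T l) (ruleColorProg k s l (G.info x)) S
      fun b _ => b = ruleColor G k W s l x := by
  induction l generalizing x S ρ with
  | zero => exact Runs.pure rfl
  | succ l ih =>
    set o := ruleColor G k W s l with ho
    set c := ruleCost k s T l with hc
    set D := l * (2 * s + k + 3) with hD
    have hR' : ρ + (D + (2 * s + k + 3)) ≤ R := by
      rw [hD]; convert hR using 2; ring
    have hcost : ruleCost k s T (l + 1) =
        s * (4 * k + 3) + s * (4 * k + 3) + ((c + 2) * T + (c + 2) * T + (c + 2)) := by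
      rw [ruleCost, ← hc]; ring
    have hE : ∀ (x : Fin n) (S : List (Fin n)) (ρ : ℕ), x ∈ S → G.graph.edist a x ≤ ρ →
        ρ + (D + k + 3) ≤ R → Runs G W a R (if W x then c + 2 else 0)
          (exemptProg (ruleColorProg k s l) (G.info x)) S fun b _ => b = exempt G W o x :=
      fun x S ρ hx hρ hR => runs_exemptProg
        (fun x S ρ hx hρ hR => ih (x := x) (S := S) (ρ := ρ) hx hρ hR) hx hρ (by omega)
    refine Runs.bind (c₂ := s * (4 * k + 3) + s * (4 * k + 3) + ((c + 2) * T + (c + 2) * T))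
      (hE x S ρ hx hρ (by omega)) (by rw [hcost]; split_ifs <;> omega) ?_
    rintro _ S₁ hS₁ rfl
    unfold ruleColor
    cases hex : exempt G W o x with
    | true => exact Runs.pure rfl
    | false =>
      simp only [Bool.false_eq_true, if_false]
      refine Runs.bind (c₂ := s * (4 * k + 3) + (c + 2) * T)
        (runs_findTopProg (f := next G k) (g := prev G k) (fun u v => next_iff_prev u v)
          (d := D + k + 3)
          (fun x S ρ hx hρ hR => runs_prevProg hx hρ (by omega))
          (fun x u ρ h hρ => edist_of_prev h hρ) hE (v₀ := x) hex s 0 rfl (by omega) hex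
          (hS₁ _ hx) hρ (by omega) (s * (4 * k + 3) + (c + 2) * T) ?_) (by omega) ?_
      · rw [zero_add]
        have := Nat.mul_le_mul_left (c + 2) (hT' x)
        omega
      rintro _ S₂ hS₂ ⟨rfl, htop⟩
      unfold runColor
      cases ht : findTop (restrict (exempt G W o) (prev G k)) x s x with
      | long => exact Runs.pure rfl
      | cycle => exact Runs.pure rfl
      | top t =>
        obtain ⟨htS, htd⟩ := htop t ht
        obtain ⟨j, -, hj1, hj2⟩ := findTop_eq_top ht
        have het : exempt G W o t = false := (walk_restrict hj1 hex).2
        have hno : ∀ u, restrict (exempt G W o) (next G k) u ≠ some t := fun u hu => by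
          rw [restrict_inv, hj2] at hu; simp at hu
        simp only [TopResult.map]
        refine Runs.bind (c₂ := 0)
          (runs_findTopProg (f := prev G k) (g := next G k) (fun u v => (next_iff_prev v u).symm)
            (d := D + k + 3)
            (fun x S ρ hx hρ hR => runs_nextProg hx hρ (by omega))
            (fun x u ρ h hρ => edist_of_next h hρ) hE (v₀ := t) het s 0 rfl (by omega) het
            htS htd (by omega) (s * (4 * k + 3) + (c + 2) * T) ?_) (by omega) ?_
        · rw [zero_add]
          have := Nat.mul_le_mul_left (c + 2) (hT t)
          omega
        rintro _ S₃ hS₃ ⟨rfl, -⟩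
        rw [findEnd_eq_findTop hno]
        cases findTop (restrict (exempt G W o) (next G k)) t s t <;> exact Runs.pure rfl

theorem ruleCost_mono (k s T : ℕ) : Monotone (ruleCost k s T) := by
  refine monotone_nat_of_le_succ fun l => ?_
  rw [ruleCost]
  nlinarith [Nat.zero_le (T * (ruleCost k s T l + 2)), Nat.zero_le (s * (4 * k + 3))]

/-- The program computes the output of the rule. -/
theorem runs_ruleProg {T : ℕ} (hT : ∀ v, wayCount W (next G k) s v ≤ T)
    (hT' : ∀ v, wayCount W (prev G k) s v ≤ T) (hk : 1 ≤ k)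
    (hR : k * (2 * s + k + 3) ≤ R) (v : Fin n) :
    Runs G W v R (2 * k + ruleCost k s T k) (ruleProg k s (G.info v)) [v]
      fun b _ => b = rule G k W s v := by
  have hv : G.graph.edist v v ≤ (0 : ℕ) := by simp
  refine Runs.bind (runs_capLevelProg k (by simp) hv ?_) le_rfl ?_
  · nlinarith
  rintro _ S hS rfl
  unfold rule
  split_ifs with h
  · refine Runs.mono (runs_ruleColorProg hT hT' _ (hS v (by simp)) hv ?_) (ruleCost_mono _ _ _ h)
      fun b _ hb => hb
    have := Nat.mul_le_mul_right (2 * s + k + 3) h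
    omega
  · exact Runs.pure rfl

end RuleCost

/-! ### Random way-points -/

section Probability

variable {n : ℕ}

/-- The strings of random bits that start with `b` bits that are true. -/
def allTrue (b : ℕ) : Set (ℕ → Bool) := Set.pi (Finset.range b : Set ℕ) fun _ => {true}

theorem measurableSet_allTrue (b : ℕ) : MeasurableSet (allTrue b) :=
  MeasurableSet.pi (Finset.countable_toSet _) fun _ _ => measurableSet_singleton _

theorem measure_allTrue (b : ℕ) :
    Measure.infinitePi (fun _ : ℕ => (PMF.uniformOfFintype Bool).toMeasure) (allTrue b) =
      2⁻¹ ^ b := by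
  rw [allTrue, Measure.infinitePi_pi _ fun _ _ => measurableSet_singleton _]
  simp

theorem coinMeasure_forall {t : Set (ℕ → Bool)} (ht : MeasurableSet t) (A : Finset (Fin n)) :
    coinMeasure n {r | ∀ x ∈ A, (fun i => r (x, i)) ∈ t} =
      Measure.infinitePi (fun _ : ℕ => (PMF.uniformOfFintype Bool).toMeasure) t ^ A.card := by
  have h := Measure.infinitePi_map_curry (ι := Fin n) (κ := ℕ)
    fun _ _ => (PMF.uniformOfFintype Bool).toMeasure
  have hset : {r : Fin n × ℕ → Bool | ∀ x ∈ A, (fun i => r (x, i)) ∈ t} =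
      MeasurableEquiv.curry (Fin n) ℕ Bool ⁻¹' Set.pi (A : Set (Fin n)) fun _ => t := by
    ext r
    simp only [Set.mem_ofPred_eq, Set.mem_preimage, Set.mem_pi, Finset.mem_coe]
    rfl
  rw [hset, coinMeasure, ← Measure.map_apply (MeasurableEquiv.measurable _)
    (MeasurableSet.pi (Finset.countable_toSet _) fun _ _ => ht), h,
    Measure.infinitePi_pi _ fun _ _ => ht, Finset.prod_const]

theorem wayPoint_eq_true_iff {b : ℕ} {r : Fin n × ℕ → Bool} {x : Fin n} :
    Prog.wayPoint b r x = true ↔ (fun i => r (x, i)) ∈ allTrue b := by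
  simp [Prog.wayPoint, allTrue]

theorem coinMeasure_all_wayPoints (b : ℕ) (A : Finset (Fin n)) :
    coinMeasure n {r | ∀ x ∈ A, Prog.wayPoint b r x = true} = (2⁻¹ ^ b) ^ A.card := by
  simp_rw [wayPoint_eq_true_iff]
  rw [coinMeasure_forall (measurableSet_allTrue b), measure_allTrue]

theorem coinMeasure_no_wayPoint (b : ℕ) (A : Finset (Fin n)) :
    coinMeasure n {r | ∀ x ∈ A, ¬ Prog.wayPoint b r x = true} = (1 - 2⁻¹ ^ b) ^ A.card := by
  simp_rw [wayPoint_eq_true_iff]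
  have := coinMeasure_forall (measurableSet_allTrue b).compl A
  rw [prob_compl_eq_one_sub (measurableSet_allTrue b), measure_allTrue] at this
  exact this

/-- Markov's inequality for the random variable `2 ^ N`, where `N` is the number of way-points: this
variable counts the sets of way-points. -/
theorem coinMeasure_many_wayPoints (b T : ℕ) (A : Finset (Fin n)) :
    2 ^ T * coinMeasure n {r | T ≤ (A.filter fun x => Prog.wayPoint b r x = true).card} ≤
      (1 + 2⁻¹ ^ b) ^ A.card := by
  classical
  set E : Finset (Fin n) → Set (Fin n × ℕ → Bool) :=
    fun B => {r | ∀ x ∈ B, Prog.wayPoint b r x = true} with hE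
  have hmeas : ∀ B, MeasurableSet (E B) := by
    intro B
    have : E B = ⋂ x ∈ B, (fun r : Fin n × ℕ → Bool => fun i => r (x, i)) ⁻¹' allTrue b := by
      ext r
      simp [hE, wayPoint_eq_true_iff]
    rw [this]
    exact Finset.measurableSet_biInter _ fun x _ => by
      refine MeasurableSet.preimage (measurableSet_allTrue b) ?_
      fun_prop
  set F : (Fin n × ℕ → Bool) → ℝ≥0∞ := fun r => ∑ B ∈ A.powerset, (E B).indicator 1 r with hF
  have hFval : ∀ r, F r = 2 ^ (A.filter fun x => Prog.wayPoint b r x = true).card := by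
    intro r
    have h1 : F r = ∑ B ∈ A.powerset, if r ∈ E B then 1 else 0 := by
      simp only [hF, Set.indicator_apply, Pi.one_apply]
    have h2 : (A.powerset.filter fun B => r ∈ E B) =
        (A.filter fun x => Prog.wayPoint b r x = true).powerset := by
      ext B
      simp only [Finset.mem_filter, Finset.mem_powerset, hE, Set.mem_ofPred_eq,
        Finset.subset_iff]
      constructor
      · exact fun h x hx => ⟨h.1 hx, h.2 x hx⟩
      · exact fun h => ⟨fun x hx => (h hx).1, fun x hx => (h hx).2⟩
    rw [h1, Finset.sum_boole, h2, Finset.card_powerset]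
    push_cast
    rfl
  have hint : ∫⁻ r, F r ∂(coinMeasure n) = (1 + 2⁻¹ ^ b) ^ A.card := by
    rw [hF, lintegral_finsetSum _ fun B _ => measurable_one.indicator (hmeas B)]
    simp_rw [lintegral_indicator_one (hmeas _)]
    have := Finset.sum_pow_mul_eq_add_pow ((2⁻¹ : ℝ≥0∞) ^ b) 1 A
    rw [add_comm, ← this]
    refine Finset.sum_congr rfl fun B _ => ?_
    rw [one_pow, mul_one]
    exact coinMeasure_all_wayPoints b B
  have hFm : Measurable F :=
    Finset.measurable_fun_sum _ fun B _ => measurable_one.indicator (hmeas B)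
  have := mul_meas_ge_le_lintegral hFm (μ := coinMeasure n) (2 ^ T)
  rw [hint] at this
  refine le_trans (mul_le_mul_right (measure_mono fun r hr => ?_) _) this
  rw [Set.mem_ofPred_eq, hFval]
  exact pow_le_pow_right₀ (by norm_num) hr

theorem coinMeasure_no_wayPoint_le {b h Λ : ℕ} (hb : 2 ^ b ≤ h) {A : Finset (Fin n)}
    (hA : h * Λ ≤ A.card) :
    coinMeasure n {r | ∀ x ∈ A, ¬ Prog.wayPoint b r x = true} ≤
      ENNReal.ofReal (Real.exp (-Λ)) := by
  rw [coinMeasure_no_wayPoint]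
  have h2 : (2⁻¹ : ℝ≥0∞) = ENNReal.ofReal 2⁻¹ := by
    rw [ENNReal.ofReal_inv_of_pos two_pos, ENNReal.ofReal_ofNat]
  have hp1 : ((2⁻¹ : ℝ) ^ b) ≤ 1 := pow_le_one₀ (by norm_num) (by norm_num)
  have h3 : (1 : ℝ≥0∞) - 2⁻¹ ^ b = ENNReal.ofReal (1 - 2⁻¹ ^ b) := by
    rw [ENNReal.ofReal_sub _ (by positivity), ENNReal.ofReal_one, ENNReal.ofReal_pow (by norm_num),
      h2]
  rw [h3, ← ENNReal.ofReal_pow (by linarith)]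
  refine ENNReal.ofReal_le_ofReal ?_
  have h4 : 1 - (2⁻¹ : ℝ) ^ b ≤ Real.exp (-(2⁻¹ ^ b)) := by
    have := Real.add_one_le_exp (-((2⁻¹ : ℝ) ^ b)); linarith
  calc (1 - (2⁻¹ : ℝ) ^ b) ^ A.card ≤ Real.exp (-(2⁻¹ ^ b)) ^ A.card :=
        pow_le_pow_left₀ (by linarith) h4 _
    _ = Real.exp (-(A.card * 2⁻¹ ^ b)) := by rw [← Real.exp_nat_mul]; ring_nf
    _ ≤ Real.exp (-Λ) := by
      refine Real.exp_le_exp.2 (neg_le_neg ?_)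
      rw [inv_pow, ← div_eq_mul_inv, le_div_iff₀ (by positivity)]
      have h5 : Λ * 2 ^ b ≤ A.card := by
        refine le_trans ?_ hA
        rw [mul_comm]
        exact Nat.mul_le_mul_right _ hb
      exact_mod_cast h5

theorem coinMeasure_many_wayPoints_le {b h Λ : ℕ} (hb : h < 2 ^ (b + 1)) (hh : 1 ≤ h)
    {A : Finset (Fin n)} (hA : A.card ≤ h + h * Λ + 1) :
    coinMeasure n {r | 6 * Λ + 8 ≤ (A.filter fun x => Prog.wayPoint b r x = true).card} ≤
      ENNReal.ofReal (Real.exp (-Λ)) := by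
  have h1 := coinMeasure_many_wayPoints b (6 * Λ + 8) A
  have h2 : (2⁻¹ : ℝ≥0∞) = ENNReal.ofReal 2⁻¹ := by
    rw [ENNReal.ofReal_inv_of_pos two_pos, ENNReal.ofReal_ofNat]
  have h3 : (1 : ℝ≥0∞) + 2⁻¹ ^ b = ENNReal.ofReal (1 + 2⁻¹ ^ b) := by
    rw [ENNReal.ofReal_add one_pos.le (by positivity), ENNReal.ofReal_one,
      ENNReal.ofReal_pow (by norm_num), h2]
  have h4 : (1 + (2⁻¹ : ℝ) ^ b) ^ A.card ≤ 2 ^ (6 * Λ + 8) * Real.exp (-Λ) := by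
    have h5 : 1 + (2⁻¹ : ℝ) ^ b ≤ Real.exp (2⁻¹ ^ b) := by
      have := Real.add_one_le_exp ((2⁻¹ : ℝ) ^ b); linarith
    have h6 : (A.card : ℝ) * 2⁻¹ ^ b ≤ 2 * Λ + 4 := by
      rw [inv_pow, ← div_eq_mul_inv, div_le_iff₀ (by positivity)]
      have h7 : A.card ≤ (2 * Λ + 4) * 2 ^ b := by
        have : h + h * Λ + 1 ≤ h * (Λ + 2) := by nlinarith
        have h8 : h * (Λ + 2) ≤ 2 ^ (b + 1) * (Λ + 2) := Nat.mul_le_mul_right _ hb.le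
        calc A.card ≤ 2 ^ (b + 1) * (Λ + 2) := by omega
          _ = (2 * Λ + 4) * 2 ^ b := by ring
      exact_mod_cast h7
    have h7 : Real.exp (1 / 2) ≤ 2 := by
      rw [← Real.le_log_iff_exp_le two_pos]
      linarith [Real.log_two_gt_d9]
    calc (1 + (2⁻¹ : ℝ) ^ b) ^ A.card ≤ Real.exp (2⁻¹ ^ b) ^ A.card :=
          pow_le_pow_left₀ (by positivity) h5 _
      _ = Real.exp (A.card * 2⁻¹ ^ b) := by rw [← Real.exp_nat_mul]
      _ ≤ Real.exp (2 * Λ + 4) := Real.exp_le_exp.2 h6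
      _ = Real.exp (1 / 2) ^ (6 * Λ + 8) * Real.exp (-Λ) := by
        rw [← Real.exp_nat_mul, ← Real.exp_add]; push_cast; ring_nf
      _ ≤ 2 ^ (6 * Λ + 8) * Real.exp (-Λ) :=
        mul_le_mul_of_nonneg_right (pow_le_pow_left₀ (Real.exp_pos _).le h7 _) (Real.exp_pos _).le
  rw [h3, ← ENNReal.ofReal_pow (by positivity)] at h1
  have h5 := h1.trans (ENNReal.ofReal_le_ofReal h4)
  rw [ENNReal.ofReal_mul (by positivity), ENNReal.ofReal_pow (by norm_num), ENNReal.ofReal_ofNat]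
    at h5
  exact (ENNReal.mul_le_mul_iff_right (by simp) (by simp)).1 h5

variable {Δ : ℕ} {α : ℝ}

/-- The random way-points hit all windows with many light nodes, and no window contains many of
them, with high probability. -/
theorem coinMeasure_not_hits_le (G : LabeledGraph Δ α (TreeLabel Δ) n) (k : ℕ) {b h Λ : ℕ}
    (hb : 2 ^ b ≤ h) (hb' : h < 2 ^ (b + 1)) :
    coinMeasure n {r | ¬ (Hits G k (Prog.wayPoint b r) (h + h * Λ) h (h * Λ) ∧
      (∀ v, wayCount (Prog.wayPoint b r) (next G k) (h + h * Λ) v ≤ 6 * Λ + 8) ∧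
      ∀ v, wayCount (Prog.wayPoint b r) (prev G k) (h + h * Λ) v ≤ 6 * Λ + 8)} ≤
      ENNReal.ofReal (4 * n * Real.exp (-Λ)) := by
  classical
  have hh : 1 ≤ h := Nat.one_le_two_pow.trans hb
  set s := h + h * Λ with hs
  set f : Bool → Fin n → Option (Fin n) := fun c => if c then next G k else prev G k with hf
  set light : Fin n × Bool → Finset (Fin n) :=
    fun i => (window (f i.2) s i.1).filter (IsLight G k h) with hlight
  set big : Fin n × Bool → Finset (Fin n) := fun i => window (f i.2) (s + 1) i.1 with hbig
  -- the bad events for each window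
  set E₁ : Fin n × Bool → Set (Fin n × ℕ → Bool) := fun i =>
    {r | h * Λ ≤ (light i).card ∧ ∀ x ∈ light i, ¬ Prog.wayPoint b r x = true} with hE₁
  set E₂ : Fin n × Bool → Set (Fin n × ℕ → Bool) := fun i =>
    {r | 6 * Λ + 8 ≤ ((big i).filter fun x => Prog.wayPoint b r x = true).card} with hE₂
  have h1 : ∀ i, coinMeasure n (E₁ i) ≤ ENNReal.ofReal (Real.exp (-Λ)) := by
    intro i
    by_cases hc : h * Λ ≤ (light i).card
    · exact (measure_mono fun r hr => hr.2).trans (coinMeasure_no_wayPoint_le hb hc)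
    · have : E₁ i = ∅ := by ext r; simp [hE₁, hc]
      rw [this, measure_empty]
      exact zero_le
  have h2 : ∀ i, coinMeasure n (E₂ i) ≤ ENNReal.ofReal (Real.exp (-Λ)) := fun i =>
    coinMeasure_many_wayPoints_le hb' hh (card_window_le _ _ _)
  have hsub : {r | ¬ (Hits G k (Prog.wayPoint b r) s h (h * Λ) ∧
      (∀ v, wayCount (Prog.wayPoint b r) (next G k) s v ≤ 6 * Λ + 8) ∧
      ∀ v, wayCount (Prog.wayPoint b r) (prev G k) s v ≤ 6 * Λ + 8)} ⊆
      ⋃ i ∈ (Finset.univ : Finset (Fin n × Bool)), (E₁ i ∪ E₂ i) := by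
    intro r hr
    by_contra hno
    simp only [Set.mem_iUnion, Finset.mem_univ, exists_const, not_exists, Set.mem_union,
      not_or] at hno
    refine hr ⟨?_, fun v => ?_, fun v => ?_⟩
    · intro v N hN hq
      obtain ⟨c, rfl⟩ : ∃ c, N = window (f c) s v := by
        rcases hN with rfl | hN
        · exact ⟨true, by simp [hf]⟩
        · exact ⟨false, by rw [Set.mem_singleton_iff.1 hN]; simp [hf]⟩
      have := (hno (v, c)).1
      simp only [hE₁, Set.mem_ofPred_eq, not_and, not_forall, not_not] at this
      obtain ⟨x, hx, hw⟩ := this (by convert hq)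
      exact ⟨x, (Finset.mem_filter.1 hx).1, (Finset.mem_filter.1 hx).2, hw⟩
    · have := (hno (v, true)).2
      simp only [hE₂, hbig, hf, Set.mem_ofPred_eq, not_le, if_true] at this
      exact this.le
    · have := (hno (v, false)).2
      simp only [hE₂, hbig, hf, Set.mem_ofPred_eq, not_le, Bool.false_eq_true, if_false] at this
      exact this.le
  calc _ ≤ coinMeasure n (⋃ i ∈ (Finset.univ : Finset (Fin n × Bool)), (E₁ i ∪ E₂ i)) :=
        measure_mono hsub
    _ ≤ ∑ i : Fin n × Bool, coinMeasure n (E₁ i ∪ E₂ i) := measure_biUnion_finset_le _ _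
    _ ≤ ∑ _i : Fin n × Bool, (ENNReal.ofReal (Real.exp (-Λ)) + ENNReal.ofReal (Real.exp (-Λ))) :=
        Finset.sum_le_sum fun i _ => (measure_union_le _ _).trans (add_le_add (h1 i) (h2 i))
    _ = ENNReal.ofReal (4 * n * Real.exp (-Λ)) := by
      rw [Finset.sum_const, Finset.card_univ, Fintype.card_prod, Fintype.card_fin,
        Fintype.card_bool, ← ENNReal.ofReal_add (Real.exp_pos _).le (Real.exp_pos _).le,
        nsmul_eq_mul, ← ENNReal.ofReal_natCast, ← ENNReal.ofReal_mul (by positivity)]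
      congr 1
      push_cast
      ring

end Probability

/-! ### The upper bounds -/

section Upper

variable {Δ : ℕ} {α : ℝ}

/-- The algorithm that executes the program for the rule, with windows of length `s n` and with the
nodes whose first `b n` random bits are true as way-points. It gives up when it has made more
queries than are needed if no window contains more than `T n` way-points. -/
noncomputable def ruleAlgorithm (Δ k : ℕ) (b s T : ℕ → ℕ) : Algorithm (TreeLabel Δ) OutColor :=
  CoinProg.toAlgorithm fun n x =>
    ((ruleProg k (s n) x).truncate .D (2 * k + ruleCost k (s n) (T n) k)).toCoin (b n) fun _ => none

theorem isDeterministic_ruleAlgorithm (Δ k : ℕ) (s T : ℕ → ℕ) :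
    (ruleAlgorithm Δ k (fun _ => 0) s T).IsDeterministic :=
  Prog.isDeterministic fun n x =>
    (ruleProg k (s n) x).truncate OutColor.D (2 * k + ruleCost k (s n) (T n) k)

variable {n k : ℕ} (G : LabeledGraph Δ α (TreeLabel Δ) n) (r : Fin n × ℕ → Bool) (b s T : ℕ → ℕ)

theorem wayCount_le (W : Fin n → Bool) (g : Fin n → Option (Fin n)) (j : ℕ) (v : Fin n) :
    wayCount W g j v ≤ n :=
  (Finset.card_le_univ _).trans_eq (Fintype.card_fin n)

theorem encard_visitedSet_ruleAlgorithm_le (hk : 1 ≤ k) (v : Fin n) :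
    (visitedSet (ruleAlgorithm Δ k b s T) G r v).encard ≤
      (1 + (2 * k + ruleCost k (s n) (T n) k) : ℕ) := by
  have h1 := runs_ruleProg (G := G) (W := Prog.wayPoint (b n) r) (k := k) (s := s n) (T := n)
    (fun v => wayCount_le _ _ _ v) (fun v => wayCount_le _ _ _ v) hk le_rfl v
  have h2 := Prog.wp_truncate .D (M := 2 * k + ruleCost k (s n) (T n) k) h1
  have h3 := Prog.wp_toCoin _ (fun _ => none) _ (fun _ => 0) (by simp) (by simp) h2
  obtain ⟨o, S, -, hS, hlen, -⟩ := CoinProg.exists_output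
    (P := fun n x => ((ruleProg k (s n) x).truncate .D
      (2 * k + ruleCost k (s n) (T n) k)).toCoin (b n) fun _ => none) h3
  have h4 : {x | x ∈ S} = (S.toFinset : Set (Fin n)) := by ext; simp
  refine (Set.encard_le_encard hS).trans ?_
  rw [h4, Set.encard_coe_eq_coe_finsetCard]
  exact_mod_cast (List.toFinset_card_le S).trans hlen

theorem outputs_ruleAlgorithm (hk : 1 ≤ k)
    (hT : ∀ v, wayCount (Prog.wayPoint (b n) r) (next G k) (s n) v ≤ T n)
    (hT' : ∀ v, wayCount (Prog.wayPoint (b n) r) (prev G k) (s n) v ≤ T n) (v : Fin n) :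
    Outputs (ruleAlgorithm Δ k b s T) G r v (rule G k (Prog.wayPoint (b n) r) (s n) v) ∧
    ∀ u ∈ visitedSet (ruleAlgorithm Δ k b s T) G r v,
      G.graph.edist v u ≤ (k * (2 * s n + k + 3) : ℕ) := by
  have h1 := runs_ruleProg (G := G) hT hT' hk le_rfl v
  have h2 := Prog.wp_truncate .D (M := 2 * k + ruleCost k (s n) (T n) k) h1
  have h3 := Prog.wp_toCoin _ (fun _ => none) _ (fun _ => 0) (by simp) (by simp) h2
  obtain ⟨o, S, ho, hS, -, h4⟩ := CoinProg.exists_output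
    (P := fun n x => ((ruleProg k (s n) x).truncate .D
      (2 * k + ruleCost k (s n) (T n) k)).toCoin (b n) fun _ => none) h3
  rcases h4 with ⟨⟨l, rfl, -, hl⟩, rfl⟩ | h4
  · refine ⟨ho, fun u hu => ?_⟩
    rcases List.mem_append.1 (hS hu) with h | h
    · rw [List.mem_singleton] at h
      subst h
      simp
    · exact hl u h
  · refine absurd (Prog.wp_mono h1 ?_) h4
    rintro _ _ ⟨⟨l, rfl, h5, -⟩, -⟩
    rw [List.length_append]
    omega

theorem succeeds_ruleAlgorithm (hk : 1 ≤ k) {h q : ℕ} (hs : h + q ≤ s n + 1) (hn : n < h ^ k)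
    (hits : Hits G k (Prog.wayPoint (b n) r) (s n) h q)
    (hT : ∀ v, wayCount (Prog.wayPoint (b n) r) (next G k) (s n) v ≤ T n)
    (hT' : ∀ v, wayCount (Prog.wayPoint (b n) r) (prev G k) (s n) v ≤ T n) :
    Succeeds (hierarchicalTHC Δ α k) (ruleAlgorithm Δ k b s T) G r :=
  ⟨_, fun v => (outputs_ruleAlgorithm G r b s T hk hT hT' v).1, validTHC_rule hs hits hk hn⟩

/-- Without random bits, all nodes are way-points, and windows of length `h` with `h ^ k > n` are
sufficient. -/
theorem succeeds_ruleAlgorithm_of_eq_zero (hk : 1 ≤ k) (hb : b n = 0) (hT : T n = n)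
    (hn : n < s n ^ k) :
    Succeeds (hierarchicalTHC Δ α k) (ruleAlgorithm Δ k b s T) G r := by
  classical
  refine succeeds_ruleAlgorithm G r b s T hk (h := s n) (q := 1) le_rfl hn ?_
    (fun v => by rw [hT]; exact wayCount_le _ _ _ v)
    (fun v => by rw [hT]; exact wayCount_le _ _ _ v)
  intro v N _ hq
  obtain ⟨u, hu⟩ := Finset.card_pos.1 hq
  exact ⟨u, (Finset.mem_filter.1 hu).1, (Finset.mem_filter.1 hu).2, by simp [Prog.wayPoint, hb]⟩

theorem lt_floor_rpow_add_one_pow (hk : 1 ≤ k) (N : ℕ) :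
    N < (⌊(N : ℝ) ^ (1 / (k : ℝ))⌋₊ + 1) ^ k := by
  have hk0 : (k : ℝ) ≠ 0 := by exact_mod_cast (by omega : k ≠ 0)
  have h1 := Nat.lt_floor_add_one ((N : ℝ) ^ (1 / (k : ℝ)))
  have h2 : (N : ℝ) = ((N : ℝ) ^ (1 / (k : ℝ))) ^ k := by
    rw [← Real.rpow_natCast, ← Real.rpow_mul (by positivity), one_div, inv_mul_cancel₀ hk0,
      Real.rpow_one]
  have h3 := pow_lt_pow_left₀ h1 (by positivity) (by omega : k ≠ 0)
  rw [← h2] at h3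
  exact_mod_cast h3

theorem isBigOh_dDist (Δ : ℕ) (α : ℝ) (hk : 1 ≤ k) :
    IsBigOh (DDist (hierarchicalTHC Δ α k)) (fun n => (n : ℝ) ^ (1 / (k : ℝ))) := by
  refine ⟨k * (k + 7), by positivity, ?_⟩
  filter_upwards [eventually_ge_atTop 1] with N hN
  set x : ℝ := (N : ℝ) ^ (1 / (k : ℝ)) with hx
  have hx1 : 1 ≤ x := Real.one_le_rpow (by exact_mod_cast hN) (by positivity)
  set h := ⌊x⌋₊ + 1 with hh
  have hhx : (h : ℝ) ≤ 2 * x := by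
    have := Nat.floor_le (zero_le_one.trans hx1)
    rw [hh]; push_cast; linarith
  -- the algorithm may depend on `N`; on larger graphs its cost does not matter
  set s : ℕ → ℕ := fun n => if n ≤ N then h else n + 1 with hs
  have hsolve : SolvesDet (hierarchicalTHC Δ α k)
      (ruleAlgorithm Δ k (fun _ => 0) s fun n => n) := by
    refine ⟨isDeterministic_ruleAlgorithm _ _ _ _, fun n G r => ?_⟩
    refine succeeds_ruleAlgorithm_of_eq_zero G r _ s _ hk rfl rfl ?_
    by_cases hnN : n ≤ N
    · simp only [hs, if_pos hnN]
      exact hnN.trans_lt (lt_floor_rpow_add_one_pow hk N)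
    · simp only [hs, if_neg hnN]
      exact (Nat.lt_succ_self n).trans_le (Nat.le_self_pow (by omega) _)
  have hcost : distCost Δ α (ruleAlgorithm Δ k (fun _ => 0) s fun n => n) N ≤
      (k * (2 * h + k + 3) : ℕ) := by
    refine iSup_le fun n => iSup_le fun hnN => iSup_le fun G => iSup_le fun r => iSup_le fun v =>
      iSup_le fun u => iSup_le fun hu => ?_
    have := (outputs_ruleAlgorithm G r (fun _ => 0) s (fun n => n) hk (fun v => wayCount_le _ _ _ v)
      (fun v => wayCount_le _ _ _ v) v).2 u hu
    simpa only [hs, if_pos hnN] using this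
  refine (ENat.toENNReal_le.2 ((iInf₂_le _ hsolve).trans hcost)).trans ?_
  rw [ENat.toENNReal_coe, ← ENNReal.ofReal_natCast]
  refine ENNReal.ofReal_le_ofReal ?_
  push_cast
  rw [mul_assoc]
  refine mul_le_mul_of_nonneg_left ?_ (by positivity)
  nlinarith [(Nat.cast_nonneg k : (0 : ℝ) ≤ k)]

theorem rDist_le_dDist {L Out : Type} (P : GraphProblem Δ α L Out) (C : ℝ) (n : ℕ) :
    RDist P C n ≤ DDist P n := by
  refine le_iInf₂ fun A hA => iInf₂_le A fun m G => ?_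
  have : {r | ¬ Succeeds P A G r} = ∅ := by ext r; simp [hA.2 m G r]
  rw [this, measure_empty]
  exact zero_le

theorem ruleCost_le (k s T l : ℕ) :
    ruleCost k s T l ≤ l * ((2 * T + 1) ^ l * (2 * (s * (4 * k + 3)) + 2)) := by
  induction l with
  | zero => simp [ruleCost]
  | succ l ih =>
    set A := 2 * (s * (4 * k + 3)) with hA
    set X := 2 * T + 1 with hX
    have h1 : 1 ≤ X ^ l := Nat.one_le_pow _ _ (by omega)
    have h2 : X ≤ X ^ (l + 1) := Nat.le_self_pow (by omega) _
    have h3 : A ≤ X ^ (l + 1) * A := Nat.le_mul_of_pos_left _ (by positivity)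
    calc ruleCost k s T (l + 1) = A + X * (ruleCost k s T l + 2) := rfl
      _ ≤ A + X * (l * (X ^ l * (A + 2)) + 2) := by gcongr
      _ = l * (X ^ (l + 1) * (A + 2)) + (A + 2 * X) := by ring
      _ ≤ l * (X ^ (l + 1) * (A + 2)) + (X ^ (l + 1) * A + 2 * X ^ (l + 1)) := by gcongr
      _ = (l + 1) * (X ^ (l + 1) * (A + 2)) := by ring

/-- The number of visited nodes, with the parameters of the randomized algorithm. -/
theorem volume_bound (hk : 1 ≤ k) {x ℓ : ℝ} (hx : 1 ≤ x) (hℓ : 1 ≤ ℓ) {h Λ : ℕ} (hh : h ≤ 2 * x)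
    (hΛ : Λ ≤ 4 * ℓ) :
    ((1 + (2 * k + ruleCost k (h + h * Λ) (6 * Λ + 8) k) : ℕ) : ℝ) ≤
      (1 + 2 * k + k * (65 ^ k * (20 * (4 * k + 3) + 2))) * (x * ℓ ^ (2 * k)) := by
  have h1 : ((ruleCost k (h + h * Λ) (6 * Λ + 8) k : ℕ) : ℝ) ≤
      k * ((2 * (6 * Λ + 8) + 1) ^ k * (2 * ((h + h * Λ) * (4 * k + 3)) + 2)) := by
    exact_mod_cast ruleCost_le k (h + h * Λ) (6 * Λ + 8) k
  have h2 : (2 * (6 * Λ + 8) + 1 : ℝ) ≤ 65 * ℓ := by linarith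
  have h3 : (h + h * Λ : ℝ) ≤ 10 * (x * ℓ) := by
    have h4 : (1 + Λ : ℝ) ≤ 5 * ℓ := by linarith
    calc (h + h * Λ : ℝ) = h * (1 + Λ) := by ring
      _ ≤ (2 * x) * (5 * ℓ) := by gcongr
      _ = 10 * (x * ℓ) := by ring
  have hxℓ : 1 ≤ x * ℓ := one_le_mul_of_one_le_of_one_le hx hℓ
  have h5 : (2 * ((h + h * Λ) * (4 * k + 3)) + 2 : ℝ) ≤ (20 * (4 * k + 3) + 2) * (x * ℓ) := by
    have : ((h + h * Λ) * (4 * k + 3) : ℝ) ≤ 10 * (x * ℓ) * (4 * k + 3) := by gcongr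
    linarith
  have h6 : ℓ ^ k * ℓ ≤ ℓ ^ (2 * k) := by
    rw [← pow_succ]; exact pow_le_pow_right₀ hℓ (by omega)
  have h7 : 1 ≤ x * ℓ ^ (2 * k) := one_le_mul_of_one_le_of_one_le hx (one_le_pow₀ hℓ)
  have h8 : (k : ℝ) * ((2 * (6 * Λ + 8) + 1) ^ k * (2 * ((h + h * Λ) * (4 * k + 3)) + 2)) ≤
      k * (65 ^ k * (20 * (4 * k + 3) + 2)) * (x * ℓ ^ (2 * k)) := by
    calc (k : ℝ) * ((2 * (6 * Λ + 8) + 1) ^ k * (2 * ((h + h * Λ) * (4 * k + 3)) + 2))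
        ≤ k * ((65 * ℓ) ^ k * ((20 * (4 * k + 3) + 2) * (x * ℓ))) := by gcongr
      _ = k * (65 ^ k * (20 * (4 * k + 3) + 2)) * (x * (ℓ ^ k * ℓ)) := by rw [mul_pow]; ring
      _ ≤ k * (65 ^ k * (20 * (4 * k + 3) + 2)) * (x * ℓ ^ (2 * k)) := by gcongr
  have h9 : (1 + 2 * k : ℝ) ≤ (1 + 2 * k) * (x * ℓ ^ (2 * k)) :=
    le_mul_of_one_le_right (by positivity) h7
  push_cast
  linarith

theorem isBigOh_rVol (Δ : ℕ) (α : ℝ) (hk : 1 ≤ k) {C : ℝ} (hC : 0 < C) :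
    IsBigOh (RVol (hierarchicalTHC Δ α k) C)
      (fun n => (n : ℝ) ^ (1 / (k : ℝ)) * Real.log n ^ (2 * k)) := by
  refine ⟨1 + 2 * k + k * (65 ^ k * (20 * (4 * k + 3) + 2)), by positivity, ?_⟩
  filter_upwards [eventually_ge_atTop 3, eventually_ge_atTop ⌈4 / C⌉₊] with N hN hNC
  have hN0 : (0 : ℝ) < N := by exact_mod_cast (by omega : 0 < N)
  set x : ℝ := (N : ℝ) ^ (1 / (k : ℝ)) with hx
  set ℓ := Real.log N with hℓ
  have hx1 : 1 ≤ x := Real.one_le_rpow (by exact_mod_cast (by omega : 1 ≤ N)) (by positivity)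
  have hℓ1 : 1 ≤ ℓ := by
    rw [hℓ, Real.le_log_iff_exp_le hN0]
    have : (3 : ℝ) ≤ N := by exact_mod_cast hN
    linarith [Real.exp_one_lt_d9]
  set h := ⌊x⌋₊ + 1 with hh
  have hhx : (h : ℝ) ≤ 2 * x := by
    have := Nat.floor_le (zero_le_one.trans hx1)
    rw [hh]; push_cast; linarith
  set Λ := ⌈3 * ℓ⌉₊ with hΛ
  have hΛ1 : (Λ : ℝ) ≤ 4 * ℓ := by
    have := Nat.ceil_lt_add_one (show 0 ≤ 3 * ℓ by linarith)
    linarith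
  -- with `Λ ≥ 3 log N`, the failure probability is at most `4 N / N ^ 3`
  have hexp : Real.exp (-Λ) ≤ 1 / (N : ℝ) ^ 3 := by
    have h1 : Real.exp (3 * ℓ) = (N : ℝ) ^ 3 := by
      have := Real.exp_nat_mul ℓ 3
      rw [hℓ, Real.exp_log hN0] at this
      rw [← this, hℓ]
      norm_num
    rw [← h1, one_div, ← Real.exp_neg]
    exact Real.exp_le_exp.2 (neg_le_neg (Nat.le_ceil _))
  -- a node is a way-point with probability about `1 / h`; on graphs with more than `N` nodes, where
  -- the cost does not matter, the algorithm is deterministic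
  set b : ℕ → ℕ := fun n => if n ≤ N then Nat.log 2 h else 0 with hb
  set s : ℕ → ℕ := fun n => if n ≤ N then h + h * Λ else n + 1 with hs
  set T : ℕ → ℕ := fun n => if n ≤ N then 6 * Λ + 8 else n with hT
  have hsolve : SolvesRand (hierarchicalTHC Δ α k) C (ruleAlgorithm Δ k b s T) := by
    intro n G
    by_cases hnN : n ≤ N
    · have hbn : b n = Nat.log 2 h := if_pos hnN
      have hsn : s n = h + h * Λ := if_pos hnN
      have hTn : T n = 6 * Λ + 8 := if_pos hnN
      have hsub := coinMeasure_not_hits_le G k (Λ := Λ)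
        (Nat.pow_log_le_self 2 (by omega : h ≠ 0)) (Nat.lt_pow_succ_log_self (by norm_num) h)
      rw [← hbn, ← hsn, ← hTn] at hsub
      refine le_trans (le_trans (measure_mono ?_) hsub) ?_
      · intro r hr hgood
        refine hr (succeeds_ruleAlgorithm G r b s T hk (q := h * Λ) (hsn.ge.trans (Nat.le_succ _))
          (hnN.trans_lt (lt_floor_rpow_add_one_pow hk N)) hgood.1 hgood.2.1
          hgood.2.2)
      · refine ENNReal.ofReal_le_ofReal ?_
        rcases Nat.eq_zero_or_pos n with rfl | hn
        · simp
        · have hn0 : (0 : ℝ) < n := by exact_mod_cast hn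
          have hnN' : (n : ℝ) ≤ N := by exact_mod_cast hnN
          rw [le_div_iff₀ hn0]
          have h4 : 4 ≤ C * N := by
            have := (Nat.le_ceil (4 / C)).trans (by exact_mod_cast hNC : (⌈4 / C⌉₊ : ℝ) ≤ N)
            rw [div_le_iff₀ hC] at this
            linarith
          calc 4 * n * Real.exp (-Λ) * n ≤ 4 * N * (1 / (N : ℝ) ^ 3) * N := by gcongr
            _ = 4 / N := by field_simp
            _ ≤ C := by rw [div_le_iff₀ hN0]; exact h4
    · have : {r | ¬ Succeeds (hierarchicalTHC Δ α k) (ruleAlgorithm Δ k b s T) G r} = ∅ := by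
        rw [Set.eq_empty_iff_forall_notMem]
        intro r hr
        refine hr (succeeds_ruleAlgorithm_of_eq_zero G r b s T hk (if_neg hnN) (if_neg hnN) ?_)
        simp only [hs, if_neg hnN]
        exact (Nat.lt_succ_self n).trans_le (Nat.le_self_pow (by omega) _)
      rw [this, measure_empty]
      exact zero_le
  have hcost : volCost Δ α (ruleAlgorithm Δ k b s T) N ≤
      (1 + (2 * k + ruleCost k (h + h * Λ) (6 * Λ + 8) k) : ℕ) := by
    refine iSup_le fun n => iSup_le fun hnN => iSup_le fun G => iSup_le fun r => iSup_le fun v => ?_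
    have := encard_visitedSet_ruleAlgorithm_le G r b s T hk v
    simpa only [hs, hT, if_pos hnN] using this
  refine (ENat.toENNReal_le.2 ((iInf₂_le _ hsolve).trans hcost)).trans ?_
  rw [ENat.toENNReal_coe, ← ENNReal.ofReal_natCast]
  exact ENNReal.ofReal_le_ofReal (volume_bound hk hx1 hℓ1 hhx hΛ1)

end Upper

end VolumeModel

theorem mainTheorem5 (Δ : ℕ) (hΔ : 3 ≤ Δ) (α : ℝ) (hα : 1 ≤ α) :
    (∀ k : ℕ, 1 ≤ k → ∀ C : ℝ, 0 < C →
      VolumeModel.IsBigTheta (VolumeModel.RDist (VolumeModel.hierarchicalTHC Δ α k) C)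
        (fun n => (n : ℝ) ^ (1 / (k : ℝ)))) ∧
    (∀ k : ℕ, 1 ≤ k →
      VolumeModel.IsBigTheta (VolumeModel.DDist (VolumeModel.hierarchicalTHC Δ α k))
        (fun n => (n : ℝ) ^ (1 / (k : ℝ)))) ∧
    (∃ a : ℕ, ∀ k : ℕ, 1 ≤ k → ∀ C : ℝ, 0 < C →
      VolumeModel.IsBigOh (VolumeModel.RVol (VolumeModel.hierarchicalTHC Δ α k) C)
        (fun n => (n : ℝ) ^ (1 / (k : ℝ)) * Real.log n ^ (a * k))) ∧
    (∃ c : ℝ, 0 < c ∧ ∀ k : ℕ, 1 ≤ k → ∀ᶠ n : ℕ in Filter.atTop,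
      ENNReal.ofReal (c * ((n : ℝ) / (k * Real.log n))) ≤
        (VolumeModel.DVol (VolumeModel.hierarchicalTHC Δ α k) n : ENNReal)) := by
  open VolumeModel in
  refine ⟨fun k hk C _ => ⟨?_, isBigOmega_rDist hΔ hα hk C⟩,
    fun k hk => ⟨isBigOh_dDist Δ α hk, ?_⟩,
    ⟨2, fun k hk C hC => isBigOh_rVol Δ α hk hC⟩,
    ⟨1 / 100, by norm_num, fun k hk => le_dVol hΔ hα hk⟩⟩
  · obtain ⟨c, hc, h⟩ := isBigOh_dDist Δ α hk
    exact ⟨c, hc, h.mono fun n hn => (ENat.toENNReal_le.2 (rDist_le_dDist _ C n)).trans hn⟩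
  · obtain ⟨c, hc, h⟩ := isBigOmega_rDist hΔ hα hk 1
    exact ⟨c, hc, h.mono fun n hn => hn.trans (ENat.toENNReal_le.2 (rDist_le_dDist _ 1 n))⟩
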